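/- Let $0<r_1<R_1<R_2<r_2$, $A,B\in\mathbb R$ with $B\neq 0$, $u(r)=Ar+B/r$ with $u(R_1)\neq u(R_2)$, $\gamma=-\int_{r_1}^{r_2}u(r)\,dr$, and $0<\alpha<1$. Let $\Theta\in C^\infty(\mathbb R)$ be a mollifier: $\Theta\ge 0$, $\Theta=0$ outside $(-1,1)$, $\int_{-1}^1\Theta=1$. For small $\kappa>0$ put $$\varphi_\kappa(z)=1-\frac{\int_{-1}^{z}\int_{-1+\kappa}^{1-\kappa}\Theta\left(\frac{x-w}{\kappa}\right)dw\,dx}{\int_{-1}^{1}\int_{-1+\kappa}^{1-\kappa}\Theta\left(\frac{x-w}{\kappa}\right)dw\,dx},\qquad |z|\le 1,$$ and for small $\varepsilon>0$ let $\varpi=2A+\varpi_{\varepsilon,\kappa}$, where $\varpi_{\varepsilon,\kappa}(r)$ equals $\varepsilon\varphi_\kappa\left(\frac{R_1-r}{\varepsilon}\right)$ for $|r-R_1|\le\varepsilon$, $\varepsilon$ for $R_1+\varepsilon<r<R_2-\varepsilon$, $\varepsilon\varphi_\kappa\left(\frac{r-R_2}{\varepsilon}\right)$ for $|r-R_2|\le\varepsilon$,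 and $0$ elsewhere. Let $$\phi(r)=C_\varpi\log\frac r{r_1}-\int_{r_1}^r\frac1s\int_{r_1}^s t\,\varpi(t)\,dt\,ds,$$ where the constant $C_\varpi$ is chosen so that $\phi(r_2)=\gamma$; thus $-(\phi''+\phi'/r)=\varpi$ and $\phi(r_1)=0$. Let $I_\varepsilon=(R_1-\varepsilon,R_1+\varepsilon)\cup(R_2-\varepsilon,R_2+\varepsilon)$ and $D_\varepsilon=I_\varepsilon\times\mathbb T$, with $\mathbb T=\mathbb R/2\pi\mathbb Z$. Let $X(D_\varepsilon)$ be the space of functions $h(r,\theta)$ on $D_\varepsilon$ with finite $C^{2,\alpha}$ norm that are even in $\theta$ and satisfy $\int_{\mathbb T}h(r,\theta)\,d\theta=0$ for all $r\in I_\varepsilon$. For $h\in X(D_\varepsilon)$ let $h_n(r)=\frac1\pi\int_{-\pi}^{\pi}h(r,\theta)\cos(n\theta)\,d\theta$, and for $\lambda\in\mathbb R$ put $$\mathcal L_{\varepsilon,\kappa}[\lambda]h(r,\theta)=\sum_{n\ge1}\cos(n\theta)\,\mathcal L_n[\lambda]h_n(r),\qquad (r,\theta)\in D_\varepsilon,$$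 where, with $\mathcal S_n(x)=\sinh(n\log x)$, $$\mathcal L_n[\lambda]g(r)=(\phi'(r)+\lambda r)g(r)+\frac1n\int_{r_1}^{r}s\varpi'(s)\mathcal S_n(r/s)g(s)\,ds-\frac{\mathcal S_n(r/r_1)}{\mathcal S_n(r_2/r_1)}\,\frac1n\int_{r_1}^{r_2}s\varpi'(s)\mathcal S_n(r_2/s)g(s)\,ds.$$ The integrands are understood to vanish outside $I_\varepsilon$. **Theorem.** For every $M>1$ there are $\kappa_0,\varepsilon_0,C>0$ such that for all $0<\kappa<\kappa_0$ and all integers $1\le m<M$ there is $\lambda^1_{\kappa,m}\in\mathbb R$ with $|\lambda^1_{\kappa,m}|\le C$, and for all $0<\varepsilon<\varepsilon_0$ there are $\lambda_{\varepsilon,\kappa,m}\in\mathbb R$ and $h_{\varepsilon,\kappa,m}\in X(D_\varepsilon)$ with the following properties. 1. $|\lambda_{\varepsilon,\kappa,m}-\lambda_0-\lambda^1_{\kappa,m}\varepsilon|\le C\varepsilon^2$, where $\lambda_0=u(R_2)/R_2$. 2. $h_{\varepsilon,\kappa,m}$ is not identically zero, is $\frac{2\pi}m$-periodic in $\theta$,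 depends non-trivially on $\theta$ (for some $r\in I_\varepsilon$ the function $h_{\varepsilon,\kappa,m}(r,\cdot)$ is not constant), and is of class $C^\infty$ on $D_\varepsilon$ with derivatives of every order bounded on $D_\varepsilon$. 3. For every $g\in X(D_\varepsilon)$ the series defining $\mathcal L_{\varepsilon,\kappa}[\lambda_{\varepsilon,\kappa,m}]g$ converges absolutely at every point of $D_\varepsilon$, and $\{g\in X(D_\varepsilon):\mathcal L_{\varepsilon,\kappa}[\lambda_{\varepsilon,\kappa,m}]g=0\text{ on }D_\varepsilon\}=\operatorname{span}\{h_{\varepsilon,\kappa,m}\}$. Here $\varepsilon_0$ does not depend on $\kappa$. -/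

import Mathlib

open Set MeasureTheory
open scoped ContDiff NNReal

noncomputable section

namespace TaylorCouette

/-- Angular velocity component of the Taylor-Couette flow. -/
def uTC (A B r : ℝ) : ℝ := A * r + B / r

/-- The value on the outer circle of the stream function of the Taylor-Couette flow
which vanishes on the inner circle. -/
def circulation (A B r₁ r₂ : ℝ) : ℝ := -∫ r in r₁..r₂, uTC A B r

/-- `Θ` is a mollifier supported in `(-1, 1)`. -/
structure IsMollifier (Θ : ℝ → ℝ) : Prop where
  smooth : ContDiff ℝ ∞ Θ
  nonneg : ∀ z, 0 ≤ Θ z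
  support_subset : Function.support Θ ⊆ Ioo (-1) 1
  integral_eq_one : ∫ z in (-1 : ℝ)..1, Θ z = 1

/-- The inner integral `∫_{-1+κ}^{1-κ} Θ((z - w)/κ) dw` of the regularized profile. -/
def mollifiedStep (Θ : ℝ → ℝ) (κ z : ℝ) : ℝ :=
  ∫ w in (-1 + κ)..(1 - κ), Θ ((z - w) / κ)

/-- The smooth decreasing profile `φ_κ`, going from `1` at `-1` to `0` at `1`. -/
def profile (Θ : ℝ → ℝ) (κ z : ℝ) : ℝ :=
  1 - (∫ x in (-1 : ℝ)..z, mollifiedStep Θ κ x) / (∫ x in (-1 : ℝ)..1, mollifiedStep Θ κ x)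

/-- The smoothed trapezoid `ϖ_{ε,κ}`. -/
def trapezoid (Θ : ℝ → ℝ) (R₁ R₂ ε κ r : ℝ) : ℝ :=
  if r < R₁ - ε then 0
  else if r ≤ R₁ + ε then ε * profile Θ κ ((R₁ - r) / ε)
  else if r < R₂ - ε then ε
  else if r ≤ R₂ + ε then ε * profile Θ κ ((r - R₂) / ε)
  else 0

/-- The radial vorticity `ϖ = 2A + ϖ_{ε,κ}` of the background flow. -/
def vorticity (Θ : ℝ → ℝ) (A R₁ R₂ ε κ r : ℝ) : ℝ :=
  2 * A + trapezoid Θ R₁ R₂ ε κ r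

/-- The constant in the solution of the radial boundary value problem. -/
def streamConst (r₁ r₂ γ : ℝ) (ϖ : ℝ → ℝ) : ℝ :=
  (Real.log (r₂ / r₁))⁻¹ * (γ + (∫ s in r₁..r₂, 1 / s * (∫ t in r₁..s, t * ϖ t)))

/-- The solution `φ` of `-(φ'' + φ'/r) = ϖ`, `φ(r₁) = 0`, `φ(r₂) = γ`. -/
def stream (r₁ r₂ γ : ℝ) (ϖ : ℝ → ℝ) (r : ℝ) : ℝ :=
  streamConst r₁ r₂ γ ϖ * Real.log (r / r₁)
    - (∫ s in r₁..r, 1 / s * (∫ t in r₁..s, t * ϖ t))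

/-- `𝒮_n(x) = sinh(n log x)`. -/
def logSinh (n : ℕ) (x : ℝ) : ℝ := Real.sinh (n * Real.log x)

/-- The operator `ℒ_n[lam]` acting on the radial coefficient `g` of `cos(nθ)`. Functions `g` that
live on the support of `ϖ'` only are allowed: every value of `g` under the integrals is multiplied
by `ϖ'`. -/
def modeOp (r₁ r₂ γ : ℝ) (ϖ : ℝ → ℝ) (lam : ℝ) (n : ℕ) (g : ℝ → ℝ) (r : ℝ) : ℝ :=
  (deriv (stream r₁ r₂ γ ϖ) r + lam * r) * g r
    + 1 / (n : ℝ) * (∫ s in r₁..r, s * deriv ϖ s * logSinh n (r / s) * g s)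
    - logSinh n (r / r₁) / logSinh n (r₂ / r₁) *
        (1 / (n : ℝ) * (∫ s in r₁..r₂, s * deriv ϖ s * logSinh n (r₂ / s) * g s))

/-- The coefficient of `cos(nθ)`, `n ≥ 1`, in the angular Fourier series of `h`. -/
def cosCoeff (n : ℕ) (h : ℝ × ℝ → ℝ) (r : ℝ) : ℝ :=
  1 / Real.pi * (∫ θ in (-Real.pi)..Real.pi, h (r, θ) * Real.cos (n * θ))

/-- The term of order `n` of the series defining the linearized operator. -/
def linTerm (r₁ r₂ γ : ℝ) (ϖ : ℝ → ℝ) (lam : ℝ) (h : ℝ × ℝ → ℝ) (p : ℝ × ℝ) (n : ℕ) : ℝ :=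
  Real.cos (n * p.2) * modeOp r₁ r₂ γ ϖ lam n (cosCoeff n h) p.1

/-- The linearized operator `ℒ[lam] h = ∑_{n ≥ 1} cos(nθ) ℒ_n[lam] Π_n h`. -/
def linOp (r₁ r₂ γ : ℝ) (ϖ : ℝ → ℝ) (lam : ℝ) (h : ℝ × ℝ → ℝ) (p : ℝ × ℝ) : ℝ :=
  ∑' n : ℕ, linTerm r₁ r₂ γ ϖ lam h p (n + 1)

/-- The radial set `(R₁ - ε, R₁ + ε) ∪ (R₂ - ε, R₂ + ε)`. -/
def radii (R₁ R₂ ε : ℝ) : Set ℝ := Ioo (R₁ - ε) (R₁ + ε) ∪ Ioo (R₂ - ε) (R₂ + ε)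

/-- The domain `D_ε` in polar coordinates `(r, θ)`; functions on it are `2π`-periodic in the
real variable `θ`. -/
def dom (R₁ R₂ ε : ℝ) : Set (ℝ × ℝ) := radii R₁ R₂ ε ×ˢ univ

/-- `h` has a finite `C^{2,α}` norm on `D`; for the open sets `D` used here, values of `h`
outside `D` play no role. -/
structure IsC2Holder (α : ℝ≥0) (D : Set (ℝ × ℝ)) (h : ℝ × ℝ → ℝ) : Prop where
  contDiffOn : ContDiffOn ℝ 2 h D
  bounded : ∃ K : ℝ, ∀ k ≤ 2, ∀ p ∈ D, ‖iteratedFDeriv ℝ k h p‖ ≤ K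
  holder : ∃ K : ℝ≥0, HolderOnWith K α (iteratedFDeriv ℝ 2 h) D

/-- `h` is smooth on `D`, and its derivatives of every order are bounded on `D`. -/
structure IsCInfty (D : Set (ℝ × ℝ)) (h : ℝ × ℝ → ℝ) : Prop where
  contDiffOn : ContDiffOn ℝ ∞ h D
  bounded : ∀ k : ℕ, ∃ K : ℝ, ∀ p ∈ D, ‖iteratedFDeriv ℝ k h p‖ ≤ K

/-- The space `X(D_ε)`: functions of class `C^{2,α}` on `D_ε` which are `2π`-periodic and even in
the angle, with zero angular mean. Its elements are represented by functions on the plane, and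
two of them are the same element if they agree on `D_ε`. -/
structure MemX (α : ℝ≥0) (R₁ R₂ ε : ℝ) (h : ℝ × ℝ → ℝ) : Prop where
  isC2Holder : IsC2Holder α (dom R₁ R₂ ε) h
  periodic : ∀ r ∈ radii R₁ R₂ ε, ∀ θ : ℝ, h (r, θ + 2 * Real.pi) = h (r, θ)
  even : ∀ r ∈ radii R₁ R₂ ε, ∀ θ : ℝ, h (r, -θ) = h (r, θ)
  mean_zero : ∀ r ∈ radii R₁ R₂ ε, ∫ θ in (-Real.pi)..Real.pi, h (r, θ) = 0

end TaylorCouette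

end

namespace TaylorCouette

/-! The operator is diagonal in the angular modes. By `modeOp_eq`, `ℒ_n` multiplies by the speed
`d(r) = φ'(r) + λ r` and subtracts the Green potential of `W g`, where `W(s) = s ϖ'(s)`. If `d` has
no zero on the two closed intervals, the substitution `v = d g` turns `ℒ_n g = 0` into the Fredholm
equation `v(r) = ∫ W(s) G_n(r,s) v(s)/d(s) ds`.

Put `a = 2B/R₂³` (`slope`) and `λ = λ₀ + ε(μ - ψ)`, with `ψ` the normalized first-order velocity
correction at `R₂`. Near `R₁` the speed stays away from zero because `B ≠ 0`; at `r = R₂ + εz` it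
equals `ε r (a z + μ)` up to `O(ε²)`. With `μ = -|a|ν` and `ν ≥ 1 + δ`, the quotient `W/d` is
bounded near `R₁` and of size `1/ε` near `R₂`. Both intervals have length `2ε`, and `G_n` is bounded
and Lipschitz uniformly in `n`. Hence the integral operator is a rank-one operator, obtained by
freezing `s = R₂` in `G_n` on the outer interval, plus an operator of norm `O(ε)`
(`SpeedBound.smallKernel_bound`). A nonzero solution then forces `G_n(R₂,R₂) ∫ W/d = 1 + O(ε)`, the
integral being over the outer interval, and solutions are unique up to a factor (section `RankOne`).

Rescaling the outer interval gives `∫ W/d = Φ(ν) + O(ε)` with `Φ(ν) = ∫ ρ(z)/(|a|ν - a z) dz` and `ρ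
= -φ_κ'`. This function decreases strictly and tends to zero at infinity. Since `ρ ≥ 1/2` away from
the endpoints, it is logarithmically large near `ν = 1`, uniformly in small `κ`
(`exists_le_dispersion`). So `G_m(R₂,R₂) Φ(ν₁) = 1` has a root, which determines `λ¹`. The
intermediate value theorem in `ν` yields an exact solution of mode `m`, and the lower bound
`le_dispersion_sub` on the decrease of `Φ` places its parameter within `O(ε)` of `ν₁`.

The other modes have only the zero solution, because `1/G_n(R₂,R₂)` is a sum of two terms `n coth(n
c)` and increases strictly with `n`: the diagonal values are separated by a fixed gap
(`exists_le_abs_green_diag_sub`), and two modes cannot both satisfy the dispersion relation up to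
`O(ε)`. All constants come from bounds independent of `κ`, hence so does `ε₀`.

The kernel element is `(v/d) cos(mθ)`, smooth by bootstrapping in the Green potential. Conversely,
the cosine coefficients of a function in the kernel solve the mode equations, and completeness of
the cosines identifies it with a multiple of this element. -/

/-- The primitive of the mollifier. -/
noncomputable def moll (Θ : ℝ → ℝ) (x : ℝ) : ℝ := ∫ y in (-1 : ℝ)..x, Θ y

/-! ### Primitive of the mollifier and the mollified step -/

namespace IsMollifier
variable {Θ : ℝ → ℝ}

lemma eq_zero (hΘ : IsMollifier Θ) {z : ℝ} (hz : z ∉ Ioo (-1 : ℝ) 1) : Θ z = 0 := by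
  by_contra h
  exact hz (hΘ.support_subset h)

lemma intervalIntegrable (hΘ : IsMollifier Θ) (a b : ℝ) : IntervalIntegrable Θ volume a b :=
  hΘ.smooth.continuous.intervalIntegrable a b

lemma hasDerivAt_moll (hΘ : IsMollifier Θ) (x : ℝ) : HasDerivAt (moll Θ) (Θ x) x :=
  intervalIntegral.integral_hasDerivAt_right (hΘ.intervalIntegrable _ _)
    (hΘ.smooth.continuous.stronglyMeasurableAtFilter _ _) hΘ.smooth.continuous.continuousAt

end IsMollifier

lemma contDiff_of_hasDerivAt {f f' : ℝ → ℝ} (h : ∀ x, HasDerivAt f (f' x) x)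
    (hf' : ContDiff ℝ ∞ f') : ContDiff ℝ ∞ f := by
  rw [contDiff_infty_iff_deriv]
  refine ⟨fun x => (h x).differentiableAt, ?_⟩
  have : deriv f = f' := funext fun x => (h x).deriv
  rwa [this]

namespace IsMollifier
variable {Θ : ℝ → ℝ}

lemma contDiff_moll (hΘ : IsMollifier Θ) : ContDiff ℝ ∞ (moll Θ) :=
  contDiff_of_hasDerivAt hΘ.hasDerivAt_moll hΘ.smooth

lemma moll_of_le (hΘ : IsMollifier Θ) {x : ℝ} (hx : x ≤ -1) : moll Θ x = 0 := by
  unfold moll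
  rw [intervalIntegral.integral_congr (g := fun _ => 0)]
  · simp
  · intro y hy
    rw [uIcc_of_ge hx] at hy
    exact hΘ.eq_zero fun h => by linarith [h.1, hy.2]

lemma monotone_moll (hΘ : IsMollifier Θ) : Monotone (moll Θ) := by
  refine monotone_of_deriv_nonneg (fun x => (hΘ.hasDerivAt_moll x).differentiableAt) fun x => ?_
  rw [(hΘ.hasDerivAt_moll x).deriv]
  exact hΘ.nonneg x

lemma moll_of_ge (hΘ : IsMollifier Θ) {x : ℝ} (hx : 1 ≤ x) : moll Θ x = 1 := by
  unfold moll
  rw [← intervalIntegral.integral_add_adjacent_intervals (hΘ.intervalIntegrable (-1) 1)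
    (hΘ.intervalIntegrable 1 x), hΘ.integral_eq_one,
    intervalIntegral.integral_congr (a := 1) (b := x) (g := fun _ => 0)]
  · simp
  · intro y hy
    rw [uIcc_of_le hx] at hy
    exact hΘ.eq_zero fun h => by linarith [h.2, hy.1]

lemma moll_nonneg (hΘ : IsMollifier Θ) (x : ℝ) : 0 ≤ moll Θ x := by
  have h := hΘ.monotone_moll (min_le_left x (-1))
  rwa [hΘ.moll_of_le (min_le_right _ _)] at h

lemma moll_le_one (hΘ : IsMollifier Θ) (x : ℝ) : moll Θ x ≤ 1 := by
  have h := hΘ.monotone_moll (le_max_left x 1)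
  rwa [hΘ.moll_of_ge (le_max_right _ _)] at h

/-- Substituting `y = (z - w)/κ` leaves a difference of two values of `moll Θ`. Smoothness, sign,
size, plateau and support then follow from `moll Θ` being smooth, monotone and saturated at 0 and 1.
-/
lemma mollifiedStep_eq (hΘ : IsMollifier Θ) {κ : ℝ} (hκ : 0 < κ) (z : ℝ) :
    mollifiedStep Θ κ z
      = κ * (moll Θ ((z - (-1 + κ)) / κ) - moll Θ ((z - (1 - κ)) / κ)) := by
  unfold mollifiedStep moll
  rw [intervalIntegral.integral_interval_sub_left (hΘ.intervalIntegrable _ _)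
    (hΘ.intervalIntegrable _ _)]
  have := intervalIntegral.integral_comp_sub_div (a := -1 + κ) (b := 1 - κ) (fun y => Θ y)
    hκ.ne' (z / κ)
  rw [smul_eq_mul] at this
  simp only [sub_div] at this ⊢
  exact this

lemma contDiff_mollifiedStep (hΘ : IsMollifier Θ) {κ : ℝ} (hκ : 0 < κ) :
    ContDiff ℝ ∞ (mollifiedStep Θ κ) := by
  rw [funext (hΘ.mollifiedStep_eq hκ)]
  have := hΘ.contDiff_moll
  exact contDiff_const.mul ((this.comp (by fun_prop)).sub (this.comp (by fun_prop)))

lemma mollifiedStep_nonneg (hΘ : IsMollifier Θ) {κ : ℝ} (hκ : 0 < κ) (hκ' : κ ≤ 1 / 4) (z : ℝ) :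
    0 ≤ mollifiedStep Θ κ z := by
  rw [hΘ.mollifiedStep_eq hκ]
  refine mul_nonneg hκ.le (sub_nonneg.2 (hΘ.monotone_moll ?_))
  gcongr
  linarith

lemma mollifiedStep_le (hΘ : IsMollifier Θ) {κ : ℝ} (hκ : 0 < κ) (z : ℝ) :
    mollifiedStep Θ κ z ≤ κ := by
  rw [hΘ.mollifiedStep_eq hκ]
  nlinarith [hΘ.moll_nonneg ((z - (1 - κ)) / κ), hΘ.moll_le_one ((z - (-1 + κ)) / κ)]

lemma mollifiedStep_of_abs_le (hΘ : IsMollifier Θ) {κ : ℝ} (hκ : 0 < κ) {z : ℝ}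
    (hz : |z| ≤ 1 - 2 * κ) : mollifiedStep Θ κ z = κ := by
  rw [abs_le] at hz
  rw [hΘ.mollifiedStep_eq hκ, hΘ.moll_of_ge, hΘ.moll_of_le]
  · ring
  · rw [div_le_iff₀ hκ]; linarith
  · rw [le_div_iff₀ hκ]; linarith

lemma mollifiedStep_of_le_abs (hΘ : IsMollifier Θ) {κ : ℝ} (hκ : 0 < κ) (hκ' : κ ≤ 1 / 4) {z : ℝ}
    (hz : 1 ≤ |z|) : mollifiedStep Θ κ z = 0 := by
  rw [hΘ.mollifiedStep_eq hκ]
  rcases le_abs'.1 hz with h | h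
  · rw [hΘ.moll_of_le, hΘ.moll_of_le]
    · ring
    · rw [div_le_iff₀ hκ]; linarith
    · rw [div_le_iff₀ hκ]; linarith
  · rw [hΘ.moll_of_ge, hΘ.moll_of_ge]
    · ring
    · rw [le_div_iff₀ hκ]; linarith
    · rw [le_div_iff₀ hκ]; linarith

lemma integral_mollifiedStep_le (hΘ : IsMollifier Θ) {κ : ℝ} (hκ : 0 < κ) :
    ∫ x in (-1 : ℝ)..1, mollifiedStep Θ κ x ≤ 2 * κ := by
  have hc := (hΘ.contDiff_mollifiedStep hκ).continuous
  calc ∫ x in (-1 : ℝ)..1, mollifiedStep Θ κ x ≤ ∫ x in (-1 : ℝ)..1, κ :=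
        intervalIntegral.integral_mono_on (by norm_num) (hc.intervalIntegrable _ _)
          (by simp) fun x _ => hΘ.mollifiedStep_le hκ x
    _ = 2 * κ := by rw [intervalIntegral.integral_const, smul_eq_mul]; norm_num

/-- For `κ ≤ 1/4` the plateau of height `κ` contains `[-1/2, 1/2]`. -/
lemma le_integral_mollifiedStep (hΘ : IsMollifier Θ) {κ : ℝ} (hκ : 0 < κ) (hκ' : κ ≤ 1 / 4) :
    κ ≤ ∫ x in (-1 : ℝ)..1, mollifiedStep Θ κ x := by
  have hc := (hΘ.contDiff_mollifiedStep hκ).continuous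
  calc κ = ∫ x in (-(1 / 2) : ℝ)..(1 / 2), κ := by rw [intervalIntegral.integral_const, smul_eq_mul]; norm_num
    _ = ∫ x in (-(1 / 2) : ℝ)..(1 / 2), mollifiedStep Θ κ x := by
        refine intervalIntegral.integral_congr fun x hx => ?_
        rw [uIcc_of_le (by norm_num)] at hx
        refine (hΘ.mollifiedStep_of_abs_le hκ ?_).symm
        exact (abs_le.2 hx).trans (by linarith)
    _ ≤ ∫ x in (-1 : ℝ)..1, mollifiedStep Θ κ x := by
        refine intervalIntegral.integral_mono_interval (by norm_num) (by norm_num) (by norm_num)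
          (Filter.Eventually.of_forall fun x => hΘ.mollifiedStep_nonneg hκ hκ' x)
          (hc.intervalIntegrable _ _)

end IsMollifier

/-! ### The profile and its density -/

/-- The density `-φ_κ'` of the profile. -/
noncomputable def dens (Θ : ℝ → ℝ) (κ z : ℝ) : ℝ :=
  mollifiedStep Θ κ z / ∫ x in (-1 : ℝ)..1, mollifiedStep Θ κ x

namespace IsMollifier
variable {Θ : ℝ → ℝ} {κ : ℝ}

lemma contDiff_dens (hΘ : IsMollifier Θ) (hκ : 0 < κ) : ContDiff ℝ ∞ (dens Θ κ) :=
  (hΘ.contDiff_mollifiedStep hκ).div_const _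

lemma continuous_dens (hΘ : IsMollifier Θ) (hκ : 0 < κ) : Continuous (dens Θ κ) :=
  (hΘ.contDiff_dens hκ).continuous

lemma dens_nonneg (hΘ : IsMollifier Θ) (hκ : 0 < κ) (hκ' : κ ≤ 1 / 4) (z : ℝ) :
    0 ≤ dens Θ κ z :=
  div_nonneg (hΘ.mollifiedStep_nonneg hκ hκ' z) (hκ.le.trans (hΘ.le_integral_mollifiedStep hκ hκ'))

lemma dens_le_one (hΘ : IsMollifier Θ) (hκ : 0 < κ) (hκ' : κ ≤ 1 / 4) (z : ℝ) :
    dens Θ κ z ≤ 1 :=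
  div_le_one_of_le₀ ((hΘ.mollifiedStep_le hκ z).trans (hΘ.le_integral_mollifiedStep hκ hκ'))
    (hκ.le.trans (hΘ.le_integral_mollifiedStep hκ hκ'))

/-- The plateau value `κ` is divided by a total mass of at most `2κ`. This bound, free of `κ`, is
what makes the dispersion integral large near the edge. -/
lemma half_le_dens (hΘ : IsMollifier Θ) (hκ : 0 < κ) (hκ' : κ ≤ 1 / 4) {z : ℝ}
    (hz : |z| ≤ 1 - 2 * κ) : 1 / 2 ≤ dens Θ κ z := by
  unfold dens
  rw [hΘ.mollifiedStep_of_abs_le hκ hz,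
    le_div_iff₀ (hκ.trans_le (hΘ.le_integral_mollifiedStep hκ hκ'))]
  linarith [hΘ.integral_mollifiedStep_le hκ]

lemma dens_eq_zero (hΘ : IsMollifier Θ) (hκ : 0 < κ) (hκ' : κ ≤ 1 / 4) {z : ℝ}
    (hz : 1 ≤ |z|) : dens Θ κ z = 0 := by
  unfold dens
  rw [hΘ.mollifiedStep_of_le_abs hκ hκ' hz, zero_div]

lemma profile_eq (Θ : ℝ → ℝ) (κ z : ℝ) : profile Θ κ z = 1 - ∫ x in (-1 : ℝ)..z, dens Θ κ x := by
  unfold profile dens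
  rw [intervalIntegral.integral_div]

lemma integral_dens (hΘ : IsMollifier Θ) (hκ : 0 < κ) (hκ' : κ ≤ 1 / 4) :
    ∫ x in (-1 : ℝ)..1, dens Θ κ x = 1 := by
  unfold dens
  rw [intervalIntegral.integral_div]
  exact div_self (hκ.trans_le (hΘ.le_integral_mollifiedStep hκ hκ')).ne'

lemma hasDerivAt_profile (hΘ : IsMollifier Θ) (hκ : 0 < κ) (z : ℝ) :
    HasDerivAt (profile Θ κ) (-dens Θ κ z) z := by
  rw [funext (profile_eq Θ κ)]
  have hc := hΘ.continuous_dens hκ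
  exact (intervalIntegral.integral_hasDerivAt_right (hc.intervalIntegrable _ _)
    (hc.stronglyMeasurableAtFilter _ _) hc.continuousAt).const_sub 1

lemma profile_of_le (hΘ : IsMollifier Θ) (hκ : 0 < κ) (hκ' : κ ≤ 1 / 4) {z : ℝ} (hz : z ≤ -1) :
    profile Θ κ z = 1 := by
  rw [profile_eq, intervalIntegral.integral_congr (g := fun _ => 0)]
  · simp
  · intro y hy
    rw [uIcc_of_ge hz] at hy
    exact hΘ.dens_eq_zero hκ hκ' (le_abs'.2 (Or.inl hy.2))

lemma profile_of_ge (hΘ : IsMollifier Θ) (hκ : 0 < κ) (hκ' : κ ≤ 1 / 4) {z : ℝ} (hz : 1 ≤ z) :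
    profile Θ κ z = 0 := by
  have hc := hΘ.continuous_dens hκ
  rw [profile_eq, ← intervalIntegral.integral_add_adjacent_intervals
    (hc.intervalIntegrable (-1) 1) (hc.intervalIntegrable 1 z), hΘ.integral_dens hκ hκ',
    intervalIntegral.integral_congr (a := 1) (b := z) (g := fun _ => 0)]
  · simp
  · intro y hy
    rw [uIcc_of_le hz] at hy
    exact hΘ.dens_eq_zero hκ hκ' (le_abs'.2 (Or.inr hy.1))

lemma antitone_profile (hΘ : IsMollifier Θ) (hκ : 0 < κ) (hκ' : κ ≤ 1 / 4) :
    Antitone (profile Θ κ) := by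
  refine antitone_of_deriv_nonpos
    (fun x => (hΘ.hasDerivAt_profile hκ x).differentiableAt) fun x => ?_
  rw [(hΘ.hasDerivAt_profile hκ x).deriv]
  simpa using hΘ.dens_nonneg hκ hκ' x

lemma profile_nonneg (hΘ : IsMollifier Θ) (hκ : 0 < κ) (hκ' : κ ≤ 1 / 4) (z : ℝ) :
    0 ≤ profile Θ κ z := by
  have h := hΘ.antitone_profile hκ hκ' (le_max_left z 1)
  rwa [hΘ.profile_of_ge hκ hκ' (le_max_right _ _)] at h

lemma profile_le_one (hΘ : IsMollifier Θ) (hκ : 0 < κ) (hκ' : κ ≤ 1 / 4) (z : ℝ) :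
    profile Θ κ z ≤ 1 := by
  have h := hΘ.antitone_profile hκ hκ' (min_le_left z (-1))
  rwa [hΘ.profile_of_le hκ hκ' (min_le_right _ _)] at h

/-! ### The trapezoidal vorticity -/

variable {R₁ R₂ ε A : ℝ}

/-- Outside its own ramp each profile is saturated at 0 or 1, so a single formula covers all five
branches; the derivative and smoothness across the branch points can be read off from it. -/
lemma trapezoid_eq (hΘ : IsMollifier Θ) (hκ : 0 < κ) (hκ' : κ ≤ 1 / 4) (hε : 0 < ε)
    (hεR : 2 * ε < R₂ - R₁) (r : ℝ) :
    trapezoid Θ R₁ R₂ ε κ r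
      = ε * (profile Θ κ ((R₁ - r) / ε) + profile Θ κ ((r - R₂) / ε) - 1) := by
  unfold trapezoid
  have h1 : R₁ + ε < r → profile Θ κ ((R₁ - r) / ε) = 1 := fun h =>
    hΘ.profile_of_le hκ hκ' (by rw [div_le_iff₀ hε]; linarith)
  have h2 : r < R₁ - ε → profile Θ κ ((R₁ - r) / ε) = 0 := fun h =>
    hΘ.profile_of_ge hκ hκ' (by rw [le_div_iff₀ hε]; linarith)
  have h3 : r < R₂ - ε → profile Θ κ ((r - R₂) / ε) = 1 := fun h =>
    hΘ.profile_of_le hκ hκ' (by rw [div_le_iff₀ hε]; linarith)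
  have h4 : R₂ + ε < r → profile Θ κ ((r - R₂) / ε) = 0 := fun h =>
    hΘ.profile_of_ge hκ hκ' (by rw [le_div_iff₀ hε]; linarith)
  split_ifs with a b c d
  · rw [h2 a, h3 (by linarith)]; ring
  · rw [h3 (by linarith)]; ring
  · rw [h1 (by linarith), h3 c]; ring
  · rw [h1 (by linarith)]; ring
  · rw [h1 (by linarith), h4 (by linarith)]; ring

lemma hasDerivAt_trapezoid (hΘ : IsMollifier Θ) (hκ : 0 < κ) (hκ' : κ ≤ 1 / 4) (hε : 0 < ε)
    (hεR : 2 * ε < R₂ - R₁) (r : ℝ) :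
    HasDerivAt (trapezoid Θ R₁ R₂ ε κ)
      (dens Θ κ ((R₁ - r) / ε) - dens Θ κ ((r - R₂) / ε)) r := by
  rw [funext (hΘ.trapezoid_eq hκ hκ' hε hεR)]
  have e1 : HasDerivAt (fun r : ℝ => (R₁ - r) / ε) (-1 / ε) r :=
    ((hasDerivAt_id r).const_sub R₁).div_const ε
  have e2 : HasDerivAt (fun r : ℝ => (r - R₂) / ε) (1 / ε) r :=
    ((hasDerivAt_id r).sub_const R₂).div_const ε
  have := ((((hΘ.hasDerivAt_profile hκ _).comp r e1).add
    ((hΘ.hasDerivAt_profile hκ _).comp r e2)).sub_const 1).const_mul ε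
  refine this.congr_deriv ?_
  have := hε.ne'
  field_simp
  ring

lemma contDiff_trapezoid (hΘ : IsMollifier Θ) (hκ : 0 < κ) (hκ' : κ ≤ 1 / 4) (hε : 0 < ε)
    (hεR : 2 * ε < R₂ - R₁) : ContDiff ℝ ∞ (trapezoid Θ R₁ R₂ ε κ) := by
  have := hΘ.contDiff_dens hκ
  exact contDiff_of_hasDerivAt (hΘ.hasDerivAt_trapezoid hκ hκ' hε hεR)
    ((this.comp (by fun_prop)).sub (this.comp (by fun_prop)))

lemma contDiff_vorticity (hΘ : IsMollifier Θ) (hκ : 0 < κ) (hκ' : κ ≤ 1 / 4) (hε : 0 < ε)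
    (hεR : 2 * ε < R₂ - R₁) : ContDiff ℝ ∞ (vorticity Θ A R₁ R₂ ε κ) :=
  contDiff_const.add (hΘ.contDiff_trapezoid hκ hκ' hε hεR)

lemma deriv_vorticity (hΘ : IsMollifier Θ) (hκ : 0 < κ) (hκ' : κ ≤ 1 / 4) (hε : 0 < ε)
    (hεR : 2 * ε < R₂ - R₁) (r : ℝ) :
    deriv (vorticity Θ A R₁ R₂ ε κ) r
      = dens Θ κ ((R₁ - r) / ε) - dens Θ κ ((r - R₂) / ε) :=
  ((hΘ.hasDerivAt_trapezoid hκ hκ' hε hεR r).const_add (2 * A)).deriv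

lemma contDiff_deriv_vorticity (hΘ : IsMollifier Θ) (hκ : 0 < κ) (hκ' : κ ≤ 1 / 4) (hε : 0 < ε)
    (hεR : 2 * ε < R₂ - R₁) : ContDiff ℝ ∞ (deriv (vorticity Θ A R₁ R₂ ε κ)) :=
  (contDiff_infty_iff_deriv.1 (hΘ.contDiff_vorticity hκ hκ' hε hεR)).2

lemma trapezoid_nonneg (hΘ : IsMollifier Θ) (hκ : 0 < κ) (hκ' : κ ≤ 1 / 4) (hε : 0 < ε)
    (r : ℝ) : 0 ≤ trapezoid Θ R₁ R₂ ε κ r := by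
  unfold trapezoid
  have := hΘ.profile_nonneg hκ hκ'
  split_ifs <;> first | exact le_rfl | exact hε.le | exact mul_nonneg hε.le (this _)

lemma trapezoid_le (hΘ : IsMollifier Θ) (hκ : 0 < κ) (hκ' : κ ≤ 1 / 4) (hε : 0 < ε)
    (r : ℝ) : trapezoid Θ R₁ R₂ ε κ r ≤ ε := by
  unfold trapezoid
  have := hΘ.profile_le_one hκ hκ'
  split_ifs <;> first | exact le_rfl | exact hε.le | exact mul_le_of_le_one_right hε.le (this _)

/-- The trapezoid differs from a step function only near the two jumps. -/
lemma abs_trapezoid_sub_le (hΘ : IsMollifier Θ) (hκ : 0 < κ) (hκ' : κ ≤ 1 / 4) (hε : 0 < ε)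
    (hεR : 2 * ε < R₂ - R₁) (r : ℝ) :
    |trapezoid Θ R₁ R₂ ε κ r - ε * (Icc R₁ R₂).indicator 1 r|
      ≤ ε * ((Icc (R₁ - ε) (R₁ + ε)).indicator 1 r + (Icc (R₂ - ε) (R₂ + ε)).indicator 1 r) := by
  have h0 := hΘ.trapezoid_nonneg (R₁ := R₁) (R₂ := R₂) hκ hκ' hε r
  have h1 := hΘ.trapezoid_le (R₁ := R₁) (R₂ := R₂) hκ hκ' hε r
  have hI : ∀ s : Set ℝ, (0 : ℝ) ≤ s.indicator 1 r := fun s =>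
    indicator_nonneg (fun _ _ => zero_le_one) r
  have hI' : (Icc R₁ R₂).indicator (1 : ℝ → ℝ) r ≤ 1 := indicator_le_self' (by simp) r
  have habs : |trapezoid Θ R₁ R₂ ε κ r - ε * (Icc R₁ R₂).indicator 1 r| ≤ ε := by
    rw [abs_le]
    constructor <;> nlinarith [hI (Icc R₁ R₂)]
  by_cases ha : r ∈ Icc (R₁ - ε) (R₁ + ε)
  · rw [indicator_of_mem ha]
    simp only [Pi.one_apply]
    nlinarith [hI (Icc (R₂ - ε) (R₂ + ε))]
  by_cases hb : r ∈ Icc (R₂ - ε) (R₂ + ε)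
  · rw [indicator_of_mem hb]
    simp only [Pi.one_apply]
    nlinarith [hI (Icc (R₁ - ε) (R₁ + ε))]
  rw [indicator_of_notMem ha, indicator_of_notMem hb]
  simp only [mem_Icc, not_and_or, not_le] at ha hb
  have : trapezoid Θ R₁ R₂ ε κ r = ε * (Icc R₁ R₂).indicator 1 r := by
    unfold trapezoid
    by_cases hc : r ∈ Icc R₁ R₂
    · rw [indicator_of_mem hc]
      have : R₁ + ε < r := by rcases ha with h | h <;> linarith [hc.1]
      have : r < R₂ - ε := by rcases hb with h | h <;> linarith [hc.2]
      rw [if_neg (by linarith), if_neg (by linarith), if_pos this]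
      simp
    · rw [indicator_of_notMem hc]
      simp only [mem_Icc, not_and_or, not_le] at hc
      rcases hc with h | h
      · rw [if_pos (by rcases ha with h | h <;> linarith)]; simp
      · have : R₂ + ε < r := by rcases hb with h | h <;> linarith
        rw [if_neg (by linarith), if_neg (by linarith), if_neg (by linarith),
          if_neg (by linarith)]; simp
  rw [this]
  simp

end IsMollifier
-- Velocity of the radial background flow
/-- The closed `ε`-neighbourhoods of the two radii are disjoint and lie inside the annulus. -/
structure Admissible (r₁ r₂ R₁ R₂ ε : ℝ) : Prop where
  r₁_pos : 0 < r₁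
  pos : 0 < ε
  left : r₁ < R₁ - ε
  mid : 2 * ε < R₂ - R₁
  right : R₂ + ε < r₂

/-- The first moment `∫_{r₁}^r t τ(t) dt`. -/
noncomputable def moment (r₁ : ℝ) (τ : ℝ → ℝ) (r : ℝ) : ℝ := ∫ t in r₁..r, t * τ t

/-- `r` times the velocity perturbation produced by the vorticity perturbation `τ`. -/
noncomputable def velCorr (r₁ r₂ : ℝ) (τ : ℝ → ℝ) (r : ℝ) : ℝ :=
  (Real.log (r₂ / r₁))⁻¹ * (∫ s in r₁..r₂, 1 / s * moment r₁ τ s) - moment r₁ τ r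

lemma continuous_moment {r₁ : ℝ} {τ : ℝ → ℝ} (hτ : Continuous τ) : Continuous (moment r₁ τ) :=
  intervalIntegral.continuous_primitive
    (fun a b => (continuous_id.mul hτ).intervalIntegrable a b) r₁

lemma hasDerivAt_moment {r₁ : ℝ} {τ : ℝ → ℝ} (hτ : Continuous τ) (r : ℝ) :
    HasDerivAt (moment r₁ τ) (r * τ r) r :=
  intervalIntegral.integral_hasDerivAt_right ((continuous_id.mul hτ).intervalIntegrable _ _)
    ((continuous_id.mul hτ).stronglyMeasurableAtFilter _ _) (continuous_id.mul hτ).continuousAt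

lemma intervalIntegrable_inv_mul_moment {r₁ a b : ℝ} {τ : ℝ → ℝ}
    (hτ : Continuous (moment r₁ τ)) (ha : 0 < a) (hb : 0 < b) :
    IntervalIntegrable (fun s => 1 / s * moment r₁ τ s) volume a b := by
  refine ContinuousOn.intervalIntegrable fun s hs => ?_
  have hs0 : 0 < s := (lt_min ha hb).trans_le hs.1
  exact ((continuousAt_const.div continuousAt_id hs0.ne').mul
    hτ.continuousAt).continuousWithinAt

lemma hasDerivAt_stream {r₁ r₂ γ r : ℝ} {ϖ : ℝ → ℝ} (hϖ : Continuous ϖ) (h₁ : 0 < r₁)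
    (hr : 0 < r) :
    HasDerivAt (stream r₁ r₂ γ ϖ)
      (streamConst r₁ r₂ γ ϖ / r - 1 / r * moment r₁ ϖ r) r := by
  have hm := continuous_moment (r₁ := r₁) hϖ
  have e1 : HasDerivAt (fun r : ℝ => Real.log (r / r₁)) (1 / r) r := by
    have := ((hasDerivAt_id r).div_const r₁).log (div_pos hr h₁).ne'
    refine this.congr_deriv ?_
    have := hr.ne'
    have := h₁.ne'
    simp only [id]
    field_simp
  have e2 : HasDerivAt (fun r : ℝ => ∫ s in r₁..r, 1 / s * moment r₁ ϖ s)
      (1 / r * moment r₁ ϖ r) r := by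
    have hc : ContinuousOn (fun s => 1 / s * moment r₁ ϖ s) (Ioi 0) := fun s hs =>
      ((continuousAt_const.div continuousAt_id (ne_of_gt hs)).mul
        hm.continuousAt).continuousWithinAt
    exact intervalIntegral.integral_hasDerivAt_right
      (intervalIntegrable_inv_mul_moment hm h₁ hr)
      (hc.stronglyMeasurableAtFilter isOpen_Ioi r hr) (hc.continuousAt (Ioi_mem_nhds hr))
  refine ((e1.const_mul (streamConst r₁ r₂ γ ϖ)).sub e2).congr_deriv ?_
  ring

lemma moment_const (r₁ A r : ℝ) : moment r₁ (fun _ => 2 * A) r = A * (r ^ 2 - r₁ ^ 2) := by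
  unfold moment
  rw [intervalIntegral.integral_mul_const, integral_id]
  ring

lemma integral_inv_mul_moment_const {r₁ r₂ : ℝ} (A : ℝ) (h₁ : 0 < r₁) (h₂ : 0 < r₂) :
    ∫ s in r₁..r₂, 1 / s * (A * (s ^ 2 - r₁ ^ 2))
      = A * (r₂ ^ 2 - r₁ ^ 2) / 2 - A * r₁ ^ 2 * Real.log (r₂ / r₁) := by
  have hs : ∀ s ∈ uIcc r₁ r₂, 0 < s := fun s hs => (lt_min h₁ h₂).trans_le hs.1
  have : ∀ s ∈ uIcc r₁ r₂,
      1 / s * (A * (s ^ 2 - r₁ ^ 2)) = A * s - A * r₁ ^ 2 * (1 / s) := fun s h => by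
    have := (hs s h).ne'
    field_simp
  rw [intervalIntegral.integral_congr this, intervalIntegral.integral_sub,
    intervalIntegral.integral_const_mul, intervalIntegral.integral_const_mul, integral_id,
    integral_one_div_of_pos h₁ h₂]
  · ring
  · exact (continuous_const.mul continuous_id).intervalIntegrable _ _
  · refine ContinuousOn.intervalIntegrable fun s h => ?_
    exact (continuousAt_const.mul
      (continuousAt_const.div continuousAt_id (hs s h).ne')).continuousWithinAt

lemma circulation_eq {r₁ r₂ : ℝ} (A B : ℝ) (h₁ : 0 < r₁) (h₂ : 0 < r₂) :
    circulation A B r₁ r₂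
      = -(A * (r₂ ^ 2 - r₁ ^ 2) / 2) - B * Real.log (r₂ / r₁) := by
  have hs : ∀ s ∈ uIcc r₁ r₂, 0 < s := fun s hs => (lt_min h₁ h₂).trans_le hs.1
  have : ∀ s ∈ uIcc r₁ r₂, uTC A B s = A * s + B * (1 / s) := fun s h => by
    unfold uTC; ring
  unfold circulation
  rw [intervalIntegral.integral_congr this, intervalIntegral.integral_add,
    intervalIntegral.integral_const_mul, intervalIntegral.integral_const_mul, integral_id,
    integral_one_div_of_pos h₁ h₂]
  · ring
  · exact (continuous_const.mul continuous_id).intervalIntegrable _ _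
  · refine ContinuousOn.intervalIntegrable fun s h => ?_
    exact (continuousAt_const.mul
      (continuousAt_const.div continuousAt_id (hs s h).ne')).continuousWithinAt

/-- The velocity of the perturbed flow. -/
lemma deriv_stream_eq {r₁ r₂ r : ℝ} (A B : ℝ) {τ : ℝ → ℝ} (hτ : Continuous τ) (h₁ : 0 < r₁)
    (h₂ : r₁ < r₂) (hr : 0 < r) :
    deriv (stream r₁ r₂ (circulation A B r₁ r₂) (fun s => 2 * A + τ s)) r
      = -uTC A B r + velCorr r₁ r₂ τ r / r := by
  have h0 : 0 < r₂ := h₁.trans h₂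
  have hL : Real.log (r₂ / r₁) ≠ 0 :=
    (Real.log_pos (by rwa [one_lt_div h₁])).ne'
  have hm : ∀ s, moment r₁ (fun s => 2 * A + τ s) s
      = A * (s ^ 2 - r₁ ^ 2) + moment r₁ τ s := fun s => by
    rw [← moment_const]
    unfold moment
    rw [← intervalIntegral.integral_add]
    · simp only [mul_add]
    · exact (continuous_id.mul continuous_const).intervalIntegrable _ _
    · exact (continuous_id.mul hτ).intervalIntegrable _ _
  have hC : streamConst r₁ r₂ (circulation A B r₁ r₂) (fun s => 2 * A + τ s)
      = -B - A * r₁ ^ 2 + (Real.log (r₂ / r₁))⁻¹ * ∫ s in r₁..r₂, 1 / s * moment r₁ τ s := by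
    have : ∫ s in r₁..r₂, 1 / s * (∫ t in r₁..s, t * (2 * A + τ t))
        = (∫ s in r₁..r₂, 1 / s * (A * (s ^ 2 - r₁ ^ 2)))
          + ∫ s in r₁..r₂, 1 / s * moment r₁ τ s := by
      rw [← intervalIntegral.integral_add]
      · refine intervalIntegral.integral_congr fun s _ => ?_
        have := hm s
        unfold moment at this ⊢
        simp only [this]
        ring
      · refine ContinuousOn.intervalIntegrable fun s hs => ?_
        have hs0 : 0 < s := (lt_min h₁ h0).trans_le hs.1
        exact ((continuousAt_const.div continuousAt_id hs0.ne').mul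
          (by fun_prop)).continuousWithinAt
      · exact intervalIntegrable_inv_mul_moment (continuous_moment hτ) h₁ h0
    unfold streamConst
    rw [this, integral_inv_mul_moment_const A h₁ h0, circulation_eq A B h₁ h0]
    field_simp
    ring
  have hϖ : Continuous fun s => 2 * A + τ s := continuous_const.add hτ
  rw [(hasDerivAt_stream hϖ h₁ hr).deriv, hC, hm]
  unfold uTC velCorr
  field_simp
  ring

lemma contDiffOn_deriv_stream {r₁ r₂ γ : ℝ} {ϖ : ℝ → ℝ} (hϖ : ContDiff ℝ ∞ ϖ) (h₁ : 0 < r₁) :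
    ContDiffOn ℝ ∞ (deriv (stream r₁ r₂ γ ϖ)) (Ioi 0) := by
  have hm : ContDiff ℝ ∞ (moment r₁ ϖ) :=
    contDiff_of_hasDerivAt (hasDerivAt_moment hϖ.continuous) (contDiff_id.mul hϖ)
  have : ContDiffOn ℝ ∞
      (fun r => streamConst r₁ r₂ γ ϖ / r - 1 / r * moment r₁ ϖ r) (Ioi 0) := by
    have hi : ∀ c : ℝ, ContDiffOn ℝ ∞ (fun r => c / r) (Ioi 0) := fun c =>
      contDiffOn_const.div contDiffOn_id fun r hr => ne_of_gt hr
    exact (hi _).sub ((hi _).mul hm.contDiffOn)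
  exact this.congr fun r hr => (hasDerivAt_stream hϖ.continuous h₁ hr).deriv

/-! ### First-order expansion of the velocity in ε -/

section Estimates

variable {r₁ r₂ : ℝ}

lemma abs_moment_sub_le {f g h : ℝ → ℝ} (h₁ : 0 < r₁) (hf : IntervalIntegrable f volume r₁ r₂)
    (hg : IntervalIntegrable g volume r₁ r₂) (hh : IntervalIntegrable h volume r₁ r₂)
    (hfg : ∀ r, |f r - g r| ≤ h r) {r : ℝ} (hr : r ∈ Icc r₁ r₂) :
    |moment r₁ f r - moment r₁ g r| ≤ r₂ * ∫ t in r₁..r₂, h t := by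
  have hsub : uIcc r₁ r ⊆ uIcc r₁ r₂ := by
    rw [uIcc_of_le hr.1, uIcc_of_le (hr.1.trans hr.2)]
    exact Icc_subset_Icc_right hr.2
  have hf' := hf.mono_set hsub
  have hg' := hg.mono_set hsub
  have hh' := hh.mono_set hsub
  have hi : ∀ τ : ℝ → ℝ, IntervalIntegrable τ volume r₁ r →
      IntervalIntegrable (fun t => t * τ t) volume r₁ r := fun τ hτ =>
    hτ.continuousOn_mul continuousOn_id
  unfold moment
  rw [← intervalIntegral.integral_sub (hi f hf') (hi g hg'), ← Real.norm_eq_abs]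
  have hpos : ∀ t, 0 ≤ h t := fun t => (abs_nonneg _).trans (hfg t)
  calc ‖∫ t in r₁..r, (t * f t - t * g t)‖ ≤ ∫ t in r₁..r, r₂ * h t := by
        refine intervalIntegral.norm_integral_le_of_norm_le hr.1
          (Filter.Eventually.of_forall fun t ht => ?_) (hh'.const_mul _)
        have ht0 : 0 < t := h₁.trans ht.1
        rw [← mul_sub, norm_mul, Real.norm_of_nonneg ht0.le, Real.norm_eq_abs]
        exact mul_le_mul (ht.2.trans hr.2) (hfg t) (abs_nonneg _) (ht0.le.trans (ht.2.trans hr.2))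
    _ ≤ ∫ t in r₁..r₂, r₂ * h t := by
        refine intervalIntegral.integral_mono_interval le_rfl hr.1 hr.2
          (Filter.Eventually.of_forall fun t => mul_nonneg (h₁.le.trans (hr.1.trans hr.2)) (hpos t))
          (hh.const_mul _)
    _ = _ := intervalIntegral.integral_const_mul _ _

lemma continuousOn_moment {τ : ℝ → ℝ} (h : r₁ ≤ r₂) (hτ : IntervalIntegrable τ volume r₁ r₂) :
    ContinuousOn (moment r₁ τ) (Icc r₁ r₂) := by
  have := intervalIntegral.continuousOn_primitive_interval
    (μ := volume) (a := r₁) (b := r₂) (f := fun t => t * τ t) ?_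
  · rwa [uIcc_of_le h] at this
  · rw [uIcc_of_le h, integrableOn_Icc_iff_integrableOn_Ioc,
      ← intervalIntegrable_iff_integrableOn_Ioc_of_le h]
    exact hτ.continuousOn_mul continuousOn_id

/-- The velocity sees the vorticity only through integrals, so an `L¹` bound on the difference
controls it uniformly in `r`. -/
lemma abs_velCorr_sub_le {f g h : ℝ → ℝ} (h₁ : 0 < r₁) (h₂ : r₁ < r₂)
    (hf : IntervalIntegrable f volume r₁ r₂)
    (hg : IntervalIntegrable g volume r₁ r₂) (hh : IntervalIntegrable h volume r₁ r₂)
    (hfg : ∀ r, |f r - g r| ≤ h r) {r : ℝ} (hr : r ∈ Icc r₁ r₂) :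
    |velCorr r₁ r₂ f r - velCorr r₁ r₂ g r|
      ≤ ((Real.log (r₂ / r₁))⁻¹ * ((r₂ - r₁) / r₁) + 1) * (r₂ * ∫ t in r₁..r₂, h t) := by
  set I := r₂ * ∫ t in r₁..r₂, h t
  have hL : 0 < Real.log (r₂ / r₁) := Real.log_pos (by rwa [one_lt_div h₁])
  have hI : ∀ r ∈ Icc r₁ r₂, |moment r₁ f r - moment r₁ g r| ≤ I := fun r hr =>
    abs_moment_sub_le h₁ hf hg hh hfg hr
  have hint : ∀ τ : ℝ → ℝ, IntervalIntegrable τ volume r₁ r₂ →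
      IntervalIntegrable (fun s => 1 / s * moment r₁ τ s) volume r₁ r₂ := fun τ hτ => by
    refine ContinuousOn.intervalIntegrable ?_
    rw [uIcc_of_le h₂.le]
    refine ContinuousOn.mul ?_ (continuousOn_moment h₂.le hτ)
    exact continuousOn_const.div continuousOn_id fun x hx => (h₁.trans_le hx.1).ne'
  have hmain : |(∫ s in r₁..r₂, 1 / s * moment r₁ f s) - ∫ s in r₁..r₂, 1 / s * moment r₁ g s|
      ≤ (r₂ - r₁) / r₁ * I := by
    rw [← intervalIntegral.integral_sub (hint f hf) (hint g hg), ← Real.norm_eq_abs]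
    have := intervalIntegral.norm_integral_le_of_norm_le_const (a := r₁) (b := r₂)
      (f := fun s => 1 / s * moment r₁ f s - 1 / s * moment r₁ g s) (C := 1 / r₁ * I) ?_
    · refine this.trans (le_of_eq ?_)
      rw [abs_of_pos (sub_pos.2 h₂)]
      ring
    · intro s hs
      rw [uIoc_of_le h₂.le] at hs
      have hs0 : 0 < s := h₁.trans hs.1
      rw [← mul_sub, norm_mul, Real.norm_of_nonneg (by positivity), Real.norm_eq_abs]
      have := hI s ⟨hs.1.le, hs.2⟩
      have h3 : 1 / s ≤ 1 / r₁ := one_div_le_one_div_of_le h₁ hs.1.le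
      exact mul_le_mul h3 this (abs_nonneg _) (by positivity)
  have := hI r hr
  unfold velCorr
  rw [abs_le] at hmain this ⊢
  have h4 : 0 < (Real.log (r₂ / r₁))⁻¹ := inv_pos.2 hL
  constructor
  · nlinarith [mul_le_mul_of_nonneg_left hmain.1 h4.le]
  · nlinarith [mul_le_mul_of_nonneg_left hmain.2 h4.le]

lemma velCorr_const_mul (c : ℝ) (τ : ℝ → ℝ) (r : ℝ) :
    velCorr r₁ r₂ (fun t => c * τ t) r = c * velCorr r₁ r₂ τ r := by
  have : ∀ s, moment r₁ (fun t => c * τ t) s = c * moment r₁ τ s := fun s => by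
    unfold moment
    rw [← intervalIntegral.integral_const_mul]
    congr 1; ext t; ring
  have h2 : ∫ s in r₁..r₂, 1 / s * (c * moment r₁ τ s)
      = c * ∫ s in r₁..r₂, 1 / s * moment r₁ τ s := by
    rw [← intervalIntegral.integral_const_mul]
    exact intervalIntegral.integral_congr fun s _ => by ring
  unfold velCorr
  simp only [this, h2]
  ring

lemma intervalIntegrable_indicator_one (a b c d : ℝ) :
    IntervalIntegrable ((Icc c d).indicator (1 : ℝ → ℝ)) volume a b := by
  rw [intervalIntegrable_iff]
  refine Integrable.indicator ?_ measurableSet_Icc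
  have : IntervalIntegrable (fun _ : ℝ => (1 : ℝ)) volume a b := by simp
  rw [intervalIntegrable_iff] at this
  exact this

/-- The velocity correction of the limiting step function. -/
noncomputable def stepCorr (r₁ r₂ R₁ R₂ r : ℝ) : ℝ :=
  velCorr r₁ r₂ ((Icc R₁ R₂).indicator 1) r

/-- The trapezoid differs from `ε` times the step by at most `ε`, and only on two intervals of
length `2ε`: the `L¹` error is at most `4ε²`, whatever `κ` is. -/
lemma exists_abs_velCorr_trapezoid_sub_le {Θ : ℝ → ℝ} (hΘ : IsMollifier Θ) (h₁ : 0 < r₁)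
    (h₂ : r₁ < r₂) (R₁ R₂ : ℝ) :
    ∃ C > 0, ∀ κ ε : ℝ, 0 < κ → κ ≤ 1 / 4 → Admissible r₁ r₂ R₁ R₂ ε → ∀ r ∈ Icc r₁ r₂,
      |velCorr r₁ r₂ (trapezoid Θ R₁ R₂ ε κ) r - ε * stepCorr r₁ r₂ R₁ R₂ r| ≤ C * ε ^ 2 := by
  have h0 : 0 < r₂ := h₁.trans h₂
  have hL : 0 < (Real.log (r₂ / r₁))⁻¹ := inv_pos.2 (Real.log_pos (by rwa [one_lt_div h₁]))
  have hd : 0 < r₂ - r₁ := sub_pos.2 h₂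
  set K := ((Real.log (r₂ / r₁))⁻¹ * ((r₂ - r₁) / r₁) + 1)
  have hK : 0 < K := by positivity
  refine ⟨K * (r₂ * 4), by positivity, fun κ ε hκ hκ' hε r hr => ?_⟩
  have hi := intervalIntegrable_indicator_one r₁ r₂
  have hp := hε.pos
  have hl := hε.left
  have hm := hε.mid
  have hri := hε.right
  have := abs_velCorr_sub_le h₁ h₂
    ((hΘ.contDiff_trapezoid hκ hκ' hε.pos hε.mid).continuous.intervalIntegrable _ _)
    ((hi R₁ R₂).const_mul ε)
    (((hi (R₁ - ε) (R₁ + ε)).add (hi (R₂ - ε) (R₂ + ε))).const_mul ε)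
    (hΘ.abs_trapezoid_sub_le hκ hκ' hε.pos hε.mid) hr
  rw [velCorr_const_mul] at this
  refine this.trans (le_of_eq ?_)
  have hind : ∀ c, r₁ < c - ε → c + ε < r₂ →
      ∫ t in r₁..r₂, (Icc (c - ε) (c + ε)).indicator (1 : ℝ → ℝ) t = 2 * ε := fun c hc hc' => by
    rw [intervalIntegral.integral_of_le h₂.le, integral_indicator measurableSet_Icc,
      Measure.restrict_restrict measurableSet_Icc, inter_eq_left.2]
    · simp only [Pi.one_apply, integral_const, MeasurableSet.univ, measureReal_restrict_apply,
        univ_inter, Real.volume_real_Icc, smul_eq_mul, mul_one]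
      rw [max_eq_left] <;> linarith
    · exact fun x hx => ⟨hc.trans_le hx.1, hx.2.trans hc'.le⟩
  rw [intervalIntegral.integral_const_mul, intervalIntegral.integral_add (hi _ _) (hi _ _),
    hind R₁ (by linarith) (by linarith), hind R₂ (by linarith) (by linarith)]
  ring

/-- The constant term of `velCorr` cancels; what remains is the first moment of the step between `r`
and `r'`. -/
lemma abs_stepCorr_sub_le (h₁ : 0 < r₁) {R₁ R₂ r r' : ℝ} (hr : r ∈ Icc r₁ r₂)
    (hr' : r' ∈ Icc r₁ r₂) :
    |stepCorr r₁ r₂ R₁ R₂ r - stepCorr r₁ r₂ R₁ R₂ r'| ≤ r₂ * |r - r'| := by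
  have hi : ∀ a b, IntervalIntegrable
      (fun t => t * (Icc R₁ R₂).indicator (1 : ℝ → ℝ) t) volume a b := fun a b =>
    (intervalIntegrable_indicator_one a b R₁ R₂).continuousOn_mul continuousOn_id
  unfold stepCorr velCorr moment
  rw [sub_sub_sub_cancel_left, abs_sub_comm,
    intervalIntegral.integral_interval_sub_left (hi _ _) (hi _ _), ← Real.norm_eq_abs]
  refine intervalIntegral.norm_integral_le_of_norm_le_const fun t ht => ?_
  have ht0 : r₁ < t ∧ t ≤ r₂ :=
    ⟨(le_min hr'.1 hr.1).trans_lt ht.1, ht.2.trans (max_le hr'.2 hr.2)⟩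
  have : (Icc R₁ R₂).indicator (1 : ℝ → ℝ) t ≤ 1 := indicator_le_self' (by simp) t
  have h5 : (0 : ℝ) ≤ (Icc R₁ R₂).indicator (1 : ℝ → ℝ) t :=
    indicator_nonneg (fun _ _ => zero_le_one) t
  rw [norm_mul, Real.norm_of_nonneg (h₁.trans ht0.1).le, Real.norm_of_nonneg h5]
  nlinarith [ht0.1, ht0.2]

end Estimates

/-! ### The speed `φ' + λ r` near the two radii -/

section Speed

/-- The function `φ'(r) + λ r` with which `ℒ_n[λ]` multiplies. -/
noncomputable def speed (Θ : ℝ → ℝ) (r₁ r₂ R₁ R₂ A B ε κ lam r : ℝ) : ℝ :=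
  deriv (stream r₁ r₂ (circulation A B r₁ r₂) (vorticity Θ A R₁ R₂ ε κ)) r + lam * r

/-- The slope at `R₂`, relative to `R₂`, of `λ₀ r - u(r)`. -/
noncomputable def slope (B R₂ : ℝ) : ℝ := 2 * B / R₂ ^ 3

/-- The rescaled eigenvalue parameter: it makes `φ'(R₂) + λ R₂` equal to `ε μ R₂` up to
`O(ε²)`. -/
noncomputable def lamOf (r₁ r₂ R₁ R₂ A B ε μ : ℝ) : ℝ :=
  uTC A B R₂ / R₂ + ε * (μ - stepCorr r₁ r₂ R₁ R₂ R₂ / R₂ ^ 2)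

variable {Θ : ℝ → ℝ} {r₁ r₂ R₁ R₂ ε κ : ℝ}

lemma speed_eq (hΘ : IsMollifier Θ) (hκ : 0 < κ) (hκ' : κ ≤ 1 / 4)
    (hε : Admissible r₁ r₂ R₁ R₂ ε) (A B lam : ℝ) {r : ℝ} (hr : 0 < r) :
    speed Θ r₁ r₂ R₁ R₂ A B ε κ lam r
      = -uTC A B r + velCorr r₁ r₂ (trapezoid Θ R₁ R₂ ε κ) r / r + lam * r := by
  have h₁ := hε.left
  have h₂ := hε.mid
  have h₃ := hε.right
  have h₄ := hε.pos
  unfold speed vorticity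
  rw [deriv_stream_eq A B (hΘ.contDiff_trapezoid hκ hκ' hε.pos hε.mid).continuous hε.r₁_pos
    (by linarith) hr]

lemma contDiffOn_speed (hΘ : IsMollifier Θ) (hκ : 0 < κ) (hκ' : κ ≤ 1 / 4)
    (hε : Admissible r₁ r₂ R₁ R₂ ε) (A B lam : ℝ) :
    ContDiffOn ℝ ∞ (speed Θ r₁ r₂ R₁ R₂ A B ε κ lam) (Ioi 0) :=
  (contDiffOn_deriv_stream (hΘ.contDiff_vorticity hκ hκ' hε.pos hε.mid) hε.r₁_pos).add
    (contDiff_const.mul contDiff_id).contDiffOn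

/-- The rigid rotation `A r` cancels in `λ₀ r - u(r)`, leaving the term in `B`. Subtracting
`stepCorr R₂ / R₂²` in `lamOf` removes the order-`ε` correction at `R₂`, so the remainder is `O(ε²)`
plus `ε` times a function vanishing at `R₂`. -/
lemma speed_lamOf (hΘ : IsMollifier Θ) (hκ : 0 < κ) (hκ' : κ ≤ 1 / 4)
    (hε : Admissible r₁ r₂ R₁ R₂ ε) (A B μ : ℝ) (hR₂ : 0 < R₂) {r : ℝ} (hr : 0 < r) :
    speed Θ r₁ r₂ R₁ R₂ A B ε κ (lamOf r₁ r₂ R₁ R₂ A B ε μ) r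
      = r * (B / R₂ ^ 2 - B / r ^ 2) + r * (ε * μ)
        + ((velCorr r₁ r₂ (trapezoid Θ R₁ R₂ ε κ) r - ε * stepCorr r₁ r₂ R₁ R₂ r) / r
        + ε * ((stepCorr r₁ r₂ R₁ R₂ r - stepCorr r₁ r₂ R₁ R₂ R₂) / r
          + stepCorr r₁ r₂ R₁ R₂ R₂ * (1 / r - r / R₂ ^ 2))) := by
  rw [speed_eq hΘ hκ hκ' hε A B _ hr]
  unfold lamOf uTC
  field_simp
  ring

lemma exists_abs_speed_sub_le (hΘ : IsMollifier Θ) (A B : ℝ) (h₁ : 0 < r₁) (h₂ : r₁ < r₂)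
    (hR₂ : R₂ ∈ Icc r₁ r₂) :
    ∃ C > 0, ∀ κ ε μ : ℝ, 0 < κ → κ ≤ 1 / 4 → Admissible r₁ r₂ R₁ R₂ ε → ∀ r ∈ Icc r₁ r₂,
      |speed Θ r₁ r₂ R₁ R₂ A B ε κ (lamOf r₁ r₂ R₁ R₂ A B ε μ) r
          - (r * (B / R₂ ^ 2 - B / r ^ 2) + r * (ε * μ))| ≤ C * (ε ^ 2 + ε * |r - R₂|) := by
  obtain ⟨C₀, hC₀, hC⟩ := exists_abs_velCorr_trapezoid_sub_le hΘ h₁ h₂ R₁ R₂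
  have h0 : 0 < r₂ := h₁.trans h₂
  have hR₂0 : 0 < R₂ := h₁.trans_le hR₂.1
  set s := stepCorr r₁ r₂ R₁ R₂ R₂
  refine ⟨C₀ / r₁ + (r₂ / r₁ + |s| * (2 * r₂ / r₁ ^ 3)), by positivity,
    fun κ ε μ hκ hκ' hε r hr => ?_⟩
  have hr0 : 0 < r := h₁.trans_le hr.1
  have hp := hε.pos
  rw [speed_lamOf hΘ hκ hκ' hε A B μ hR₂0 hr0, add_sub_cancel_left]
  have e1 : |(velCorr r₁ r₂ (trapezoid Θ R₁ R₂ ε κ) r - ε * stepCorr r₁ r₂ R₁ R₂ r) / r|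
      ≤ C₀ / r₁ * ε ^ 2 := by
    rw [abs_div, abs_of_pos hr0]
    calc _ ≤ C₀ * ε ^ 2 / r₁ :=
          div_le_div₀ (by positivity) (hC κ ε hκ hκ' hε r hr) h₁ hr.1
      _ = _ := by ring
  have e2 : |(stepCorr r₁ r₂ R₁ R₂ r - s) / r| ≤ r₂ / r₁ * |r - R₂| := by
    rw [abs_div, abs_of_pos hr0]
    calc _ ≤ r₂ * |r - R₂| / r₁ :=
          div_le_div₀ (by positivity) (abs_stepCorr_sub_le h₁ hr hR₂) h₁ hr.1
      _ = _ := by ring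
  have e3 : |s * (1 / r - r / R₂ ^ 2)| ≤ |s| * (2 * r₂ / r₁ ^ 3) * |r - R₂| := by
    have : 1 / r - r / R₂ ^ 2 = -((r - R₂) * ((r + R₂) / (r * R₂ ^ 2))) := by
      field_simp
      ring
    rw [this, abs_mul, abs_neg, abs_mul, mul_assoc]
    refine mul_le_mul_of_nonneg_left ?_ (abs_nonneg _)
    rw [mul_comm]
    refine mul_le_mul_of_nonneg_right ?_ (abs_nonneg _)
    rw [abs_of_pos (by positivity)]
    refine div_le_div₀ (by positivity) (by linarith [hr.2, hR₂.2]) (by positivity) ?_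
    calc r₁ ^ 3 = r₁ * r₁ ^ 2 := by ring
      _ ≤ r * R₂ ^ 2 :=
        mul_le_mul hr.1 (pow_le_pow_left₀ h₁.le hR₂.1 2) (by positivity) hr0.le
  refine (abs_add_le _ _).trans ?_
  rw [abs_mul, abs_of_pos hp]
  have e4 := abs_add_le ((stepCorr r₁ r₂ R₁ R₂ r - s) / r) (s * (1 / r - r / R₂ ^ 2))
  have e5 := mul_le_mul_of_nonneg_left (e4.trans (add_le_add e2 e3)) hp.le
  have h6 : 0 ≤ C₀ / r₁ * (ε * |r - R₂|) := by positivity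
  have h7 : 0 ≤ (r₂ / r₁ + |s| * (2 * r₂ / r₁ ^ 3)) * ε ^ 2 := by positivity
  linarith

/-- Near `R₂` the speed is `ε r (a z + μ)` up to `O(ε²)`, where `r = R₂ + ε z`. -/
lemma exists_abs_speed_sub_le_outer (hΘ : IsMollifier Θ) (A B : ℝ) (h₁ : 0 < r₁) (h₂ : r₁ < r₂)
    (hR₂ : R₂ ∈ Icc r₁ r₂) :
    ∃ C > 0, ∀ κ ε μ : ℝ, 0 < κ → κ ≤ 1 / 4 → Admissible r₁ r₂ R₁ R₂ ε → ∀ z : ℝ, |z| ≤ 1 →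
      |speed Θ r₁ r₂ R₁ R₂ A B ε κ (lamOf r₁ r₂ R₁ R₂ A B ε μ) (R₂ + ε * z)
          - (R₂ + ε * z) * (ε * (slope B R₂ * z + μ))| ≤ C * ε ^ 2 := by
  obtain ⟨C₀, hC₀, hC⟩ := exists_abs_speed_sub_le (R₁ := R₁) hΘ A B h₁ h₂ hR₂
  have h0 : 0 < r₂ := h₁.trans h₂
  have hR₂0 : 0 < R₂ := h₁.trans_le hR₂.1
  refine ⟨C₀ * 2 + 3 * r₂ * |B| / r₁ ^ 4, by positivity, fun κ ε μ hκ hκ' hε z hz => ?_⟩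
  have hp := hε.pos
  have hz' := abs_le.1 hz
  have hl := hε.left
  have hm := hε.mid
  have hri := hε.right
  set r := R₂ + ε * z with hrdef
  have hr : r ∈ Icc r₁ r₂ := by constructor <;> nlinarith
  have hr0 : 0 < r := h₁.trans_le hr.1
  have hrR : |r - R₂| ≤ ε := by
    rw [hrdef, add_sub_cancel_left, abs_mul, abs_of_pos hp]
    nlinarith [abs_nonneg z]
  have e0 := hC κ ε μ hκ hκ' hε r hr
  have e1 : |r * (B / R₂ ^ 2 - B / r ^ 2) - r * (ε * (slope B R₂ * z))|
      ≤ 3 * r₂ * |B| / r₁ ^ 4 * ε ^ 2 := by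
    -- The second-order Taylor remainder at `R₂`, in closed form with the factor `(r - R₂)²`.
    have : r * (B / R₂ ^ 2 - B / r ^ 2) - r * (ε * (slope B R₂ * z))
        = -(B * (r - R₂) ^ 2 * ((R₂ + 2 * r) / (R₂ ^ 3 * r))) := by
      have : ε * z = r - R₂ := by rw [hrdef]; ring
      unfold slope
      rw [mul_comm (2 * B / R₂ ^ 3) z, ← mul_assoc ε, this]
      field_simp
      ring
    rw [this, abs_neg, abs_mul, abs_mul, abs_pow]
    have h8 : |(R₂ + 2 * r) / (R₂ ^ 3 * r)| ≤ 3 * r₂ / r₁ ^ 4 := by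
      rw [abs_of_pos (by positivity)]
      refine div_le_div₀ (by positivity) (by linarith [hr.2, hR₂.2]) (by positivity) ?_
      calc r₁ ^ 4 = r₁ ^ 3 * r₁ := by ring
        _ ≤ R₂ ^ 3 * r :=
          mul_le_mul (pow_le_pow_left₀ h₁.le hR₂.1 3) hr.1 h₁.le (by positivity)
    have h9 : |r - R₂| ^ 2 ≤ ε ^ 2 := pow_le_pow_left₀ (abs_nonneg _) hrR 2
    calc |B| * |r - R₂| ^ 2 * |(R₂ + 2 * r) / (R₂ ^ 3 * r)|
        ≤ |B| * ε ^ 2 * (3 * r₂ / r₁ ^ 4) := by gcongr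
      _ = _ := by ring
  have e2 : C₀ * (ε ^ 2 + ε * |r - R₂|) ≤ C₀ * 2 * ε ^ 2 := by
    rw [mul_assoc]
    refine mul_le_mul_of_nonneg_left ?_ hC₀.le
    nlinarith
  have e3 := abs_add_le
    (speed Θ r₁ r₂ R₁ R₂ A B ε κ (lamOf r₁ r₂ R₁ R₂ A B ε μ) r
      - (r * (B / R₂ ^ 2 - B / r ^ 2) + r * (ε * μ)))
    (r * (B / R₂ ^ 2 - B / r ^ 2) - r * (ε * (slope B R₂ * z)))
  refine le_trans (le_of_eq ?_) (e3.trans ((add_le_add (e0.trans e2) e1).trans (le_of_eq ?_)))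
  · congr 1; ring
  · ring

/-- Near `R₁` the speed is bounded away from zero. -/
lemma exists_le_abs_speed_inner (hΘ : IsMollifier Θ) (A : ℝ) {B : ℝ} (hB : B ≠ 0) (h₁ : 0 < r₁)
    (hr₁ : r₁ < R₁) (hR : R₁ < R₂) (hr₂ : R₂ < r₂) (K : ℝ) :
    ∃ c > 0, ∃ ε₀ > 0, ∀ κ ε μ : ℝ, 0 < κ → κ ≤ 1 / 4 → Admissible r₁ r₂ R₁ R₂ ε → ε < ε₀ →
      |μ| ≤ K → ∀ r ∈ Icc (R₁ - ε) (R₁ + ε),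
      c ≤ |speed Θ r₁ r₂ R₁ R₂ A B ε κ (lamOf r₁ r₂ R₁ R₂ A B ε μ) r| := by
  have h₂ : r₁ < r₂ := by linarith
  have h0 : 0 < r₂ := h₁.trans h₂
  have hR₂ : R₂ ∈ Icc r₁ r₂ := ⟨by linarith, hr₂.le⟩
  obtain ⟨C, hC₀, hC⟩ := exists_abs_speed_sub_le (R₁ := R₁) hΘ A B h₁ h₂ hR₂
  -- By `2ε < R₂ - R₁` the inner interval stays below the midpoint, so `1/r² - 1/R₂²` has a positive
  -- lower bound independent of `ε`.
  set Rm := (R₁ + R₂) / 2 with hRm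
  have hRm0 : 0 < Rm := by linarith
  have hR₂0 : 0 < R₂ := by linarith
  have hpos : 0 < 1 / Rm ^ 2 - 1 / R₂ ^ 2 :=
    sub_pos.2 (one_div_lt_one_div_of_lt (by positivity)
      (pow_lt_pow_left₀ (by linarith) hRm0.le two_ne_zero))
  set c := r₁ * (|B| * (1 / Rm ^ 2 - 1 / R₂ ^ 2)) with hc
  have hc0 : 0 < c := by have := abs_pos.2 hB; positivity
  set D := r₂ * |K| + C * (2 * r₂) + 1 with hD
  have hD0 : 0 < D := by positivity
  refine ⟨c / 2, by positivity, c / 2 / D, by positivity,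
    fun κ ε μ hκ hκ' hε hεs hμ r hr => ?_⟩
  have hp := hε.pos
  have hl := hε.left
  have hm := hε.mid
  have hri := hε.right
  have hr' : r ∈ Icc r₁ r₂ := ⟨by linarith [hr.1], by linarith [hr.2]⟩
  have hr0 : 0 < r := h₁.trans_le hr'.1
  have hrm : r ≤ Rm := by linarith [hr.2]
  have e0 := hC κ ε μ hκ hκ' hε r hr'
  have e1 : c ≤ |r * (B / R₂ ^ 2 - B / r ^ 2)| := by
    have : r * (B / R₂ ^ 2 - B / r ^ 2) = -(r * (B * (1 / r ^ 2 - 1 / R₂ ^ 2))) := by ring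
    have h10 : 1 / Rm ^ 2 ≤ 1 / r ^ 2 :=
      one_div_le_one_div_of_le (by positivity) (pow_le_pow_left₀ hr0.le hrm 2)
    rw [this, abs_neg, abs_mul, abs_mul, abs_of_pos hr0,
      abs_of_pos (a := 1 / r ^ 2 - 1 / R₂ ^ 2) (by linarith), hc]
    gcongr
    exact hr'.1
  have e2 : |r * (ε * μ)| ≤ r₂ * |K| * ε := by
    rw [abs_mul, abs_mul, abs_of_pos hr0, abs_of_pos hp]
    have : |μ| ≤ |K| := hμ.trans (le_abs_self K)
    calc r * (ε * |μ|) ≤ r₂ * (ε * |K|) := by gcongr; exact hr'.2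
      _ = _ := by ring
  have e3 : C * (ε ^ 2 + ε * |r - R₂|) ≤ C * (2 * r₂) * ε := by
    have h11 : |r - R₂| ≤ r₂ := by rw [abs_le]; constructor <;> linarith [hr'.1, hr'.2]
    have : ε ^ 2 + ε * |r - R₂| ≤ 2 * r₂ * ε := by nlinarith
    calc _ ≤ C * (2 * r₂ * ε) := mul_le_mul_of_nonneg_left this hC₀.le
      _ = _ := by ring
  have e4 : D * ε < c / 2 := by rw [lt_div_iff₀ hD0] at hεs; linarith
  have e5 : |r * (B / R₂ ^ 2 - B / r ^ 2)|
      ≤ |speed Θ r₁ r₂ R₁ R₂ A B ε κ (lamOf r₁ r₂ R₁ R₂ A B ε μ) r|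
        + (|speed Θ r₁ r₂ R₁ R₂ A B ε κ (lamOf r₁ r₂ R₁ R₂ A B ε μ) r
          - (r * (B / R₂ ^ 2 - B / r ^ 2) + r * (ε * μ))| + |r * (ε * μ)|) := by
    have a1 := abs_sub
      (speed Θ r₁ r₂ R₁ R₂ A B ε κ (lamOf r₁ r₂ R₁ R₂ A B ε μ) r)
      ((speed Θ r₁ r₂ R₁ R₂ A B ε κ (lamOf r₁ r₂ R₁ R₂ A B ε μ) r
          - (r * (B / R₂ ^ 2 - B / r ^ 2) + r * (ε * μ))) + r * (ε * μ))
    have a2 := abs_add_le (speed Θ r₁ r₂ R₁ R₂ A B ε κ (lamOf r₁ r₂ R₁ R₂ A B ε μ) r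
          - (r * (B / R₂ ^ 2 - B / r ^ 2) + r * (ε * μ))) (r * (ε * μ))
    refine le_trans (le_of_eq ?_) (a1.trans (by linarith))
    congr 1; ring
  nlinarith

end Speed

/-! ### Inequalities for hyperbolic functions -/

section Sinh

lemma sinh_sub_sinh_le {p p' : ℝ} (hp : 0 ≤ p) (h : p ≤ p') :
    Real.sinh p' - Real.sinh p ≤ (p' - p) * Real.cosh p' := by
  rw [mul_comm]
  refine Convex.image_sub_le_mul_sub_of_deriv_le (convex_Icc p p')
    Real.continuous_sinh.continuousOn Real.differentiable_sinh.differentiableOn ?_ p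
    (left_mem_Icc.2 h) p' (right_mem_Icc.2 h) h
  intro x hx
  rw [interior_Icc] at hx
  rw [Real.deriv_sinh, Real.cosh_le_cosh, abs_of_pos (hp.trans_lt hx.1),
    abs_of_pos (hp.trans_lt (hx.1.trans hx.2))]
  exact hx.2.le

/-- The mean value bound gives `(p' - p) cosh p' sinh q`, and `cosh p' sinh q ≤ sinh(p' + q)`.
Applied with `p' - p` proportional to `n`, it loses exactly one factor `n`, which the denominator of
the Green function absorbs. -/
lemma sinh_sub_mul_sinh_le {p p' q T : ℝ} (hp : 0 ≤ p) (h : p ≤ p') (hq : 0 ≤ q)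
    (hT : p' + q ≤ T) :
    (Real.sinh p' - Real.sinh p) * Real.sinh q ≤ (p' - p) * Real.sinh T := by
  have h1 := sinh_sub_sinh_le hp h
  have h2 : Real.cosh p' * Real.sinh q ≤ Real.sinh T := by
    refine le_trans ?_ (Real.sinh_le_sinh.2 hT)
    rw [Real.sinh_add]
    have := Real.sinh_nonneg_iff.2 (hp.trans h)
    have := Real.cosh_pos q
    nlinarith
  have h3 := Real.sinh_nonneg_iff.2 hq
  nlinarith [mul_le_mul_of_nonneg_right h1 h3]

lemma sinh_mul_sinh_le {p q T : ℝ} (hp : 0 ≤ p) (hq : 0 ≤ q) (hT : p + q ≤ T) :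
    Real.sinh p * Real.sinh q ≤ Real.sinh T / 2 := by
  have h0 : Real.sinh (p + q) ≤ Real.sinh T := Real.sinh_le_sinh.2 hT
  rw [Real.sinh_add] at h0
  have h1 := Real.sinh_nonneg_iff.2 hp
  have h2 := Real.sinh_nonneg_iff.2 hq
  have h3 := (Real.sinh_lt_cosh p).le
  have h4 := (Real.sinh_lt_cosh q).le
  nlinarith [mul_le_mul_of_nonneg_left h4 h1, mul_le_mul_of_nonneg_right h3 h2]

/-- The numerator of the derivative is `sinh t cosh t - t`, positive because `sinh t > t` and `cosh
t ≥ 1`. -/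
lemma mul_cosh_div_sinh_strictMonoOn :
    StrictMonoOn (fun t : ℝ => t * Real.cosh t / Real.sinh t) (Ioi 0) := by
  have hs : ∀ t ∈ Ioi (0 : ℝ), 0 < Real.sinh t := fun t ht => Real.sinh_pos_iff.2 ht
  refine strictMonoOn_of_deriv_pos (convex_Ioi 0)
    (ContinuousOn.div (by fun_prop) Real.continuous_sinh.continuousOn
      fun t ht => (hs t ht).ne') fun t ht => ?_
  rw [interior_Ioi] at ht
  have h := (((hasDerivAt_id t).mul (Real.hasDerivAt_cosh t)).div (Real.hasDerivAt_sinh t)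
    (hs t ht).ne').deriv
  have h' : deriv (fun t : ℝ => t * Real.cosh t / Real.sinh t) t = _ := h
  rw [h']
  refine div_pos ?_ (pow_pos (hs t ht) 2)
  have h1 : t < Real.sinh t := Real.self_lt_sinh_iff.2 ht
  have h2 := Real.one_le_cosh t
  have h3 := Real.cosh_sq t
  have ht' : (0 : ℝ) < t := ht
  simp only [Pi.mul_apply, id, one_mul]
  nlinarith [hs t ht]

end Sinh

/-! ### The Green function of each mode -/

/-- The Green function of `-g'' - g'/r + n² g/r²` on `[r₁, r₂]` with respect to `s ds`. -/
noncomputable def green (r₁ r₂ : ℝ) (n : ℕ) (r s : ℝ) : ℝ :=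
  logSinh n (min r s / r₁) * logSinh n (r₂ / max r s) / (n * logSinh n (r₂ / r₁))

section Green

variable {r₁ r₂ r r' s : ℝ} {n : ℕ}

lemma logSinh_div (n : ℕ) (hr : 0 < r) (hs : 0 < s) :
    logSinh n (r / s) = Real.sinh (n * (Real.log r - Real.log s)) := by
  unfold logSinh
  rw [Real.log_div hr.ne' hs.ne']

lemma logSinh_pos (hn : 1 ≤ n) (h₁ : 0 < r₁) (h₂ : r₁ < r₂) : 0 < logSinh n (r₂ / r₁) := by
  unfold logSinh
  have : 0 < Real.log (r₂ / r₁) := Real.log_pos (by rwa [one_lt_div h₁])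
  have hn' : (0 : ℝ) < n := by exact_mod_cast hn
  exact Real.sinh_pos_iff.2 (by positivity)

lemma logSinh_nonneg (n : ℕ) (hs : 0 < s) (h : s ≤ r) : 0 ≤ logSinh n (r / s) := by
  unfold logSinh
  have : 0 ≤ Real.log (r / s) := Real.log_nonneg (by rwa [one_le_div hs])
  exact Real.sinh_nonneg_iff.2 (by positivity)

lemma green_comm (r₁ r₂ : ℝ) (n : ℕ) (r s : ℝ) : green r₁ r₂ n r s = green r₁ r₂ n s r := by
  unfold green
  rw [min_comm, max_comm]

lemma green_of_le (h : r ≤ s) :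
    green r₁ r₂ n r s = logSinh n (r / r₁) * logSinh n (r₂ / s) / (n * logSinh n (r₂ / r₁)) := by
  unfold green
  rw [min_eq_left h, max_eq_right h]

lemma green_nonneg (h₁ : 0 < r₁) (h₂ : r₁ < r₂) (hr : r ∈ Icc r₁ r₂) (hs : s ∈ Icc r₁ r₂) :
    0 ≤ green r₁ r₂ n r s := by
  have hm : 0 < max r s := h₁.trans_le (hr.1.trans (le_max_left _ _))
  refine div_nonneg (mul_nonneg (logSinh_nonneg n h₁ (le_min hr.1 hs.1))
    (logSinh_nonneg n hm (max_le hr.2 hs.2))) (mul_nonneg n.cast_nonneg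
      (logSinh_nonneg n h₁ h₂.le))

/-- In logarithmic variables the two numerator arguments add up to at most that of the denominator,
so `sinh p sinh q ≤ sinh(T)/2` applies; the factor `1/n` is only bounded by one. -/
lemma green_le_half (hn : 1 ≤ n) (h₁ : 0 < r₁) (h₂ : r₁ < r₂) (hr : r ∈ Icc r₁ r₂)
    (hs : s ∈ Icc r₁ r₂) : green r₁ r₂ n r s ≤ 1 / 2 := by
  wlog h : r ≤ s generalizing r s
  · rw [green_comm]
    exact this hs hr (le_of_not_ge h)
  have hT := logSinh_pos hn h₁ h₂
  have hn' : (1 : ℝ) ≤ n := by exact_mod_cast hn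
  have hr0 : 0 < r := h₁.trans_le hr.1
  have hs0 : 0 < s := h₁.trans_le hs.1
  rw [green_of_le h, div_le_iff₀ (by positivity)]
  have : logSinh n (r / r₁) * logSinh n (r₂ / s) ≤ logSinh n (r₂ / r₁) / 2 := by
    rw [logSinh_div n hr0 h₁, logSinh_div n (h₁.trans h₂) hs0, logSinh_div n (h₁.trans h₂) h₁]
    have a := Real.log_le_log h₁ hr.1
    have b := Real.log_le_log hs0 hs.2
    have c := Real.log_le_log hr0 h
    have hn0 : (0 : ℝ) ≤ n := n.cast_nonneg
    refine sinh_mul_sinh_le (mul_nonneg hn0 (by linarith)) (mul_nonneg hn0 (by linarith)) ?_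
    rw [← mul_add]
    exact mul_le_mul_of_nonneg_left (by linarith) hn0
  nlinarith

lemma log_sub_log_le (h₁ : 0 < r₁) (hr : r₁ ≤ r) (h : r ≤ r') :
    Real.log r' - Real.log r ≤ 1 / r₁ * (r' - r) := by
  have hr0 : 0 < r := h₁.trans_le hr
  rw [← Real.log_div (hr0.trans_le h).ne' hr0.ne']
  refine (Real.log_le_sub_one_of_pos (div_pos (hr0.trans_le h) hr0)).trans ?_
  have : r' / r - 1 = 1 / r * (r' - r) := by field_simp
  rw [this]
  exact mul_le_mul_of_nonneg_right (one_div_le_one_div_of_le h₁ hr) (sub_nonneg.2 h)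

/-- Left of `s` only the first `sinh` factor varies. Its variation costs `n (log r' - log r)`, and
the `n` cancels against the prefactor `1/n`; hence the constant does not depend on the mode. -/
lemma abs_green_sub_le_of_le (hn : 1 ≤ n) (h₁ : 0 < r₁) (h₂ : r₁ < r₂) (hr : r₁ ≤ r)
    (h : r ≤ r') (hs : r' ≤ s) (hs₂ : s ≤ r₂) :
    |green r₁ r₂ n r' s - green r₁ r₂ n r s| ≤ 1 / r₁ * (r' - r) := by
  have hT := logSinh_pos hn h₁ h₂
  have hn' : (0 : ℝ) < n := by exact_mod_cast hn
  have hr0 : 0 < r := h₁.trans_le hr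
  have hr0' : 0 < r' := hr0.trans_le h
  have hs0 : 0 < s := hr0'.trans_le hs
  rw [green_of_le hs, green_of_le (h.trans hs), ← sub_div, ← sub_mul]
  refine le_trans ?_ (log_sub_log_le h₁ hr h)
  have a := Real.log_le_log h₁ hr
  have b := Real.log_le_log hr0 h
  have c := Real.log_le_log hr0' hs
  have d := Real.log_le_log hs0 hs₂
  rw [logSinh_div n hr0 h₁, logSinh_div n hr0' h₁, logSinh_div n (h₁.trans h₂) hs0,
    logSinh_div n (h₁.trans h₂) h₁] at *
  rw [abs_of_nonneg]
  · rw [div_le_iff₀ (by positivity)]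
    refine (sinh_sub_mul_sinh_le (T := n * (Real.log r₂ - Real.log r₁))
      (mul_nonneg hn'.le (by linarith)) (mul_le_mul_of_nonneg_left (by linarith) hn'.le)
      (mul_nonneg hn'.le (by linarith)) ?_).trans (le_of_eq ?_)
    · rw [← mul_add]
      exact mul_le_mul_of_nonneg_left (by linarith) hn'.le
    · ring
  · refine div_nonneg (mul_nonneg (sub_nonneg.2 (Real.sinh_le_sinh.2 ?_))
      (Real.sinh_nonneg_iff.2 (mul_nonneg hn'.le (by linarith)))) (by positivity)
    exact mul_le_mul_of_nonneg_left (by linarith) hn'.le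

lemma abs_green_sub_le_of_ge (hn : 1 ≤ n) (h₁ : 0 < r₁) (h₂ : r₁ < r₂) (hs₁ : r₁ ≤ s)
    (hs : s ≤ r) (h : r ≤ r') (hr' : r' ≤ r₂) :
    |green r₁ r₂ n r' s - green r₁ r₂ n r s| ≤ 1 / r₁ * (r' - r) := by
  have hT := logSinh_pos hn h₁ h₂
  have hn' : (0 : ℝ) < n := by exact_mod_cast hn
  have hs0 : 0 < s := h₁.trans_le hs₁
  have hr0 : 0 < r := hs0.trans_le hs
  have hr0' : 0 < r' := hr0.trans_le h
  rw [green_comm r₁ r₂ n r', green_comm r₁ r₂ n r, green_of_le hs, green_of_le (hs.trans h),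
    ← sub_div, ← mul_sub, abs_div, abs_mul, abs_sub_comm, ← abs_mul, ← abs_div]
  refine le_trans ?_ (log_sub_log_le h₁ (hs₁.trans hs) h)
  have a := Real.log_le_log h₁ hs₁
  have b := Real.log_le_log hs0 hs
  have c := Real.log_le_log hr0 h
  have d := Real.log_le_log hr0' hr'
  rw [logSinh_div n hs0 h₁, logSinh_div n (h₁.trans h₂) hr0, logSinh_div n (h₁.trans h₂) hr0',
    logSinh_div n (h₁.trans h₂) h₁] at *
  rw [abs_of_nonneg]
  · rw [div_le_iff₀ (by positivity), mul_comm (Real.sinh _)]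
    refine (sinh_sub_mul_sinh_le (T := n * (Real.log r₂ - Real.log r₁))
      (mul_nonneg hn'.le (by linarith)) (mul_le_mul_of_nonneg_left (by linarith) hn'.le)
      (mul_nonneg hn'.le (by linarith)) ?_).trans (le_of_eq ?_)
    · rw [← mul_add]
      exact mul_le_mul_of_nonneg_left (by linarith) hn'.le
    · ring
  · refine div_nonneg (mul_nonneg (Real.sinh_nonneg_iff.2 (mul_nonneg hn'.le (by linarith)))
      (sub_nonneg.2 (Real.sinh_le_sinh.2 ?_))) (by positivity)
    exact mul_le_mul_of_nonneg_left (by linarith) hn'.le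

/-- The Green function is Lipschitz, uniformly in the mode `n`. -/
lemma abs_green_sub_le (hn : 1 ≤ n) (h₁ : 0 < r₁) (h₂ : r₁ < r₂) (hr : r ∈ Icc r₁ r₂)
    (hr' : r' ∈ Icc r₁ r₂) (hs : s ∈ Icc r₁ r₂) :
    |green r₁ r₂ n r s - green r₁ r₂ n r' s| ≤ 1 / r₁ * |r - r'| := by
  wlog h : r ≤ r' generalizing r r'
  · rw [abs_sub_comm, abs_sub_comm r]
    exact this hr' hr (le_of_not_ge h)
  rw [abs_sub_comm, abs_sub_comm r, abs_of_nonneg (sub_nonneg.2 h)]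
  rcases le_total r' s with h3 | h3
  · exact abs_green_sub_le_of_le hn h₁ h₂ hr.1 h h3 hs.2
  rcases le_total s r with h4 | h4
  · exact abs_green_sub_le_of_ge hn h₁ h₂ hs.1 h4 h hr'.2
  have a := abs_green_sub_le_of_ge hn h₁ h₂ hs.1 le_rfl h3 hr'.2
  have b := abs_green_sub_le_of_le hn h₁ h₂ hr.1 h4 le_rfl hs.2
  refine (abs_sub_le _ (green r₁ r₂ n s s) _).trans ((add_le_add a b).trans (le_of_eq ?_))
  ring

lemma continuousOn_logSinh (n : ℕ) : ContinuousOn (logSinh n) (Ioi 0) := by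
  unfold logSinh
  refine Real.continuous_sinh.comp_continuousOn (continuousOn_const.mul ?_)
  exact Real.continuousOn_log.mono fun x hx => ne_of_gt hx

lemma contDiffOn_logSinh (n : ℕ) : ContDiffOn ℝ ∞ (logSinh n) (Ioi 0) := by
  unfold logSinh
  refine Real.contDiff_sinh.comp_contDiffOn (contDiffOn_const.mul ?_)
  exact Real.contDiffOn_log.mono fun x hx => ne_of_gt hx

lemma continuousOn_green (h₁ : 0 < r₁) (h₂ : 0 < r₂) (n : ℕ) :
    ContinuousOn (fun p : ℝ × ℝ => green r₁ r₂ n p.1 p.2) (Ioi 0 ×ˢ Ioi 0) := by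
  unfold green
  refine ContinuousOn.div_const (ContinuousOn.mul ?_ ?_) _
  · refine (continuousOn_logSinh n).comp (by fun_prop) fun p hp => ?_
    exact div_pos (lt_min hp.1 hp.2) h₁
  · refine (continuousOn_logSinh n).comp ?_ fun p hp => ?_
    · refine continuousOn_const.div (by fun_prop) fun p hp => ?_
      exact (lt_max_of_lt_left hp.1).ne'
    · exact div_pos h₂ (lt_max_of_lt_left hp.1)

lemma continuousOn_green_right (h₁ : 0 < r₁) (h₂ : 0 < r₂) (n : ℕ) (hr : 0 < r) :
    ContinuousOn (fun s => green r₁ r₂ n r s) (Ioi 0) :=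
  (continuousOn_green h₁ h₂ n).comp (f := fun s => (r, s)) (by fun_prop)
    fun s hs => ⟨hr, hs⟩

/-- By the addition formula for `sinh`, the reciprocal is `n coth(n a) + n coth(n b)`. Each term is
written as `t coth t / c` with `t = n c`, so that monotonicity in `n` reduces to that of `t coth t`.
-/
lemma green_diag (hn : 1 ≤ n) (hr₁ : 0 < r₁) (h₁ : r₁ < r) (h₂ : r < r₂) :
    green r₁ r₂ n r r
      = (n * Real.log (r / r₁) * Real.cosh (n * Real.log (r / r₁))
            / Real.sinh (n * Real.log (r / r₁)) / Real.log (r / r₁)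
          + n * Real.log (r₂ / r) * Real.cosh (n * Real.log (r₂ / r))
            / Real.sinh (n * Real.log (r₂ / r)) / Real.log (r₂ / r))⁻¹ := by
  have hr : 0 < r := hr₁.trans h₁
  have hn' : (0 : ℝ) < n := by exact_mod_cast hn
  have ha : 0 < Real.log (r / r₁) := Real.log_pos (by rwa [one_lt_div hr₁])
  have hb : 0 < Real.log (r₂ / r) := Real.log_pos (by rwa [one_lt_div hr])
  have hab : Real.log (r₂ / r₁) = Real.log (r / r₁) + Real.log (r₂ / r) := by
    rw [← Real.log_mul (by positivity) (div_pos (hr.trans h₂) hr).ne']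
    congr 1
    field_simp
  rw [green_of_le le_rfl]
  unfold logSinh
  rw [hab, mul_add, Real.sinh_add]
  set a := Real.log (r / r₁)
  set b := Real.log (r₂ / r)
  have hsa : 0 < Real.sinh (n * a) := Real.sinh_pos_iff.2 (by positivity)
  have hsb : 0 < Real.sinh (n * b) := Real.sinh_pos_iff.2 (by positivity)
  have hca := Real.cosh_pos (n * a)
  have hcb := Real.cosh_pos (n * b)
  field_simp
  ring

lemma green_diag_pos (hn : 1 ≤ n) (hr₁ : 0 < r₁) (h₁ : r₁ < r) (h₂ : r < r₂) :
    0 < green r₁ r₂ n r r := by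
  rw [green_of_le le_rfl]
  have hn' : (0 : ℝ) < n := by exact_mod_cast hn
  have := logSinh_pos hn hr₁ h₁
  have := logSinh_pos hn (hr₁.trans h₁) h₂
  have := logSinh_pos hn hr₁ (h₁.trans h₂)
  positivity

lemma green_diag_lt {n' : ℕ} (hn : 1 ≤ n) (h : n < n') (hr₁ : 0 < r₁) (h₁ : r₁ < r)
    (h₂ : r < r₂) : green r₁ r₂ n' r r < green r₁ r₂ n r r := by
  have hr : 0 < r := hr₁.trans h₁
  have hn' : (0 : ℝ) < n := by exact_mod_cast hn
  have hlt : (n : ℝ) < n' := by exact_mod_cast h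
  have ha : 0 < Real.log (r / r₁) := Real.log_pos (by rwa [one_lt_div hr₁])
  have hb : 0 < Real.log (r₂ / r) := Real.log_pos (by rwa [one_lt_div hr])
  rw [green_diag hn hr₁ h₁ h₂, green_diag (hn.trans h.le) hr₁ h₁ h₂]
  set a := Real.log (r / r₁)
  set b := Real.log (r₂ / r)
  have key : ∀ c : ℝ, 0 < c → n * c * Real.cosh (n * c) / Real.sinh (n * c) / c
      < n' * c * Real.cosh (n' * c) / Real.sinh (n' * c) / c := fun c hc =>
    div_lt_div_of_pos_right (mul_cosh_div_sinh_strictMonoOn (mul_pos hn' hc)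
      (mul_pos (hn'.trans hlt) hc) (mul_lt_mul_of_pos_right hlt hc)) hc
  have pos : ∀ c : ℝ, 0 < c → 0 < n * c * Real.cosh (n * c) / Real.sinh (n * c) / c :=
    fun c hc => by
      have := Real.sinh_pos_iff.2 (mul_pos hn' hc)
      have := Real.cosh_pos (n * c)
      positivity
  exact inv_strictAnti₀ (add_pos (pos a ha) (pos b hb)) (add_lt_add (key a ha) (key b hb))

/-- The gap between the value of the Green function on the diagonal for the mode `m` and all other
modes. -/
lemma exists_le_abs_green_diag_sub {m : ℕ} (hm : 1 ≤ m) (hr₁ : 0 < r₁) (h₁ : r₁ < r)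
    (h₂ : r < r₂) :
    ∃ c > 0, ∀ n : ℕ, 1 ≤ n → n ≠ m → c ≤ |green r₁ r₂ n r r - green r₁ r₂ m r r| := by
  have hmono : ∀ n n' : ℕ, 1 ≤ n → n ≤ n' → green r₁ r₂ n' r r ≤ green r₁ r₂ n r r :=
    fun n n' hn h => by
      rcases h.eq_or_lt with rfl | h
      · exact le_rfl
      · exact (green_diag_lt hn h hr₁ h₁ h₂).le
  have hup := green_diag_lt hm m.lt_succ_self hr₁ h₁ h₂
  by_cases hm1 : m = 1
  · refine ⟨green r₁ r₂ m r r - green r₁ r₂ (m + 1) r r, sub_pos.2 hup, fun n hn hnm => ?_⟩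
    have := hmono (m + 1) n (by omega) (by omega)
    rw [abs_sub_comm]
    exact le_trans (by linarith) (le_abs_self _)
  · have hdown := green_diag_lt (n := m - 1) (n' := m) (by omega) (by omega) hr₁ h₁ h₂
    refine ⟨min (green r₁ r₂ m r r - green r₁ r₂ (m + 1) r r)
      (green r₁ r₂ (m - 1) r r - green r₁ r₂ m r r), lt_min (sub_pos.2 hup) (sub_pos.2 hdown),
      fun n hn hnm => ?_⟩
    rcases lt_or_gt_of_ne hnm with h | h
    · have := hmono n (m - 1) hn (by omega)
      exact (min_le_right _ _).trans (le_trans (by linarith) (le_abs_self _))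
    · have := hmono (m + 1) n (by omega) (by omega)
      rw [abs_sub_comm]
      exact (min_le_left _ _).trans (le_trans (by linarith) (le_abs_self _))

/-- This is the Plücker relation: `sinh(x - y)` is the determinant of the vectors `(sinh, cosh)` at
`x` and `y`, and the identity relates the six minors of four such vectors. -/
lemma logSinh_mul_sub (n : ℕ) {a b c d : ℝ} (ha : 0 < a) (hb : 0 < b) (hc : 0 < c) (hd : 0 < d) :
    logSinh n (a / b) * logSinh n (c / d) - logSinh n (a / d) * logSinh n (c / b)
      = -(logSinh n (b / d) * logSinh n (c / a)) := by
  rw [logSinh_div n ha hb, logSinh_div n hc hd, logSinh_div n ha hd, logSinh_div n hc hb,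
    logSinh_div n hb hd, logSinh_div n hc ha]
  set x := (n : ℝ) * Real.log a with hx
  set y := (n : ℝ) * Real.log b
  set z := (n : ℝ) * Real.log c
  set w := (n : ℝ) * Real.log d
  simp only [mul_sub, ← hx]
  simp only [Real.sinh_sub]
  have hX := Real.cosh_sq x
  have hY := Real.cosh_sq y
  have hZ := Real.cosh_sq z
  have hW := Real.cosh_sq w
  ring

lemma intervalIntegral_green (h₁ : 0 < r₁) (h₂ : r₁ < r₂) (hr : r ∈ Icc r₁ r₂)
    {f : ℝ → ℝ} (hf : IntervalIntegrable f volume r₁ r₂) :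
    ∫ s in r₁..r₂, f s * green r₁ r₂ n r s
      = (logSinh n (r₂ / r) * (∫ s in r₁..r, f s * logSinh n (s / r₁))
        + logSinh n (r / r₁) * (∫ s in r..r₂, f s * logSinh n (r₂ / s)))
          / (n * logSinh n (r₂ / r₁)) := by
  have hr0 : 0 < r := h₁.trans_le hr.1
  have hsub1 : uIcc r₁ r ⊆ uIcc r₁ r₂ := by
    rw [uIcc_of_le hr.1, uIcc_of_le h₂.le]; exact Icc_subset_Icc_right hr.2
  have hsub2 : uIcc r r₂ ⊆ uIcc r₁ r₂ := by
    rw [uIcc_of_le hr.2, uIcc_of_le h₂.le]; exact Icc_subset_Icc_left hr.1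
  have hg : IntervalIntegrable (fun s => f s * green r₁ r₂ n r s) volume r₁ r₂ := by
    refine hf.mul_continuousOn ((continuousOn_green_right h₁ (h₁.trans h₂) n hr0).mono ?_)
    rw [uIcc_of_le h₂.le]
    exact fun s hs => h₁.trans_le hs.1
  rw [← intervalIntegral.integral_add_adjacent_intervals (hg.mono_set hsub1)
    (hg.mono_set hsub2), add_div, ← intervalIntegral.integral_const_mul,
    ← intervalIntegral.integral_const_mul, ← intervalIntegral.integral_div,
    ← intervalIntegral.integral_div]
  congr 1
  · refine intervalIntegral.integral_congr fun s hs => ?_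
    rw [uIcc_of_le hr.1] at hs
    rw [green_comm, green_of_le hs.2]
    ring
  · refine intervalIntegral.integral_congr fun s hs => ?_
    rw [uIcc_of_le hr.2] at hs
    rw [green_of_le hs.1]
    ring

/-- The operator `ℒ_n` in terms of the Green function. -/
lemma modeOp_eq {γ lam : ℝ} {ϖ g : ℝ → ℝ} (hn : 1 ≤ n) (h₁ : 0 < r₁) (h₂ : r₁ < r₂)
    (hr : r ∈ Icc r₁ r₂) (hg : IntervalIntegrable (fun s => s * deriv ϖ s * g s) volume r₁ r₂) :
    modeOp r₁ r₂ γ ϖ lam n g r = (deriv (stream r₁ r₂ γ ϖ) r + lam * r) * g r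
      - ∫ s in r₁..r₂, s * deriv ϖ s * g s * green r₁ r₂ n r s := by
  have hr0 : 0 < r := h₁.trans_le hr.1
  have hn' : (0 : ℝ) < n := by exact_mod_cast hn
  have hT := logSinh_pos hn h₁ h₂
  have hsub1 : uIcc r₁ r ⊆ uIcc r₁ r₂ := by
    rw [uIcc_of_le hr.1, uIcc_of_le h₂.le]; exact Icc_subset_Icc_right hr.2
  have hsub2 : uIcc r r₂ ⊆ uIcc r₁ r₂ := by
    rw [uIcc_of_le hr.2, uIcc_of_le h₂.le]; exact Icc_subset_Icc_left hr.1
  have hpos : ∀ s ∈ uIcc r₁ r₂, 0 < s := fun s hs => by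
    rw [uIcc_of_le h₂.le] at hs; exact h₁.trans_le hs.1
  have hc : ∀ a : ℝ, 0 < a → ContinuousOn (fun s => logSinh n (a / s)) (uIcc r₁ r₂) :=
    fun a ha => (continuousOn_logSinh n).comp
      (continuousOn_const.div continuousOn_id fun s hs => (hpos s hs).ne')
      fun s hs => div_pos ha (hpos s hs)
  have hc' : ContinuousOn (fun s => logSinh n (s / r₁)) (uIcc r₁ r₂) :=
    (continuousOn_logSinh n).comp (by fun_prop) fun s hs => div_pos (hpos s hs) h₁
  set w : ℝ → ℝ := fun s => s * deriv ϖ s * g s with hw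
  have e1 : ∀ a b : ℝ, ∫ s in a..b, s * deriv ϖ s * logSinh n (r / s) * g s
      = ∫ s in a..b, w s * logSinh n (r / s) := fun a b => by
    congr 1; funext s; ring
  have e2 : ∀ a b : ℝ, ∫ s in a..b, s * deriv ϖ s * logSinh n (r₂ / s) * g s
      = ∫ s in a..b, w s * logSinh n (r₂ / s) := fun a b => by
    congr 1; funext s; ring
  have i2 := hg.mul_continuousOn (hc r₂ (h₁.trans h₂))
  have i1 := (hg.mul_continuousOn (hc r hr0)).mono_set hsub1
  have i3 := (hg.mul_continuousOn hc').mono_set hsub1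
  -- Below `r`, the Volterra term and the boundary correction merge, by the Plücker relation, into
  -- the branch `s ≤ r` of the Green kernel. Above `r`, the boundary correction alone is the other
  -- branch.
  have key : (∫ s in r₁..r, w s * logSinh n (r / s)) * logSinh n (r₂ / r₁)
      - logSinh n (r / r₁) * ∫ s in r₁..r, w s * logSinh n (r₂ / s)
      = -(logSinh n (r₂ / r) * ∫ s in r₁..r, w s * logSinh n (s / r₁)) := by
    rw [← intervalIntegral.integral_mul_const, ← intervalIntegral.integral_const_mul,
      ← intervalIntegral.integral_const_mul, ← intervalIntegral.integral_sub,
      ← intervalIntegral.integral_neg]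
    · refine intervalIntegral.integral_congr fun s hs => ?_
      have := logSinh_mul_sub n hr0 (hpos s (hsub1 hs)) (h₁.trans h₂) h₁
      linear_combination w s * this
    · exact i1.mul_const _
    · exact (i2.mono_set hsub1).const_mul _
  unfold modeOp
  rw [intervalIntegral_green h₁ h₂ hr hg, e1, e2, add_sub_assoc, sub_eq_add_neg _ (_ / _)]
  congr 1
  rw [← intervalIntegral.integral_add_adjacent_intervals (i2.mono_set hsub1) (i2.mono_set hsub2)]
  field_simp
  linear_combination key

end Green

/-! ### Fixed points of a rank-one operator plus a small perturbation -/

section RankOne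

variable {X : Type*} [NormedAddCommGroup X] [NormedSpace ℝ X] {E : X →L[ℝ] X} {ℓ : X →L[ℝ] ℝ}
  {b v : X} {η K : ℝ}

/-- Here `(1 - E) v = c b` and `‖E‖ ≤ 1/2`, so inverting `1 - E` costs at most a factor 2. With `c =
0` it gives `v = 0`. -/
lemma norm_le_of_eq_add_smul (hE : ‖E‖ ≤ η) (hη : η ≤ 1 / 2) {c : ℝ} (hb : ‖b‖ ≤ 1)
    (hv : v = E v + c • b) : ‖v‖ ≤ 2 * |c| := by
  have h1 : ‖v‖ ≤ ‖E v‖ + ‖c • b‖ := by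
    conv_lhs => rw [hv]
    exact norm_add_le _ _
  rw [norm_smul, Real.norm_eq_abs] at h1
  have h2 := (E.le_opNorm v).trans (mul_le_mul_of_nonneg_right hE (norm_nonneg v))
  nlinarith [norm_nonneg v, abs_nonneg c]

lemma abs_apply_le_of_eq_add_smul (hE : ‖E‖ ≤ η) (hη : η ≤ 1 / 2) (hℓ : ‖ℓ‖ ≤ K) {c : ℝ}
    (hb : ‖b‖ ≤ 1) (hv : v = E v + c • b) : |ℓ v - c * ℓ b| ≤ 2 * K * η * |c| := by
  have h0 := norm_le_of_eq_add_smul hE hη hb hv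
  have h1 : ℓ v - c * ℓ b = ℓ (E v) := by
    conv_lhs => rw [hv]
    simp
  have hK : 0 ≤ K := (norm_nonneg _).trans hℓ
  have hη0 : 0 ≤ η := (norm_nonneg _).trans hE
  rw [h1, ← Real.norm_eq_abs]
  calc ‖ℓ (E v)‖ ≤ K * (η * (2 * |c|)) :=
        (ℓ.le_opNorm _).trans (mul_le_mul hℓ ((E.le_opNorm v).trans
          (mul_le_mul hE h0 (norm_nonneg _) hη0)) (norm_nonneg _) hK)
    _ = _ := by ring

/-- A nonzero fixed point of a rank-one operator plus a small perturbation forces the rank-one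
eigenvalue to be close to one. -/
lemma abs_sub_one_le_of_fixed (hE : ‖E‖ ≤ η) (hη : η ≤ 1 / 2) (hℓ : ‖ℓ‖ ≤ K) (hb : ‖b‖ ≤ 1)
    (hv : v = E v + ℓ v • b) (hv0 : v ≠ 0) : |ℓ b - 1| ≤ 2 * K * η := by
  have h0 := norm_le_of_eq_add_smul hE hη hb hv
  have h1 := abs_apply_le_of_eq_add_smul hE hη hℓ hb hv
  have h2 : 0 < |ℓ v| := by
    have := norm_pos_iff.2 hv0
    linarith
  have h3 : ℓ v - ℓ v * ℓ b = -(ℓ v * (ℓ b - 1)) := by ring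
  rw [h3, abs_neg, abs_mul, mul_comm] at h1
  exact le_of_mul_le_mul_right h1 h2

lemma exists_eq_smul_of_fixed (hE : ‖E‖ ≤ η) (hη : η ≤ 1 / 2) (hb : ‖b‖ ≤ 1)
    {v w : X} (hv : v = E v + ℓ v • b) (hv0 : v ≠ 0) (hw : w = E w + ℓ w • b) :
    ∃ c : ℝ, w = c • v := by
  have h2 : ℓ v ≠ 0 := by
    intro h
    have := norm_le_of_eq_add_smul hE hη hb hv
    rw [h, abs_zero, mul_zero] at this
    exact hv0 (norm_le_zero_iff.1 this)
  refine ⟨ℓ w / ℓ v, ?_⟩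
  -- The multiple of `v` is chosen so that `ℓ` vanishes on the difference; the rank-one term then
  -- disappears.
  have h3 : w - (ℓ w / ℓ v) • v = E (w - (ℓ w / ℓ v) • v) + (0 : ℝ) • b := by
    have hc : ℓ w = ℓ w / ℓ v * ℓ v := (div_mul_cancel₀ _ h2).symm
    rw [map_sub, map_smul]
    calc w - (ℓ w / ℓ v) • v = (E w + ℓ w • b) - (ℓ w / ℓ v) • (E v + ℓ v • b) := by
          rw [← hw, ← hv]
      _ = (E w + (ℓ w / ℓ v * ℓ v) • b) - (ℓ w / ℓ v) • (E v + ℓ v • b) := by rw [← hc]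
      _ = _ := by module
  have := norm_le_of_eq_add_smul hE hη hb h3
  rw [abs_zero, mul_zero] at this
  exact sub_eq_zero.1 (norm_le_zero_iff.1 this)

/-- The vector `w_t = (1 - E_t)⁻¹ b` is a fixed point as soon as `ℓ_t(w_t) = 1`. This number is
continuous in `t` and differs from `ℓ_t(b)` by at most `2Kη`, so the margins at the two ends allow
the intermediate value theorem. -/
lemma exists_fixed [CompleteSpace X] {α β : ℝ} (hαβ : α ≤ β) {E : ℝ → X →L[ℝ] X}
    {ℓ : ℝ → X →L[ℝ] ℝ} (hEc : ContinuousOn E (Icc α β)) (hℓc : ContinuousOn ℓ (Icc α β))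
    (hE : ∀ t ∈ Icc α β, ‖E t‖ ≤ η) (hη : η ≤ 1 / 2) (hℓ : ∀ t ∈ Icc α β, ‖ℓ t‖ ≤ K)
    (hb : ‖b‖ ≤ 1) (hα : 1 + 2 * K * η ≤ ℓ α b) (hβ : ℓ β b ≤ 1 - 2 * K * η) :
    ∃ t ∈ Icc α β, ∃ v : X, v ≠ 0 ∧ v = E t v + ℓ t v • b := by
  have hu : ∀ t ∈ Icc α β, IsUnit (1 - E t) := fun t ht =>
    isUnit_one_sub_of_norm_lt_one ((hE t ht).trans_lt (by linarith))
  set w : ℝ → X := fun t => Ring.inverse (1 - E t) b with hw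
  have hwc : ContinuousOn w (Icc α β) := by
    intro t ht
    have h1 : ContinuousAt Ring.inverse (1 - E t) := by
      obtain ⟨u, hu⟩ := hu t ht
      rw [← hu]
      exact NormedRing.inverse_continuousAt u
    have h2 : ContinuousWithinAt (fun t => Ring.inverse (1 - E t)) (Icc α β) t :=
      ContinuousAt.comp_continuousWithinAt (f := fun t => 1 - E t) h1
        (continuousWithinAt_const.sub (hEc t ht))
    exact h2.clm_apply continuousWithinAt_const
  have hweq : ∀ t ∈ Icc α β, w t = E t (w t) + (1 : ℝ) • b := fun t ht => by
    have h1 : (1 - E t) (w t) = b := by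
      have := Ring.mul_inverse_cancel _ (hu t ht)
      have := congrArg (fun T : X →L[ℝ] X => T b) this
      simpa using this
    have h2 : w t - E t (w t) = b := h1
    rw [one_smul, ← h2]
    abel
  have hF : ContinuousOn (fun t => ℓ t (w t)) (Icc α β) := hℓc.clm_apply hwc
  have hest : ∀ t ∈ Icc α β, |ℓ t (w t) - ℓ t b| ≤ 2 * K * η := fun t ht => by
    simpa using abs_apply_le_of_eq_add_smul (hE t ht) hη (hℓ t ht) hb (hweq t ht)
  have h1 := abs_le.1 (hest α (left_mem_Icc.2 hαβ))
  have h2 := abs_le.1 (hest β (right_mem_Icc.2 hαβ))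
  obtain ⟨t, ht, hFt⟩ := intermediate_value_Icc' hαβ hF
    (show (1 : ℝ) ∈ Icc _ _ from ⟨by linarith, by linarith⟩)
  refine ⟨t, ht, w t, fun h => ?_, ?_⟩
  · simp only [h, map_zero] at hFt
    exact zero_ne_one hFt
  · have h3 := hweq t ht
    rwa [← hFt] at h3

end RankOne

/-! ### Integral operators on continuous functions -/

section IntegralOperator

lemma inverse_apply_of_forall_ne_zero {K : Type*} [TopologicalSpace K] {d : C(K, ℝ)} (hd : ∀ s, d s ≠ 0) (s : K) :
    (Ring.inverse d) s = (d s)⁻¹ := by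
  have hu : IsUnit d := (ContinuousMap.isUnit_iff_forall_ne_zero _).2 hd
  have := congrArg (fun f : C(K, ℝ) => f s) (Ring.mul_inverse_cancel d hu)
  simp only [ContinuousMap.mul_apply, ContinuousMap.one_apply] at this
  exact eq_inv_of_mul_eq_one_right this

lemma abs_integral_le_of_abs_le {K : Type*} [MeasurableSpace K] (μ : Measure K)
    [IsFiniteMeasure μ] {f : K → ℝ} {c : ℝ} (hf : ∀ s, |f s| ≤ c) :
    |∫ s, f s ∂μ| ≤ c * μ.real univ := by
  rw [← Real.norm_eq_abs]
  exact norm_integral_le_of_norm_le_const (Filter.Eventually.of_forall hf)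

variable {K : Type*} [TopologicalSpace K] [CompactSpace K] [MeasurableSpace K] [BorelSpace K]
  (μ : Measure K) [IsFiniteMeasure μ]

lemma integrable_continuousMap (f : C(K, ℝ)) : Integrable f μ :=
  f.continuous.integrable_of_hasCompactSupport (HasCompactSupport.of_compactSpace f)

/-- Integration of continuous functions as a continuous linear functional. -/
noncomputable def integralL : C(K, ℝ) →L[ℝ] ℝ :=
  LinearMap.mkContinuous
    { toFun := fun f => ∫ s, f s ∂μ
      map_add' := fun f g => integral_add (integrable_continuousMap μ f)
        (integrable_continuousMap μ g)
      map_smul' := fun c f => integral_const_mul c f } (μ.real univ) fun f => by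
    rw [mul_comm]
    exact abs_integral_le_of_abs_le μ fun s => f.norm_coe_le_norm s

lemma integralL_apply (f : C(K, ℝ)) : integralL μ f = ∫ s, f s ∂μ := rfl

/-- The integral operator with kernel `k`. -/
noncomputable def integralOp (k : C(K × K, ℝ)) : C(K, ℝ) →L[ℝ] C(K, ℝ) :=
  LinearMap.mkContinuous
    { toFun := fun f => ⟨fun r => integralL μ (k.curry r * f), by fun_prop⟩
      map_add' := fun f g => by ext r; simp [mul_add]
      map_smul' := fun c f => by ext r; simp } (‖k‖ * μ.real univ) fun f => by
    have h0 : 0 ≤ ‖k‖ * μ.real univ * ‖f‖ := by positivity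
    refine (ContinuousMap.norm_le _ h0).2 fun r => ?_
    have := abs_integral_le_of_abs_le μ (f := k.curry r * f) (c := ‖k‖ * ‖f‖) fun s => by
      change |k (r, s) * f s| ≤ _
      rw [abs_mul]
      exact mul_le_mul (k.norm_coe_le_norm (r, s)) (f.norm_coe_le_norm s) (abs_nonneg _)
        (norm_nonneg _)
    refine le_trans this (le_of_eq ?_)
    ring

lemma integralOp_apply (k : C(K × K, ℝ)) (f : C(K, ℝ)) (r : K) :
    integralOp μ k f r = ∫ s, k (r, s) * f s ∂μ := rfl

/-- `v` is a fixed point of the integral operator with kernel `k(r, s) / d(s)`. -/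
def IsFixed (k : C(K × K, ℝ)) (d v : C(K, ℝ)) : Prop :=
  ∀ r, v r = ∫ s, k (r, s) * ((d s)⁻¹ * v s) ∂μ

variable {μ}
variable {k k₀ : C(K × K, ℝ)} {w b : C(K, ℝ)}

/-- The small part of the operator. -/
noncomputable def smallOp (μ : Measure K) [IsFiniteMeasure μ] (k₀ : C(K × K, ℝ)) (d : C(K, ℝ)) :
    C(K, ℝ) →L[ℝ] C(K, ℝ) :=
  (integralOp μ k₀).comp (ContinuousLinearMap.mul ℝ C(K, ℝ) (Ring.inverse d))

/-- The functional of the rank-one part. -/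
noncomputable def rankOneL (μ : Measure K) [IsFiniteMeasure μ] (w d : C(K, ℝ)) :
    C(K, ℝ) →L[ℝ] ℝ :=
  (integralL μ).comp (ContinuousLinearMap.mul ℝ C(K, ℝ) (w * Ring.inverse d))

/-- The separable part `b(r) w(s)` of the kernel becomes the rank-one term. Division by `d` is
expressed through `Ring.inverse` in the Banach algebra of continuous functions, where continuity of
inversion is available. -/
lemma isFixed_iff (hk : ∀ r s, k (r, s) = k₀ (r, s) + b r * w s) {d v : C(K, ℝ)}
    (hd : ∀ s, d s ≠ 0) :
    IsFixed μ k d v ↔ v = smallOp μ k₀ d v + rankOneL μ w d v • b := by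
  have key : ∀ r, ∫ s, k (r, s) * ((d s)⁻¹ * v s) ∂μ
      = (smallOp μ k₀ d v + rankOneL μ w d v • b) r := fun r => by
    have i1 : Integrable (fun s => k₀ (r, s) * ((d s)⁻¹ * v s)) μ := by
      convert integrable_continuousMap μ (k₀.curry r * (Ring.inverse d * v)) using 2 with s
      simp [inverse_apply_of_forall_ne_zero hd]
    have i2 : Integrable (fun s => w s * (d s)⁻¹ * v s) μ := by
      convert integrable_continuousMap μ (w * Ring.inverse d * v) using 2 with s
      simp [inverse_apply_of_forall_ne_zero hd]
    have e1 : smallOp μ k₀ d v r = ∫ s, k₀ (r, s) * ((d s)⁻¹ * v s) ∂μ := by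
      simp [smallOp, integralOp_apply, inverse_apply_of_forall_ne_zero hd]
    have e2 : rankOneL μ w d v = ∫ s, w s * (d s)⁻¹ * v s ∂μ := by
      simp [rankOneL, integralL_apply, inverse_apply_of_forall_ne_zero hd]
    rw [ContinuousMap.add_apply, ContinuousMap.smul_apply, e1, e2, smul_eq_mul,
      ← integral_mul_const, ← integral_add i1 (i2.mul_const _)]
    refine integral_congr_ae (Filter.Eventually.of_forall fun s => ?_)
    simp only [hk]
    ring
  constructor
  · intro h
    ext r
    rw [h r, key r]
  · intro h r
    rw [key r, ← h]

lemma norm_smallOp_le {d : C(K, ℝ)} (hd : ∀ s, d s ≠ 0) {P : ℝ} (hP : 0 ≤ P)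
    (h : ∀ r s, |k₀ (r, s) * (d s)⁻¹| ≤ P) : ‖smallOp μ k₀ d‖ ≤ P * μ.real univ := by
  refine ContinuousLinearMap.opNorm_le_bound _ (by positivity) fun f => ?_
  refine (ContinuousMap.norm_le _ (by positivity)).2 fun r => ?_
  have e1 : smallOp μ k₀ d f r = ∫ s, k₀ (r, s) * ((d s)⁻¹ * f s) ∂μ := by
    simp [smallOp, integralOp_apply, inverse_apply_of_forall_ne_zero hd]
  rw [e1, Real.norm_eq_abs]
  refine (abs_integral_le_of_abs_le μ (c := P * ‖f‖) fun s => ?_).trans (le_of_eq (by ring))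
  rw [← mul_assoc, abs_mul]
  exact mul_le_mul (h r s) (f.norm_coe_le_norm s) (abs_nonneg _) hP

lemma norm_rankOneL_le {d : C(K, ℝ)} (hd : ∀ s, d s ≠ 0) {Q : ℝ} (hQ : 0 ≤ Q)
    (h : ∀ s, |w s * (d s)⁻¹| ≤ Q) : ‖rankOneL μ w d‖ ≤ Q * μ.real univ := by
  refine ContinuousLinearMap.opNorm_le_bound _ (by positivity) fun f => ?_
  have e2 : rankOneL μ w d f = ∫ s, w s * (d s)⁻¹ * f s ∂μ := by
    simp [rankOneL, integralL_apply, inverse_apply_of_forall_ne_zero hd]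
  rw [e2, Real.norm_eq_abs]
  refine (abs_integral_le_of_abs_le μ (c := Q * ‖f‖) fun s => ?_).trans (le_of_eq (by ring))
  rw [abs_mul]
  exact mul_le_mul (h s) (f.norm_coe_le_norm s) (abs_nonneg _) hQ

lemma rankOneL_apply {d : C(K, ℝ)} (hd : ∀ s, d s ≠ 0) (f : C(K, ℝ)) :
    rankOneL μ w d f = ∫ s, w s * (d s)⁻¹ * f s ∂μ := by
  simp [rankOneL, integralL_apply, inverse_apply_of_forall_ne_zero hd]

variable {P Q V : ℝ}

lemma IsFixed.abs_sub_one_le (hk : ∀ r s, k (r, s) = k₀ (r, s) + b r * w s) {d v : C(K, ℝ)}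
    (hd : ∀ s, d s ≠ 0) (hP0 : 0 ≤ P) (hP : ∀ r s, |k₀ (r, s) * (d s)⁻¹| ≤ P) (hQ0 : 0 ≤ Q)
    (hQ : ∀ s, |w s * (d s)⁻¹| ≤ Q) (hV : μ.real univ = V) (hPV : P * V ≤ 1 / 2)
    (hb : ∀ r, |b r| ≤ 1) (hv : IsFixed μ k d v) (hv0 : v ≠ 0) :
    |(∫ s, w s * (d s)⁻¹ * b s ∂μ) - 1| ≤ 2 * (Q * V) * (P * V) := by
  subst hV
  rw [← rankOneL_apply hd]
  exact abs_sub_one_le_of_fixed (norm_smallOp_le hd hP0 hP) hPV (norm_rankOneL_le hd hQ0 hQ)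
    ((ContinuousMap.norm_le _ zero_le_one).2 hb) ((isFixed_iff hk hd).1 hv) hv0

lemma IsFixed.exists_eq_smul (hk : ∀ r s, k (r, s) = k₀ (r, s) + b r * w s) {d v v' : C(K, ℝ)}
    (hd : ∀ s, d s ≠ 0) (hP0 : 0 ≤ P) (hP : ∀ r s, |k₀ (r, s) * (d s)⁻¹| ≤ P)
    (hV : μ.real univ = V) (hPV : P * V ≤ 1 / 2) (hb : ∀ r, |b r| ≤ 1) (hv : IsFixed μ k d v)
    (hv0 : v ≠ 0) (hv' : IsFixed μ k d v') : ∃ c : ℝ, v' = c • v := by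
  subst hV
  exact exists_eq_smul_of_fixed (norm_smallOp_le hd hP0 hP) hPV
    ((ContinuousMap.norm_le _ zero_le_one).2 hb) ((isFixed_iff hk hd).1 hv) hv0
    ((isFixed_iff hk hd).1 hv')

lemma exists_isFixed (hk : ∀ r s, k (r, s) = k₀ (r, s) + b r * w s) {α β : ℝ} (hαβ : α ≤ β)
    {d : ℝ → C(K, ℝ)} (hdc : Continuous d) (hd : ∀ t ∈ Icc α β, ∀ s, d t s ≠ 0) (hP0 : 0 ≤ P)
    (hP : ∀ t ∈ Icc α β, ∀ r s, |k₀ (r, s) * (d t s)⁻¹| ≤ P) (hQ0 : 0 ≤ Q)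
    (hQ : ∀ t ∈ Icc α β, ∀ s, |w s * (d t s)⁻¹| ≤ Q) (hV : μ.real univ = V)
    (hPV : P * V ≤ 1 / 2) (hb : ∀ r, |b r| ≤ 1)
    (hα : 1 + 2 * (Q * V) * (P * V) ≤ ∫ s, w s * (d α s)⁻¹ * b s ∂μ)
    (hβ : ∫ s, w s * (d β s)⁻¹ * b s ∂μ ≤ 1 - 2 * (Q * V) * (P * V)) :
    ∃ t ∈ Icc α β, ∃ v : C(K, ℝ), v ≠ 0 ∧ IsFixed μ k (d t) v := by
  subst hV
  have hinv : ContinuousOn (fun t => Ring.inverse (d t)) (Icc α β) := fun t ht => by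
    obtain ⟨u, hu⟩ := (ContinuousMap.isUnit_iff_forall_ne_zero _).2 (hd t ht)
    have h1 : ContinuousAt Ring.inverse (d t) := by
      rw [← hu]
      exact NormedRing.inverse_continuousAt u
    exact (ContinuousAt.comp (f := d) h1 hdc.continuousAt).continuousWithinAt
  have hEc : ContinuousOn (fun t => smallOp μ k₀ (d t)) (Icc α β) :=
    continuousOn_const.clm_comp
      ((ContinuousLinearMap.mul ℝ C(K, ℝ)).continuous.comp_continuousOn hinv)
  have hℓc : ContinuousOn (fun t => rankOneL μ w (d t)) (Icc α β) :=
    continuousOn_const.clm_comp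
      ((ContinuousLinearMap.mul ℝ C(K, ℝ)).continuous.comp_continuousOn
        (continuousOn_const.mul hinv))
  rw [← rankOneL_apply (hd α (left_mem_Icc.2 hαβ))] at hα
  rw [← rankOneL_apply (hd β (right_mem_Icc.2 hαβ))] at hβ
  obtain ⟨t, ht, v, hv0, hv⟩ := exists_fixed hαβ hEc hℓc
    (fun t ht => norm_smallOp_le (hd t ht) hP0 (hP t ht)) hPV
    (fun t ht => norm_rankOneL_le (hd t ht) hQ0 (hQ t ht))
    ((ContinuousMap.norm_le _ zero_le_one).2 hb) hα hβ
  exact ⟨t, ht, v, hv0, (isFixed_iff hk (hd t ht)).2 hv⟩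

end IntegralOperator

/-! ### The compact neighbourhood of the two radii -/

/-- The closed `ε`-neighbourhood of the two radii. -/
def nbhd (R₁ R₂ ε : ℝ) : Set ℝ := Icc (R₁ - ε) (R₁ + ε) ∪ Icc (R₂ - ε) (R₂ + ε)

/-- `v` is a continuous solution on `S` of the integral equation of the mode `n`, with weight `W`
and speed `d`. -/
def IsModeSol (r₁ r₂ : ℝ) (S : Set ℝ) (W d : ℝ → ℝ) (n : ℕ) (v : ℝ → ℝ) : Prop :=
  ContinuousOn v S ∧ ∀ r ∈ S, v r = ∫ s in S, W s * green r₁ r₂ n r s * ((d s)⁻¹ * v s)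

/-- A continuous function which vanishes near `R₁` and equals one near `R₂`. -/
noncomputable def cut (R₁ R₂ ε s : ℝ) : ℝ := max 0 (min 1 ((s - (R₁ + ε)) / (R₂ - R₁ - 2 * ε)))

variable {r₁ r₂ R₁ R₂ ε : ℝ}

lemma continuous_cut : Continuous (cut R₁ R₂ ε) := by
  unfold cut
  fun_prop

namespace Admissible

lemma cut_inner (hε : Admissible r₁ r₂ R₁ R₂ ε) {s : ℝ} (hs : s ∈ Icc (R₁ - ε) (R₁ + ε)) :
    cut R₁ R₂ ε s = 0 := by
  have := hε.mid
  refine max_eq_left ((min_le_right _ _).trans (div_nonpos_of_nonpos_of_nonneg ?_ ?_))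
  · linarith [hs.2]
  · linarith

lemma cut_outer (hε : Admissible r₁ r₂ R₁ R₂ ε) {s : ℝ} (hs : s ∈ Icc (R₂ - ε) (R₂ + ε)) :
    cut R₁ R₂ ε s = 1 := by
  have := hε.mid
  have h : 1 ≤ (s - (R₁ + ε)) / (R₂ - R₁ - 2 * ε) := by
    rw [le_div_iff₀ (by linarith)]
    linarith [hs.1]
  unfold cut
  rw [min_eq_left h, max_eq_right zero_le_one]

lemma r₁_lt_r₂ (hε : Admissible r₁ r₂ R₁ R₂ ε) : r₁ < r₂ := by
  linarith [hε.left, hε.mid, hε.right, hε.pos]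

lemma nbhd_subset (hε : Admissible r₁ r₂ R₁ R₂ ε) : nbhd R₁ R₂ ε ⊆ Ioo r₁ r₂ := by
  have h1 := hε.left
  have h2 := hε.mid
  have h3 := hε.right
  have h4 := hε.pos
  rintro x (hx | hx)
  · exact ⟨by linarith [hx.1], by linarith [hx.2]⟩
  · exact ⟨by linarith [hx.1], by linarith [hx.2]⟩

lemma nbhd_subset_Icc (hε : Admissible r₁ r₂ R₁ R₂ ε) : nbhd R₁ R₂ ε ⊆ Icc r₁ r₂ :=
  hε.nbhd_subset.trans Ioo_subset_Icc_self

lemma R₂_mem (hε : Admissible r₁ r₂ R₁ R₂ ε) : R₂ ∈ Ioo r₁ r₂ :=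
  ⟨by linarith [hε.left, hε.mid, hε.pos], by linarith [hε.right, hε.pos]⟩

end Admissible

lemma isCompact_nbhd : IsCompact (nbhd R₁ R₂ ε) := isCompact_Icc.union isCompact_Icc

lemma measurableSet_nbhd : MeasurableSet (nbhd R₁ R₂ ε) := measurableSet_Icc.union measurableSet_Icc

instance : CompactSpace (nbhd R₁ R₂ ε) := isCompact_iff_compactSpace.1 isCompact_nbhd

lemma Admissible.volume_nbhd (hε : Admissible r₁ r₂ R₁ R₂ ε) :
    volume (nbhd R₁ R₂ ε) = ENNReal.ofReal (4 * ε) := by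
  have := hε.pos
  unfold nbhd
  rw [measure_union ?_ measurableSet_Icc, Real.volume_Icc, Real.volume_Icc,
    ← ENNReal.ofReal_add (by linarith) (by linarith)]
  · congr 1; ring
  · rw [Set.disjoint_left]
    intro x h1 h2
    linarith [h1.2, h2.1, hε.mid]

/-- Lebesgue measure on the closed neighbourhood of the two radii. -/
noncomputable def nbhdMeasure (R₁ R₂ ε : ℝ) : Measure (nbhd R₁ R₂ ε) :=
  Measure.comap Subtype.val volume

lemma nbhdMeasure_univ : nbhdMeasure R₁ R₂ ε univ = volume (nbhd R₁ R₂ ε) := by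
  rw [nbhdMeasure, comap_subtype_coe_apply measurableSet_nbhd, image_univ, Subtype.range_coe]

instance : IsFiniteMeasure (nbhdMeasure R₁ R₂ ε) := ⟨by
  rw [nbhdMeasure_univ]
  exact isCompact_nbhd.measure_lt_top⟩

lemma Admissible.real_nbhdMeasure_univ (hε : Admissible r₁ r₂ R₁ R₂ ε) :
    (nbhdMeasure R₁ R₂ ε).real univ = 4 * ε := by
  have := hε.pos
  rw [Measure.real, nbhdMeasure_univ, hε.volume_nbhd, ENNReal.toReal_ofReal (by linarith)]

lemma integral_nbhd_eq (f : ℝ → ℝ) :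
    ∫ s, f s ∂nbhdMeasure R₁ R₂ ε = ∫ s in nbhd R₁ R₂ ε, f s :=
  integral_subtype_comap measurableSet_nbhd f

/-! ### Rank-one structure of the mode equations -/

section Transfer

/-- The kernel of the mode `n`. -/
noncomputable def modeKernel (hε : Admissible r₁ r₂ R₁ R₂ ε) {W : ℝ → ℝ}
    (hW : ContinuousOn W (nbhd R₁ R₂ ε)) (n : ℕ) : C(nbhd R₁ R₂ ε × nbhd R₁ R₂ ε, ℝ) where
  toFun p := W p.2 * green r₁ r₂ n p.1 p.2
  continuous_toFun := by
    have h0 := hε.nbhd_subset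
    have h1 : Continuous fun p : nbhd R₁ R₂ ε × nbhd R₁ R₂ ε => W p.2 :=
      hW.comp_continuous (by fun_prop) fun p => p.2.2
    refine h1.mul ((continuousOn_green hε.r₁_pos (hε.r₁_pos.trans hε.r₁_lt_r₂) n).comp_continuous
      (f := fun p : nbhd R₁ R₂ ε × nbhd R₁ R₂ ε => ((p.1 : ℝ), (p.2 : ℝ))) (by fun_prop)
      fun p => ⟨hε.r₁_pos.trans (h0 p.1.2).1, hε.r₁_pos.trans (h0 p.2.2).1⟩)

/-- The function `r ↦ N_n(r, R₂)`. -/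
noncomputable def modeVec (hε : Admissible r₁ r₂ R₁ R₂ ε) (n : ℕ) : C(nbhd R₁ R₂ ε, ℝ) where
  toFun r := green r₁ r₂ n r R₂
  continuous_toFun := by
    have h0 := hε.nbhd_subset
    simp only [fun r : ℝ => green_comm r₁ r₂ n r R₂]
    exact (continuousOn_green_right hε.r₁_pos (hε.r₁_pos.trans hε.r₁_lt_r₂) n
      (hε.r₁_pos.trans hε.R₂_mem.1)).comp_continuous continuous_subtype_val
      fun r => hε.r₁_pos.trans (h0 r.2).1

/-- The weight restricted to the neighbourhood of `R₂`. -/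
noncomputable def outerWeight {W : ℝ → ℝ} (hW : ContinuousOn W (nbhd R₁ R₂ ε)) :
    C(nbhd R₁ R₂ ε, ℝ) where
  toFun s := cut R₁ R₂ ε s * W s
  continuous_toFun :=
    (continuous_cut.comp continuous_subtype_val).mul
      (hW.comp_continuous continuous_subtype_val fun p => p.2)

/-- The part of the kernel which acts as a small operator. -/
noncomputable def smallKernel (hε : Admissible r₁ r₂ R₁ R₂ ε) {W : ℝ → ℝ}
    (hW : ContinuousOn W (nbhd R₁ R₂ ε)) (n : ℕ) : C(nbhd R₁ R₂ ε × nbhd R₁ R₂ ε, ℝ) :=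
  modeKernel hε hW n - ((modeVec hε n).comp ContinuousMap.fst)
    * (outerWeight hW).comp ContinuousMap.snd

lemma smallKernel_apply (hε : Admissible r₁ r₂ R₁ R₂ ε) {W : ℝ → ℝ}
    (hW : ContinuousOn W (nbhd R₁ R₂ ε)) (n : ℕ) (r s : nbhd R₁ R₂ ε) :
    smallKernel hε hW n (r, s)
      = W s * green r₁ r₂ n r s - green r₁ r₂ n r R₂ * (cut R₁ R₂ ε s * W s) := rfl

lemma modeKernel_eq (hε : Admissible r₁ r₂ R₁ R₂ ε) {W : ℝ → ℝ}
    (hW : ContinuousOn W (nbhd R₁ R₂ ε)) (n : ℕ) (r s : nbhd R₁ R₂ ε) :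
    modeKernel hε hW n (r, s)
      = smallKernel hε hW n (r, s) + modeVec hε n r * outerWeight hW s := by
  simp [smallKernel]

lemma isFixed_of_isModeSol (hε : Admissible r₁ r₂ R₁ R₂ ε) {W : ℝ → ℝ}
    (hW : ContinuousOn W (nbhd R₁ R₂ ε)) {d v : ℝ → ℝ} (hd : ContinuousOn d (nbhd R₁ R₂ ε)) {n : ℕ}
    (hv : IsModeSol r₁ r₂ (nbhd R₁ R₂ ε) W d n v) :
    IsFixed (nbhdMeasure R₁ R₂ ε) (modeKernel hε hW n) ⟨_, hd.domRestrict⟩ ⟨_, hv.1.domRestrict⟩ := by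
  intro r
  have := hv.2 r r.2
  rw [← integral_nbhd_eq (fun s => W s * green r₁ r₂ n r s * ((d s)⁻¹ * v s))] at this
  exact this

/-- The quantitative hypotheses on weight and speed. -/
structure SpeedBound (r₁ r₂ R₁ R₂ ε C : ℝ) (W d : ℝ → ℝ) : Prop where
  adm : Admissible r₁ r₂ R₁ R₂ ε
  pos : 0 < C
  small : C * (1 + 1 / r₁) * (4 * ε) ≤ 1 / 2
  weight : ContinuousOn W (nbhd R₁ R₂ ε)
  speed : ContinuousOn d (nbhd R₁ R₂ ε)
  ne_zero : ∀ s ∈ nbhd R₁ R₂ ε, d s ≠ 0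
  inner : ∀ s ∈ Icc (R₁ - ε) (R₁ + ε), |W s * (d s)⁻¹| ≤ C
  outer : ∀ s ∈ Icc (R₂ - ε) (R₂ + ε), |W s * (d s)⁻¹| ≤ C / ε

namespace SpeedBound

variable {C : ℝ} {W d : ℝ → ℝ} {n : ℕ}

/-- Near `R₁` the frozen kernel is cut off and `W/d` is bounded by `C`. Near `R₂` the factor `C/ε`
from `W/d` is compensated by the Lipschitz bound `ε/r₁` for `G_n(r,s) - G_n(r,R₂)`. -/
lemma smallKernel_bound (h : SpeedBound r₁ r₂ R₁ R₂ ε C W d) (hn : 1 ≤ n)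
    (r s : nbhd R₁ R₂ ε) :
    |smallKernel h.adm h.weight n (r, s) * (d s)⁻¹| ≤ C * (1 + 1 / r₁) := by
  have h₁ := h.adm.r₁_pos
  have h₂ := h.adm.r₁_lt_r₂
  have hC := h.pos
  have hp := h.adm.pos
  have hr := h.adm.nbhd_subset_Icc r.2
  have hs := h.adm.nbhd_subset_Icc s.2
  have hR₂ := Ioo_subset_Icc_self h.adm.R₂_mem
  rw [smallKernel_apply]
  rcases s.2 with hs' | hs'
  · rw [h.adm.cut_inner hs', zero_mul, mul_zero, sub_zero, mul_right_comm, abs_mul,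
      abs_of_nonneg (green_nonneg h₁ h₂ hr hs)]
    have a := h.inner s hs'
    have b := green_le_half hn h₁ h₂ hr hs
    have b' := green_nonneg (n := n) h₁ h₂ hr hs
    have : 0 ≤ C * (1 / r₁) := by positivity
    nlinarith [mul_le_mul a b b' hC.le]
  · rw [h.adm.cut_outer hs', one_mul, mul_comm (green r₁ r₂ n r R₂), ← mul_sub, mul_right_comm,
      abs_mul, green_comm r₁ r₂ n r s, green_comm r₁ r₂ n r R₂]
    have a := h.outer s hs'
    have b := abs_green_sub_le hn h₁ h₂ hs hR₂ hr
    have c : |(s : ℝ) - R₂| ≤ ε := by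
      rw [abs_le]; constructor <;> linarith [hs'.1, hs'.2]
    have b' : |green r₁ r₂ n s r - green r₁ r₂ n R₂ r| ≤ 1 / r₁ * ε :=
      b.trans (mul_le_mul_of_nonneg_left c (by positivity))
    refine (mul_le_mul a b' (abs_nonneg _) (by positivity)).trans ?_
    have : C / ε * (1 / r₁ * ε) = C * (1 / r₁) := by field_simp
    rw [this, mul_add]
    linarith

lemma outerWeight_bound (h : SpeedBound r₁ r₂ R₁ R₂ ε C W d) (s : nbhd R₁ R₂ ε) :
    |outerWeight h.weight s * (d s)⁻¹| ≤ C / ε := by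
  have hC := h.pos
  have hp := h.adm.pos
  change |cut R₁ R₂ ε s * W s * (d s)⁻¹| ≤ _
  rcases s.2 with hs' | hs'
  · rw [h.adm.cut_inner hs', zero_mul, zero_mul, abs_zero]
    positivity
  · rw [h.adm.cut_outer hs', one_mul]
    exact h.outer s hs'

lemma modeVec_bound (h : SpeedBound r₁ r₂ R₁ R₂ ε C W d) (hn : 1 ≤ n) (r : nbhd R₁ R₂ ε) :
    |modeVec h.adm n r| ≤ 1 := by
  have hr := h.adm.nbhd_subset_Icc r.2
  have hR₂ := Ioo_subset_Icc_self h.adm.R₂_mem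
  change |green r₁ r₂ n r R₂| ≤ 1
  rw [abs_of_nonneg (green_nonneg h.adm.r₁_pos h.adm.r₁_lt_r₂ hr hR₂)]
  linarith [green_le_half hn h.adm.r₁_pos h.adm.r₁_lt_r₂ hr hR₂]

lemma integral_outer (h : SpeedBound r₁ r₂ R₁ R₂ ε C W d) :
    ∫ s, outerWeight h.weight s * (d s)⁻¹ * modeVec h.adm n s ∂nbhdMeasure R₁ R₂ ε
      = ∫ s in Icc (R₂ - ε) (R₂ + ε), W s * (d s)⁻¹ * green r₁ r₂ n s R₂ := by
  have e1 := integral_nbhd_eq (R₁ := R₁) (R₂ := R₂) (ε := ε)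
    (fun s => cut R₁ R₂ ε s * W s * (d s)⁻¹ * green r₁ r₂ n s R₂)
  refine e1.trans ?_
  rw [setIntegral_eq_of_subset_of_forall_sdiff_eq_zero measurableSet_nbhd
    (subset_union_right : Icc (R₂ - ε) (R₂ + ε) ⊆ nbhd R₁ R₂ ε)]
  · refine setIntegral_congr_fun measurableSet_Icc fun s hs => ?_
    rw [h.adm.cut_outer hs, one_mul]
  · rintro s ⟨hs | hs, hs'⟩
    · rw [h.adm.cut_inner hs]
      ring
    · exact absurd hs hs'

lemma integrableOn_outer (h : SpeedBound r₁ r₂ R₁ R₂ ε C W d) :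
    IntegrableOn (fun s => W s * (d s)⁻¹) (Icc (R₂ - ε) (R₂ + ε)) :=
  ((h.weight.mul (h.speed.inv₀ h.ne_zero)).mono subset_union_right).integrableOn_Icc

/-- Freezing the Green function on the diagonal costs `ε/r₁` pointwise, against a weight `C/ε` on an
interval of length `2ε`. -/
lemma abs_integral_outer_sub_le (h : SpeedBound r₁ r₂ R₁ R₂ ε C W d) (hn : 1 ≤ n) :
    |(∫ s, outerWeight h.weight s * (d s)⁻¹ * modeVec h.adm n s ∂nbhdMeasure R₁ R₂ ε)
        - green r₁ r₂ n R₂ R₂ * ∫ s in Icc (R₂ - ε) (R₂ + ε), W s * (d s)⁻¹|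
      ≤ 2 * C / r₁ * ε := by
  have h₁ := h.adm.r₁_pos
  have h₂ := h.adm.r₁_lt_r₂
  have hC := h.pos
  have hp := h.adm.pos
  have hR₂ := Ioo_subset_Icc_self h.adm.R₂_mem
  have hg : ContinuousOn (fun s => green r₁ r₂ n s R₂) (Icc (R₂ - ε) (R₂ + ε)) := by
    simp only [fun r : ℝ => green_comm r₁ r₂ n r R₂]
    refine (continuousOn_green_right h₁ (h₁.trans h₂) n (h₁.trans h.adm.R₂_mem.1)).mono ?_
    exact fun s hs => h₁.trans (h.adm.nbhd_subset (Or.inr hs)).1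
  rw [h.integral_outer, ← integral_const_mul, ← integral_sub
    (h.integrableOn_outer.mul_continuousOn hg isCompact_Icc)
    (h.integrableOn_outer.const_mul _), ← Real.norm_eq_abs]
  have hvol : (volume.restrict (Icc (R₂ - ε) (R₂ + ε))).real univ = 2 * ε := by
    rw [measureReal_restrict_apply_univ, Real.volume_real_Icc, max_eq_left (by linarith)]
    ring
  have := norm_setIntegral_le_of_norm_le_const (μ := volume) (s := Icc (R₂ - ε) (R₂ + ε))
    (f := fun s => W s * (d s)⁻¹ * green r₁ r₂ n s R₂
      - green r₁ r₂ n R₂ R₂ * (W s * (d s)⁻¹)) (C := C / ε * (1 / r₁ * ε))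
    measure_Icc_lt_top fun s hs => by
      have hs' := h.adm.nbhd_subset_Icc (Or.inr hs)
      have c : |(s : ℝ) - R₂| ≤ ε := by
        rw [abs_le]; constructor <;> linarith [hs.1, hs.2]
      rw [mul_comm (green r₁ r₂ n R₂ R₂), ← mul_sub, norm_mul]
      refine mul_le_mul (h.outer s hs) ?_ (norm_nonneg _) (by positivity)
      exact (abs_green_sub_le hn h₁ h₂ hs' hR₂ hR₂).trans
        (mul_le_mul_of_nonneg_left c (by positivity))
  refine this.trans (le_of_eq ?_)
  rw [measureReal_restrict_apply_univ] at hvol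
  rw [hvol]
  field_simp

/-- The constant in the eigenvalue estimates. -/
noncomputable def const (r₁ C : ℝ) : ℝ := 32 * C ^ 2 * (1 + 1 / r₁) + 2 * C / r₁

/-- The first summand is the error `2Kη` of the abstract rank-one estimate, the second that of
freezing the Green function at `R₂`. -/
lemma const_eq (h : SpeedBound r₁ r₂ R₁ R₂ ε C W d) :
    2 * (C / ε * (4 * ε)) * (C * (1 + 1 / r₁) * (4 * ε)) + 2 * C / r₁ * ε = const r₁ C * ε := by
  have := h.adm.pos
  have := h.adm.r₁_pos
  unfold const
  field_simp
  ring

lemma abs_green_mul_sub_one_le (h : SpeedBound r₁ r₂ R₁ R₂ ε C W d) (hn : 1 ≤ n) {v : ℝ → ℝ}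
    (hv : IsModeSol r₁ r₂ (nbhd R₁ R₂ ε) W d n v) (hv0 : ∃ r ∈ nbhd R₁ R₂ ε, v r ≠ 0) :
    |green r₁ r₂ n R₂ R₂ * (∫ s in Icc (R₂ - ε) (R₂ + ε), W s * (d s)⁻¹) - 1|
      ≤ const r₁ C * ε := by
  have h₁ := h.adm.r₁_pos
  have hC := h.pos
  have hp := h.adm.pos
  obtain ⟨r, hr, hvr⟩ := hv0
  have h1 := (isFixed_of_isModeSol h.adm h.weight h.speed hv).abs_sub_one_le
    (modeKernel_eq h.adm h.weight n) (fun s => h.ne_zero s s.2) (by positivity)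
    (h.smallKernel_bound hn) (by positivity) h.outerWeight_bound h.adm.real_nbhdMeasure_univ
    h.small (h.modeVec_bound hn)
    (fun h0 => hvr (congrArg (fun f : C(nbhd R₁ R₂ ε, ℝ) => f ⟨r, hr⟩) h0))
  have h2 := h.abs_integral_outer_sub_le hn
  rw [← h.const_eq]
  rw [abs_sub_comm] at h2
  exact (abs_sub_le _ _ _).trans (by rw [add_comm]; exact add_le_add h1 h2)

lemma exists_eq_mul (h : SpeedBound r₁ r₂ R₁ R₂ ε C W d) (hn : 1 ≤ n) {v w : ℝ → ℝ}
    (hv : IsModeSol r₁ r₂ (nbhd R₁ R₂ ε) W d n v) (hv0 : ∃ r ∈ nbhd R₁ R₂ ε, v r ≠ 0)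
    (hw : IsModeSol r₁ r₂ (nbhd R₁ R₂ ε) W d n w) :
    ∃ c : ℝ, ∀ r ∈ nbhd R₁ R₂ ε, w r = c * v r := by
  have h₁ := h.adm.r₁_pos
  have hC := h.pos
  obtain ⟨r, hr, hvr⟩ := hv0
  obtain ⟨c, hc⟩ := (isFixed_of_isModeSol h.adm h.weight h.speed hv).exists_eq_smul
    (modeKernel_eq h.adm h.weight n) (fun s => h.ne_zero s s.2) (by positivity)
    (h.smallKernel_bound hn) h.adm.real_nbhdMeasure_univ h.small (h.modeVec_bound hn)
    (fun h0 => hvr (congrArg (fun f : C(nbhd R₁ R₂ ε, ℝ) => f ⟨r, hr⟩) h0))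
    (isFixed_of_isModeSol h.adm h.weight h.speed hw)
  exact ⟨c, fun s hs => congrArg (fun f : C(nbhd R₁ R₂ ε, ℝ) => f ⟨s, hs⟩) hc⟩

end SpeedBound

/-- A speed affine in the parameter `t` is automatically continuous in `t` for the sup norm. The
margins `const r₁ C * ε` cover both the small operator and the frozen diagonal. -/
lemma exists_isModeSol {C : ℝ} {W : ℝ → ℝ} {n : ℕ} (hn : 1 ≤ n) {α β : ℝ} (hαβ : α ≤ β)
    {d e : ℝ → ℝ} {p : ℝ}
    (h : ∀ t ∈ Icc α β, SpeedBound r₁ r₂ R₁ R₂ ε C W (fun s => d s + p * t * e s))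
    (hd : ContinuousOn d (nbhd R₁ R₂ ε)) (he : ContinuousOn e (nbhd R₁ R₂ ε))
    (hα : 1 + SpeedBound.const r₁ C * ε ≤ green r₁ r₂ n R₂ R₂
      * ∫ s in Icc (R₂ - ε) (R₂ + ε), W s * (d s + p * α * e s)⁻¹)
    (hβ : green r₁ r₂ n R₂ R₂
      * (∫ s in Icc (R₂ - ε) (R₂ + ε), W s * (d s + p * β * e s)⁻¹)
      ≤ 1 - SpeedBound.const r₁ C * ε) :
    ∃ t ∈ Icc α β, ∃ v : ℝ → ℝ,
      IsModeSol r₁ r₂ (nbhd R₁ R₂ ε) W (fun s => d s + p * t * e s) n v ∧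
      ∃ r ∈ nbhd R₁ R₂ ε, v r ≠ 0 := by
  classical
  have h0 := h α (left_mem_Icc.2 hαβ)
  have hb := h β (right_mem_Icc.2 hαβ)
  have h₁ := h0.adm.r₁_pos
  have hC := h0.pos
  have hp := h0.adm.pos
  set D : ℝ → C(nbhd R₁ R₂ ε, ℝ) := fun t =>
    (⟨_, hd.domRestrict⟩ : C(nbhd R₁ R₂ ε, ℝ)) + (p * t) • ⟨_, he.domRestrict⟩ with hD
  have hDapp : ∀ t s, D t s = d s + p * t * e s := fun t s => rfl
  have a1 := abs_le.1 (h0.abs_integral_outer_sub_le hn)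
  have a2 := abs_le.1 (hb.abs_integral_outer_sub_le hn)
  have c1 := h0.const_eq
  obtain ⟨t, ht, v, hv0, hv⟩ := exists_isFixed (modeKernel_eq h0.adm h0.weight n) hαβ
    (d := D) (by fun_prop) (fun t ht s => (h t ht).ne_zero s s.2)
    (P := C * (1 + 1 / r₁)) (Q := C / ε) (by positivity)
    (fun t ht => (h t ht).smallKernel_bound hn) (by positivity)
    (fun t ht => (h t ht).outerWeight_bound) h0.adm.real_nbhdMeasure_univ h0.small
    (h0.modeVec_bound hn) (by simp only [hDapp]; linarith) (by simp only [hDapp]; linarith)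
  have hext : ∀ s (hs : s ∈ nbhd R₁ R₂ ε),
      (fun r => if hr : r ∈ nbhd R₁ R₂ ε then v ⟨r, hr⟩ else 0) s = v ⟨s, hs⟩ :=
    fun s hs => dif_pos hs
  -- The value 0 off the neighbourhood is arbitrary: a mode solution is only tested and integrated
  -- inside it.
  refine ⟨t, ht, fun r => if hr : r ∈ nbhd R₁ R₂ ε then v ⟨r, hr⟩ else 0, ⟨?_, fun r hr => ?_⟩, ?_⟩
  · rw [continuousOn_iff_continuous_domRestrict]
    refine v.continuous.congr fun s => ?_
    simp
  · rw [← integral_nbhd_eq (fun s => W s * green r₁ r₂ n r s * ((d s + p * t * e s)⁻¹ *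
      (fun r => if hr : r ∈ nbhd R₁ R₂ ε then v ⟨r, hr⟩ else 0) s)), hext r hr, hv ⟨r, hr⟩]
    refine integral_congr_ae (Filter.Eventually.of_forall fun s => ?_)
    simp only [hext s s.2]
    rfl
  · by_contra hcon
    push Not at hcon
    refine hv0 (ContinuousMap.ext fun s => ?_)
    have := hcon s s.2
    rwa [dif_pos s.2] at this

end Transfer

/-! ### The dispersion integral -/

/-- The limiting dispersion integral. -/
noncomputable def dispersion (a : ℝ) (ρ : ℝ → ℝ) (ν : ℝ) : ℝ :=
  ∫ z in (-1 : ℝ)..1, ρ z / (|a| * ν - a * z)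

section Dispersion

variable {a ν z : ℝ}

lemma le_dispersion_denom (hz : |z| ≤ 1) : |a| * (ν - 1) ≤ |a| * ν - a * z := by
  have h1 : a * z ≤ |a| * |z| := by rw [← abs_mul]; exact le_abs_self _
  nlinarith [abs_nonneg a]

lemma dispersion_denom_le (hz : |z| ≤ 1) : |a| * ν - a * z ≤ |a| * (ν + 1) := by
  have h1 : -(|a| * |z|) ≤ a * z := by rw [← abs_mul]; exact neg_abs_le _
  nlinarith [abs_nonneg a]

lemma abs_le_one_of_mem_uIcc (hz : z ∈ uIcc (-1 : ℝ) 1) : |z| ≤ 1 := by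
  rw [uIcc_of_le (by norm_num)] at hz
  exact abs_le.2 hz

lemma dispersion_denom_pos (ha : a ≠ 0) (hν : 1 < ν) (hz : |z| ≤ 1) : 0 < |a| * ν - a * z :=
  (mul_pos (abs_pos.2 ha) (sub_pos.2 hν)).trans_le (le_dispersion_denom hz)

lemma continuousOn_dispersion_integrand (ha : a ≠ 0) {ρ : ℝ → ℝ} (hρ : Continuous ρ)
    (hν : 1 < ν) : ContinuousOn (fun z => ρ z / (|a| * ν - a * z)) (uIcc (-1) 1) :=
  hρ.continuousOn.div (by fun_prop) fun _ hz =>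
    (dispersion_denom_pos ha hν (abs_le_one_of_mem_uIcc hz)).ne'

variable {Θ : ℝ → ℝ} {κ : ℝ}

lemma dispersion_le (hΘ : IsMollifier Θ) (hκ : 0 < κ) (hκ' : κ ≤ 1 / 4) (ha : a ≠ 0)
    (hν : 1 < ν) : dispersion a (dens Θ κ) ν ≤ 1 / (|a| * (ν - 1)) := by
  have hc := hΘ.continuous_dens hκ
  have hp : 0 < |a| * (ν - 1) := mul_pos (abs_pos.2 ha) (sub_pos.2 hν)
  calc dispersion a (dens Θ κ) ν ≤ ∫ z in (-1 : ℝ)..1, dens Θ κ z / (|a| * (ν - 1)) := by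
        refine intervalIntegral.integral_mono_on (by norm_num)
          (continuousOn_dispersion_integrand ha hc hν).intervalIntegrable
          ((hc.div_const _).intervalIntegrable _ _) fun z hz => ?_
        exact div_le_div_of_nonneg_left (hΘ.dens_nonneg hκ hκ' z) hp
          (le_dispersion_denom (abs_le.2 hz))
    _ = _ := by rw [intervalIntegral.integral_div, hΘ.integral_dens hκ hκ']

lemma dispersion_sub (hΘ : IsMollifier Θ) (hκ : 0 < κ) {ν' : ℝ} (ha : a ≠ 0) (hν : 1 < ν)
    (hν' : 1 < ν') : dispersion a (dens Θ κ) ν - dispersion a (dens Θ κ) ν'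
      = ∫ z in (-1 : ℝ)..1, dens Θ κ z
          * (|a| * (ν' - ν) / ((|a| * ν - a * z) * (|a| * ν' - a * z))) := by
  have hc := hΘ.continuous_dens hκ
  unfold dispersion
  rw [← intervalIntegral.integral_sub
    (continuousOn_dispersion_integrand ha hc hν).intervalIntegrable
    (continuousOn_dispersion_integrand ha hc hν').intervalIntegrable]
  refine intervalIntegral.integral_congr fun z hz => ?_
  have h1 := (dispersion_denom_pos ha hν (abs_le_one_of_mem_uIcc hz)).ne'
  have h2 := (dispersion_denom_pos ha hν' (abs_le_one_of_mem_uIcc hz)).ne'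
  field_simp
  ring

lemma intervalIntegrable_dispersion_sub (hΘ : IsMollifier Θ) (hκ : 0 < κ) {ν' : ℝ} (ha : a ≠ 0)
    (hν : 1 < ν) (hν' : 1 < ν') : IntervalIntegrable (fun z => dens Θ κ z
      * (|a| * (ν' - ν) / ((|a| * ν - a * z) * (|a| * ν' - a * z)))) volume (-1) 1 := by
  refine ContinuousOn.intervalIntegrable ((hΘ.continuous_dens hκ).continuousOn.mul
    (ContinuousOn.div (by fun_prop) (by fun_prop) fun z hz => ?_))
  exact (mul_pos (dispersion_denom_pos ha hν (abs_le_one_of_mem_uIcc hz))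
    (dispersion_denom_pos ha hν' (abs_le_one_of_mem_uIcc hz))).ne'

/-- Both denominators are at most `|a|(V + 1)` and the density has mass one. This quantitative
strict decrease, uniform in `κ`, converts an error in the dispersion relation into an error in `ν`.
-/
lemma le_dispersion_sub (hΘ : IsMollifier Θ) (hκ : 0 < κ) (hκ' : κ ≤ 1 / 4) (ha : a ≠ 0)
    {ν' V : ℝ} (hν : 1 < ν) (h : ν ≤ ν') (hV : ν' ≤ V) :
    (ν' - ν) / (|a| * (V + 1) ^ 2)
      ≤ dispersion a (dens Θ κ) ν - dispersion a (dens Θ κ) ν' := by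
  have hc := hΘ.continuous_dens hκ
  have ha' := abs_pos.2 ha
  have hν' := hν.trans_le h
  rw [dispersion_sub hΘ hκ ha hν hν']
  calc (ν' - ν) / (|a| * (V + 1) ^ 2)
      = ∫ z in (-1 : ℝ)..1, dens Θ κ z * ((ν' - ν) / (|a| * (V + 1) ^ 2)) := by
        rw [intervalIntegral.integral_mul_const, hΘ.integral_dens hκ hκ', one_mul]
    _ ≤ _ := by
        refine intervalIntegral.integral_mono_on (by norm_num)
          ((hc.mul_const _).intervalIntegrable _ _)
          (intervalIntegrable_dispersion_sub hΘ hκ ha hν hν') fun z hz => ?_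
        have hz' := abs_le.2 hz
        have h1 := dispersion_denom_pos ha hν hz'
        have h2 := dispersion_denom_pos ha hν' hz'
        have h3 : |a| * ν - a * z ≤ |a| * (V + 1) :=
          (dispersion_denom_le hz').trans (mul_le_mul_of_nonneg_left (by linarith) ha'.le)
        have h4 : |a| * ν' - a * z ≤ |a| * (V + 1) :=
          (dispersion_denom_le hz').trans (mul_le_mul_of_nonneg_left (by linarith) ha'.le)
        refine mul_le_mul_of_nonneg_left ?_ (hΘ.dens_nonneg hκ hκ' z)
        have : (ν' - ν) / (|a| * (V + 1) ^ 2)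
            = |a| * (ν' - ν) / ((|a| * (V + 1)) * (|a| * (V + 1))) := by
          have : V + 1 ≠ 0 := by linarith
          field_simp
        rw [this]
        exact div_le_div_of_nonneg_left (mul_nonneg ha'.le (sub_nonneg.2 h)) (mul_pos h1 h2)
          (mul_le_mul h3 h4 h2.le (h1.le.trans h3))

lemma dispersion_sub_le (hΘ : IsMollifier Θ) (hκ : 0 < κ) (hκ' : κ ≤ 1 / 4) (ha : a ≠ 0)
    {ν' δ : ℝ} (hδ : 0 < δ) (hν : 1 + δ ≤ ν) (h : ν ≤ ν') :
    dispersion a (dens Θ κ) ν - dispersion a (dens Θ κ) ν' ≤ (ν' - ν) / (|a| * δ ^ 2) := by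
  have hc := hΘ.continuous_dens hκ
  have ha' := abs_pos.2 ha
  have hν0 : 1 < ν := by linarith
  have hν' := hν0.trans_le h
  rw [dispersion_sub hΘ hκ ha hν0 hν']
  calc _ ≤ ∫ z in (-1 : ℝ)..1, dens Θ κ z * ((ν' - ν) / (|a| * δ ^ 2)) := by
        refine intervalIntegral.integral_mono_on (by norm_num)
          (intervalIntegrable_dispersion_sub hΘ hκ ha hν0 hν')
          ((hc.mul_const _).intervalIntegrable _ _) fun z hz => ?_
        have hz' := abs_le.2 hz
        have h3 : |a| * δ ≤ |a| * ν - a * z :=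
          le_trans (mul_le_mul_of_nonneg_left (by linarith) ha'.le) (le_dispersion_denom hz')
        have h4 : |a| * δ ≤ |a| * ν' - a * z :=
          le_trans (mul_le_mul_of_nonneg_left (by linarith) ha'.le) (le_dispersion_denom hz')
        refine mul_le_mul_of_nonneg_left ?_ (hΘ.dens_nonneg hκ hκ' z)
        have : (ν' - ν) / (|a| * δ ^ 2) = |a| * (ν' - ν) / ((|a| * δ) * (|a| * δ)) := by
          field_simp
        rw [this]
        have hp : 0 < |a| * δ := by positivity
        exact div_le_div_of_nonneg_left (mul_nonneg ha'.le (sub_nonneg.2 h)) (mul_pos hp hp)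
          (mul_le_mul h3 h4 hp.le (hp.le.trans h3))
    _ = _ := by rw [intervalIntegral.integral_mul_const, hΘ.integral_dens hκ hκ', one_mul]

lemma continuousOn_dispersion (hΘ : IsMollifier Θ) (hκ : 0 < κ) (hκ' : κ ≤ 1 / 4) (ha : a ≠ 0)
    {δ : ℝ} (hδ : 0 < δ) (V : ℝ) : ContinuousOn (dispersion a (dens Θ κ)) (Icc (1 + δ) V) := by
  have hp : 0 ≤ 1 / (|a| * δ ^ 2) := by positivity
  refine (LipschitzOnWith.of_dist_le_mul (K := ⟨1 / (|a| * δ ^ 2), hp⟩)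
    fun x hx y hy => ?_).continuousOn
  rw [Real.dist_eq, Real.dist_eq]
  change _ ≤ 1 / (|a| * δ ^ 2) * |x - y|
  have key : ∀ x ∈ Icc (1 + δ) V, ∀ y ∈ Icc (1 + δ) V, x ≤ y →
      |dispersion a (dens Θ κ) x - dispersion a (dens Θ κ) y| ≤ 1 / (|a| * δ ^ 2) * |x - y| := by
    intro x hx y hy h
    have h1 := le_dispersion_sub hΘ hκ hκ' ha (by linarith [hx.1]) h hy.2
    have h0 : 0 ≤ (y - x) / (|a| * (V + 1) ^ 2) :=
      div_nonneg (sub_nonneg.2 h) (by positivity)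
    rw [abs_of_nonneg (h0.trans h1), abs_sub_comm, abs_of_nonneg (sub_nonneg.2 h)]
    exact (dispersion_sub_le hΘ hκ hκ' ha hδ hx.1 h).trans (le_of_eq (by ring))
  rcases le_total x y with h | h
  · exact key x hx y hy h
  · rw [abs_sub_comm, abs_sub_comm x]
    exact key y hy x hx h

lemma integral_one_div_add {δ : ℝ} (hδ : 0 < δ) (hδ' : δ ≤ 1 / 4) :
    ∫ z in (-(1 - 2 * δ))..(1 - 2 * δ), 1 / (1 + δ + z) = Real.log ((2 - δ) / (3 * δ)) := by
  rw [intervalIntegral.integral_comp_add_left (fun x => 1 / x) (1 + δ),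
    integral_one_div_of_pos (by linarith) (by linarith)]
  congr 2 <;> ring

/-- The integral is restricted to `|z| ≤ 1 - 2δ`, which lies in the plateau as `κ ≤ δ`. There the
density is at least `1/2`, and what remains integrates to a logarithm. -/
lemma le_dispersion (hΘ : IsMollifier Θ) (hκ : 0 < κ) {δ : ℝ} (hδ' : δ ≤ 1 / 4)
    (hκδ : κ ≤ δ) (ha : a ≠ 0) :
    1 / (2 * |a|) * Real.log ((2 - δ) / (3 * δ)) ≤ dispersion a (dens Θ κ) (1 + δ) := by
  have hδ : 0 < δ := hκ.trans_le hκδ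
  have hc := hΘ.continuous_dens hκ
  have ha' := abs_pos.2 ha
  have hκ' := hκδ.trans hδ'
  have hle : -(1 - 2 * δ) ≤ 1 - 2 * δ := by linarith
  have hint := (continuousOn_dispersion_integrand ha hc (ν := 1 + δ)
    (by linarith)).intervalIntegrable (μ := volume)
  calc 1 / (2 * |a|) * Real.log ((2 - δ) / (3 * δ))
      = ∫ z in (-(1 - 2 * δ))..(1 - 2 * δ), 1 / 2 / (|a| * (1 + δ) - a * z) := by
        rw [← integral_one_div_add hδ hδ']
        -- The sign of `a` decides which endpoint is nearly singular; a reflection reduces the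
        -- second case to the same integral.
        rcases lt_or_gt_of_ne ha with h | h
        · rw [← intervalIntegral.integral_const_mul]
          refine intervalIntegral.integral_congr fun z hz => ?_
          rw [uIcc_of_le hle] at hz
          have : 1 + δ + z ≠ 0 := by linarith [hz.1]
          have h2 : |a| * (1 + δ) - a * z = |a| * (1 + δ + z) := by
            rw [abs_of_neg h]; ring
          simp only [h2]
          field_simp
        · have e := intervalIntegral.integral_comp_neg (a := -(1 - 2 * δ)) (b := 1 - 2 * δ)
            (fun z => 1 / (1 + δ + z))
          rw [neg_neg] at e
          rw [← e, ← intervalIntegral.integral_const_mul]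
          refine intervalIntegral.integral_congr fun z hz => ?_
          rw [uIcc_of_le hle] at hz
          have : 1 + δ + -z ≠ 0 := by linarith [hz.2]
          have h2 : |a| * (1 + δ) - a * z = |a| * (1 + δ + -z) := by
            rw [abs_of_pos h]; ring
          simp only [h2]
          field_simp
    _ ≤ ∫ z in (-(1 - 2 * δ))..(1 - 2 * δ), dens Θ κ z / (|a| * (1 + δ) - a * z) := by
        have hsub : uIcc (-(1 - 2 * δ)) (1 - 2 * δ) ⊆ uIcc (-1 : ℝ) 1 := by
          rw [uIcc_of_le hle, uIcc_of_le (by norm_num)]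
          exact Icc_subset_Icc (by linarith) (by linarith)
        refine intervalIntegral.integral_mono_on hle ?_ (hint.mono_set hsub) fun z hz => ?_
        · exact ((continuousOn_dispersion_integrand ha (continuous_const (y := (1 / 2 : ℝ)))
            (by linarith)).mono hsub).intervalIntegrable
        · have hz1 : |z| ≤ 1 - 2 * δ := abs_le.2 hz
          exact div_le_div_of_nonneg_right (hΘ.half_le_dens hκ hκ' (by linarith))
            (dispersion_denom_pos ha (by linarith) (by linarith)).le
    _ ≤ dispersion a (dens Θ κ) (1 + δ) := by
        refine intervalIntegral.integral_mono_interval (by linarith) hle (by linarith) ?_ hint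
        refine (ae_restrict_iff' measurableSet_Ioc).2 (Filter.Eventually.of_forall fun z hz => ?_)
        exact div_nonneg (hΘ.dens_nonneg hκ hκ' z)
          (dispersion_denom_pos ha (by linarith) (abs_le.2 ⟨hz.1.le, hz.2⟩)).le

/-- The dispersion integral is large near the edge, uniformly in small `κ`. -/
lemma exists_le_dispersion (hΘ : IsMollifier Θ) (ha : a ≠ 0) (X : ℝ) :
    ∃ δ > 0, δ ≤ 1 / 4 ∧ ∀ κ, 0 < κ → κ ≤ δ → X ≤ dispersion a (dens Θ κ) (1 + δ) := by
  have ha' := abs_pos.2 ha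
  have hE := Real.exp_pos (-(2 * |a| * |X|))
  have hE1 : Real.exp (-(2 * |a| * |X|)) ≤ 1 := Real.exp_le_one_iff.2 (by
    have : 0 ≤ 2 * |a| * |X| := by positivity
    linarith)
  -- With `E = exp(-2|a||X|) ≤ 1` and `δ = E/4`, the argument of the logarithm is at least `1/E`,
  -- which cancels the prefactor `1/(2|a|)`.
  refine ⟨Real.exp (-(2 * |a| * |X|)) / 4, by positivity, by linarith, fun κ hκ hκδ => ?_⟩
  refine le_trans ?_ (le_dispersion hΘ hκ (by linarith) hκδ ha)
  set E := Real.exp (-(2 * |a| * |X|)) with hEdef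
  have h1 : 2 * |a| * |X| ≤ Real.log ((2 - E / 4) / (3 * (E / 4))) := by
    rw [Real.le_log_iff_exp_le (div_pos (by linarith) (by linarith)), le_div_iff₀ (by linarith)]
    have : Real.exp (2 * |a| * |X|) * E = 1 := by
      rw [hEdef, ← Real.exp_add, add_neg_cancel, Real.exp_zero]
    nlinarith
  calc X ≤ |X| := le_abs_self X
    _ = 1 / (2 * |a|) * (2 * |a| * |X|) := by field_simp
    _ ≤ _ := mul_le_mul_of_nonneg_left h1 (by positivity)

end Dispersion

/-! ### The weight -/

/-- The weight `s ϖ'(s)`. -/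
noncomputable def weight (Θ : ℝ → ℝ) (A R₁ R₂ ε κ s : ℝ) : ℝ :=
  s * deriv (vorticity Θ A R₁ R₂ ε κ) s

section Weight

variable {Θ : ℝ → ℝ} {r₁ r₂ R₁ R₂ ε κ s : ℝ}

lemma contDiff_weight (hΘ : IsMollifier Θ) (hκ : 0 < κ) (hκ' : κ ≤ 1 / 4)
    (hε : Admissible r₁ r₂ R₁ R₂ ε) (A : ℝ) : ContDiff ℝ ∞ (weight Θ A R₁ R₂ ε κ) :=
  contDiff_id.mul (hΘ.contDiff_deriv_vorticity hκ hκ' hε.pos hε.mid)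

lemma weight_outer (hΘ : IsMollifier Θ) (hκ : 0 < κ) (hκ' : κ ≤ 1 / 4)
    (hε : Admissible r₁ r₂ R₁ R₂ ε) (A : ℝ) {z : ℝ} (hz : |z| ≤ 1) :
    weight Θ A R₁ R₂ ε κ (R₂ + ε * z) = -((R₂ + ε * z) * dens Θ κ z) := by
  have hp := hε.pos
  have hm := hε.mid
  have hz' := abs_le.1 hz
  unfold weight
  rw [hΘ.deriv_vorticity hκ hκ' hε.pos hε.mid, hΘ.dens_eq_zero (z := (R₁ - _) / ε) hκ hκ']
  · rw [add_sub_cancel_left, mul_div_cancel_left₀ _ hp.ne']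
    ring
  · refine le_abs'.2 (Or.inl ?_)
    rw [div_le_iff₀ hp]
    nlinarith

lemma abs_weight_le (hΘ : IsMollifier Θ) (hκ : 0 < κ) (hκ' : κ ≤ 1 / 4)
    (hε : Admissible r₁ r₂ R₁ R₂ ε) (A : ℝ) (hs : s ∈ nbhd R₁ R₂ ε) :
    |weight Θ A R₁ R₂ ε κ s| ≤ r₂ := by
  have h1 := hε.nbhd_subset hs
  have hs0 := hε.r₁_pos.trans h1.1
  unfold weight
  rw [hΘ.deriv_vorticity hκ hκ' hε.pos hε.mid, abs_mul, abs_of_pos hs0]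
  have a := hΘ.dens_nonneg hκ hκ' ((R₁ - s) / ε)
  have b := hΘ.dens_nonneg hκ hκ' ((s - R₂) / ε)
  have a' := hΘ.dens_le_one hκ hκ' ((R₁ - s) / ε)
  have b' := hΘ.dens_le_one hκ hκ' ((s - R₂) / ε)
  have c : |dens Θ κ ((R₁ - s) / ε) - dens Θ κ ((s - R₂) / ε)| ≤ 1 := by
    rw [abs_le]; constructor <;> linarith
  nlinarith [abs_nonneg (dens Θ κ ((R₁ - s) / ε) - dens Θ κ ((s - R₂) / ε)), h1.2]

lemma weight_eq_zero (hΘ : IsMollifier Θ) (hκ : 0 < κ) (hκ' : κ ≤ 1 / 4)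
    (hε : Admissible r₁ r₂ R₁ R₂ ε) (A : ℝ) (hs : s ∉ radii R₁ R₂ ε) :
    weight Θ A R₁ R₂ ε κ s = 0 := by
  have hp := hε.pos
  unfold radii at hs
  rw [mem_union, not_or, mem_Ioo, mem_Ioo, not_and_or, not_and_or, not_lt, not_lt, not_lt,
    not_lt] at hs
  unfold weight
  rw [hΘ.deriv_vorticity hκ hκ' hε.pos hε.mid, hΘ.dens_eq_zero hκ hκ', hΘ.dens_eq_zero hκ hκ']
  · ring
  · rw [le_abs', div_le_iff₀ hp, le_div_iff₀ hp]
    rcases hs.2 with h | h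
    · left; linarith
    · right; linarith
  · rw [le_abs', div_le_iff₀ hp, le_div_iff₀ hp]
    rcases hs.1 with h | h
    · right; linarith
    · left; linarith

end Weight

/-! ### Convergence of the outer integral to the dispersion integral -/

section OuterSpeed

variable {Θ : ℝ → ℝ} {r₁ r₂ R₁ R₂ ε κ a ν δ C₀ : ℝ} {d : ℝ → ℝ}

/-- Lower bound for the speed near `R₂`. -/
lemma le_abs_speed_outer (hε : Admissible r₁ r₂ R₁ R₂ ε) (hδ : 0 < δ)
    (hν : 1 + δ ≤ ν) (hC : C₀ / r₁ * ε ≤ |a| * δ / 2)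
    {z : ℝ} (hz : |z| ≤ 1)
    (hd : |d (R₂ + ε * z) - (R₂ + ε * z) * (ε * (a * z + -(|a| * ν)))| ≤ C₀ * ε ^ 2) :
    (R₂ + ε * z) * ε * (|a| * δ / 2) ≤ |d (R₂ + ε * z)| := by
  have hp := hε.pos
  have h₁ := hε.r₁_pos
  have hz' := abs_le.1 hz
  have hl := hε.left
  have hm := hε.mid
  set s := R₂ + ε * z with hs
  have hs1 : r₁ ≤ s := by nlinarith
  have hs0 : 0 < s := h₁.trans_le hs1
  have hD : |a| * δ ≤ |a| * ν - a * z :=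
    le_trans (mul_le_mul_of_nonneg_left (by linarith) (abs_nonneg a)) (le_dispersion_denom hz)
  have e1 : C₀ * ε ^ 2 ≤ s * ε * (|a| * δ / 2) := by
    have : C₀ * ε ^ 2 = r₁ * ε * (C₀ / r₁ * ε) := by field_simp
    rw [this]
    refine mul_le_mul_of_nonneg_left hC (by positivity) |>.trans ?_
    have : 0 ≤ |a| * δ / 2 := by positivity
    gcongr
  have e2 := (abs_le.1 hd).2
  have e3 : s * ε * (|a| * δ) ≤ s * ε * (|a| * ν - a * z) :=
    mul_le_mul_of_nonneg_left hD (by positivity)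
  refine le_trans ?_ (neg_le_abs _)
  linarith

/-- The prefactor `ε` is the Jacobian of `s = R₂ + εz`. Over a common denominator the difference has
the speed error `O(ε²)` above and `d(s)`, of order `ε`, below. The minus signs of weight and speed
cancel. -/
lemma outer_quotient_sub_le (hΘ : IsMollifier Θ) (hκ : 0 < κ) (hκ' : κ ≤ 1 / 4)
    (hε : Admissible r₁ r₂ R₁ R₂ ε) (A : ℝ) (ha : a ≠ 0) (hδ : 0 < δ)
    (hν : 1 + δ ≤ ν) (hC : C₀ / r₁ * ε ≤ |a| * δ / 2) {z : ℝ} (hz : |z| ≤ 1)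
    (hd : |d (R₂ + ε * z) - (R₂ + ε * z) * (ε * (a * z + -(|a| * ν)))| ≤ C₀ * ε ^ 2) :
    |ε * (weight Θ A R₁ R₂ ε κ (R₂ + ε * z) * (d (R₂ + ε * z))⁻¹)
        - dens Θ κ z / (|a| * ν - a * z)| ≤ 2 * C₀ / (r₁ * (|a| * δ) ^ 2) * ε := by
  have hlow := le_abs_speed_outer hε hδ hν hC hz hd
  rw [weight_outer hΘ hκ hκ' hε A hz]
  have ha' := abs_pos.2 ha
  have hp := hε.pos
  have h₁ := hε.r₁_pos
  have hz' := abs_le.1 hz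
  have hl := hε.left
  have hm := hε.mid
  set s := R₂ + ε * z with hs
  have hs1 : r₁ ≤ s := by nlinarith
  have hs0 : 0 < s := h₁.trans_le hs1
  have hD : |a| * δ ≤ |a| * ν - a * z :=
    le_trans (mul_le_mul_of_nonneg_left (by linarith) (abs_nonneg a)) (le_dispersion_denom hz)
  have hc : 0 < |a| * δ := by positivity
  have hC₀ : 0 ≤ C₀ := by
    have := (abs_nonneg _).trans hd
    exact nonneg_of_mul_nonneg_left this (by positivity)
  set D := |a| * ν - a * z with hDdef
  have hD0 : 0 < D := hc.trans_le hD
  have hd0 : d s ≠ 0 := by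
    rw [← abs_pos]
    exact lt_of_lt_of_le (by positivity) hlow
  have e : ε * (-(s * dens Θ κ z) * (d s)⁻¹) - dens Θ κ z / D
      = -(dens Θ κ z * ((d s - s * (ε * (a * z + -(|a| * ν)))) / (d s * D))) := by
    rw [hDdef] at hD0 ⊢
    have := hD0.ne'
    field_simp
    ring
  have hρ := hΘ.dens_nonneg hκ hκ' z
  have hρ1 := hΘ.dens_le_one hκ hκ' z
  rw [e, abs_neg, abs_mul, abs_of_nonneg hρ, abs_div, abs_mul, abs_of_pos hD0]
  refine (mul_le_of_le_one_left (by positivity) hρ1).trans ?_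
  have hden : r₁ * ε * (|a| * δ / 2) * (|a| * δ) ≤ |d s| * D :=
    mul_le_mul (le_trans (by gcongr) hlow) hD hc.le (abs_nonneg _)
  calc _ ≤ C₀ * ε ^ 2 / (r₁ * ε * (|a| * δ / 2) * (|a| * δ)) :=
        div_le_div₀ (by positivity) hd (by positivity) hden
    _ = _ := by field_simp

lemma abs_integral_outer_sub_dispersion_le (hΘ : IsMollifier Θ) (hκ : 0 < κ) (hκ' : κ ≤ 1 / 4)
    (hε : Admissible r₁ r₂ R₁ R₂ ε) (A : ℝ) (ha : a ≠ 0) (hδ : 0 < δ) (hν : 1 + δ ≤ ν)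
    (hC : C₀ / r₁ * ε ≤ |a| * δ / 2) (hdc : ContinuousOn d (nbhd R₁ R₂ ε))
    (hd : ∀ z : ℝ, |z| ≤ 1 →
      |d (R₂ + ε * z) - (R₂ + ε * z) * (ε * (a * z + -(|a| * ν)))| ≤ C₀ * ε ^ 2) :
    |(∫ s in Icc (R₂ - ε) (R₂ + ε), weight Θ A R₁ R₂ ε κ s * (d s)⁻¹)
        - dispersion a (dens Θ κ) ν| ≤ 4 * C₀ / (r₁ * (|a| * δ) ^ 2) * ε := by
  have hp := hε.pos
  have h₁ := hε.r₁_pos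
  have ha' := abs_pos.2 ha
  have hl := hε.left
  have hm := hε.mid
  have hdz : ∀ z : ℝ, |z| ≤ 1 → d (R₂ + ε * z) ≠ 0 := fun z hz => by
    have hz' := abs_le.1 hz
    have : r₁ ≤ R₂ + ε * z := by nlinarith
    have : 0 < R₂ + ε * z := h₁.trans_le this
    rw [← abs_pos]
    exact lt_of_lt_of_le (by positivity) (le_abs_speed_outer hε hδ hν hC hz (hd z hz))
  have e : ∫ s in Icc (R₂ - ε) (R₂ + ε), weight Θ A R₁ R₂ ε κ s * (d s)⁻¹
      = ∫ z in (-1 : ℝ)..1,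
          ε * (weight Θ A R₁ R₂ ε κ (R₂ + ε * z) * (d (R₂ + ε * z))⁻¹) := by
    rw [integral_Icc_eq_integral_Ioc, ← intervalIntegral.integral_of_le (by linarith),
      intervalIntegral.integral_const_mul, ← smul_eq_mul,
      intervalIntegral.smul_integral_comp_add_mul
        (fun s => weight Θ A R₁ R₂ ε κ s * (d s)⁻¹) ε R₂]
    congr 1 <;> ring
  have hmaps : ∀ z ∈ uIcc (-1 : ℝ) 1, R₂ + ε * z ∈ nbhd R₁ R₂ ε := fun z hz => by
    have := abs_le.1 (abs_le_one_of_mem_uIcc hz)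
    exact Or.inr ⟨by nlinarith, by nlinarith⟩
  have i1 : IntervalIntegrable (fun z => ε * (weight Θ A R₁ R₂ ε κ (R₂ + ε * z)
      * (d (R₂ + ε * z))⁻¹)) volume (-1) 1 := by
    refine ContinuousOn.intervalIntegrable (continuousOn_const.mul (ContinuousOn.mul ?_ ?_))
    · exact ((contDiff_weight hΘ hκ hκ' hε A).continuous.comp (by fun_prop)).continuousOn
    · exact (hdc.comp (by fun_prop) hmaps).inv₀
        fun z hz => hdz z (abs_le_one_of_mem_uIcc hz)
  rw [e]
  unfold dispersion
  rw [← intervalIntegral.integral_sub i1 (continuousOn_dispersion_integrand ha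
    (hΘ.continuous_dens hκ) (by linarith)).intervalIntegrable, ← Real.norm_eq_abs]
  refine (intervalIntegral.norm_integral_le_of_norm_le_const
    (C := 2 * C₀ / (r₁ * (|a| * δ) ^ 2) * ε) fun z hz => ?_).trans (le_of_eq ?_)
  · have hz' := abs_le_one_of_mem_uIcc (uIoc_subset_uIcc hz)
    exact outer_quotient_sub_le hΘ hκ hκ' hε A ha hδ hν hC hz' (hd z hz')
  · norm_num
    ring

end OuterSpeed

/-! ### The dispersion relation and the choice of the eigenvalue -/

section Spectral

open Filter Topology

lemma eventually_mul_lt (K : ℝ) {c : ℝ} (hc : 0 < c) : ∀ᶠ ε in 𝓝[>] (0 : ℝ), K * ε < c := by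
  have h : Tendsto (fun ε : ℝ => K * ε) (𝓝[>] 0) (𝓝 (K * 0)) :=
    ((continuous_const.mul continuous_id).tendsto 0).mono_left nhdsWithin_le_nhds
  rw [mul_zero] at h
  exact h.eventually_lt_const hc

lemma eventually_admissible {r₁ r₂ R₁ R₂ : ℝ} (hr₁ : 0 < r₁) (hrR : r₁ < R₁) (hR : R₁ < R₂)
    (hRr : R₂ < r₂) : ∀ᶠ ε in 𝓝[>] (0 : ℝ), Admissible r₁ r₂ R₁ R₂ ε := by
  filter_upwards [self_mem_nhdsWithin, eventually_mul_lt 1 (sub_pos.2 hrR),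
    eventually_mul_lt 2 (sub_pos.2 hR), eventually_mul_lt 1 (sub_pos.2 hRr)] with ε h0 h1 h2 h3
  exact ⟨hr₁, h0, by linarith, h2, by linarith⟩

variable {Θ : ℝ → ℝ} {r₁ r₂ R₁ R₂ : ℝ}

/-- The conclusion of the spectral analysis of the mode `m` at given `ε`, `κ`. -/
def SpectralStatement (Θ : ℝ → ℝ) (r₁ r₂ R₁ R₂ A B ε κ lam : ℝ) (m : ℕ) : Prop :=
  (∀ r ∈ nbhd R₁ R₂ ε, speed Θ r₁ r₂ R₁ R₂ A B ε κ lam r ≠ 0) ∧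
  (∃ v, IsModeSol r₁ r₂ (nbhd R₁ R₂ ε) (weight Θ A R₁ R₂ ε κ)
      (speed Θ r₁ r₂ R₁ R₂ A B ε κ lam) m v ∧ (∃ r ∈ nbhd R₁ R₂ ε, v r ≠ 0) ∧
    ∀ w, IsModeSol r₁ r₂ (nbhd R₁ R₂ ε) (weight Θ A R₁ R₂ ε κ)
      (speed Θ r₁ r₂ R₁ R₂ A B ε κ lam) m w → ∃ c : ℝ, ∀ r ∈ nbhd R₁ R₂ ε, w r = c * v r) ∧
  ∀ n, 1 ≤ n → n ≠ m → ∀ w, IsModeSol r₁ r₂ (nbhd R₁ R₂ ε) (weight Θ A R₁ R₂ ε κ)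
      (speed Θ r₁ r₂ R₁ R₂ A B ε κ lam) n w → ∀ r ∈ nbhd R₁ R₂ ε, w r = 0

lemma speed_lamOf_affine (Θ : ℝ → ℝ) (r₁ r₂ R₁ R₂ A B ε κ q ν : ℝ) :
    speed Θ r₁ r₂ R₁ R₂ A B ε κ (lamOf r₁ r₂ R₁ R₂ A B ε (-(q * ν)))
      = fun s => speed Θ r₁ r₂ R₁ R₂ A B ε κ (lamOf r₁ r₂ R₁ R₂ A B ε 0) s
          + -(ε * q) * ν * s := by
  funext s
  unfold speed lamOf
  ring

/-- Uniform bounds on the speed for all parameters in a compact range away from the critical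
values. -/
lemma exists_speedBound (hΘ : IsMollifier Θ) (A : ℝ) {B : ℝ} (hB : B ≠ 0) (hr₁ : 0 < r₁)
    (hrR : r₁ < R₁) (hR : R₁ < R₂) (hRr : R₂ < r₂) {δ : ℝ} (hδ : 0 < δ) (V : ℝ) :
    ∃ C > 0, ∃ C₁ > 0, ∀ᶠ ε in 𝓝[>] (0 : ℝ), ∀ κ, 0 < κ → κ ≤ 1 / 4 → ∀ ν ∈ Icc (1 + δ) V,
      SpeedBound r₁ r₂ R₁ R₂ ε C (weight Θ A R₁ R₂ ε κ)
        (speed Θ r₁ r₂ R₁ R₂ A B ε κ (lamOf r₁ r₂ R₁ R₂ A B ε (-(|slope B R₂| * ν)))) ∧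
      |(∫ s in Icc (R₂ - ε) (R₂ + ε), weight Θ A R₁ R₂ ε κ s *
          (speed Θ r₁ r₂ R₁ R₂ A B ε κ (lamOf r₁ r₂ R₁ R₂ A B ε (-(|slope B R₂| * ν))) s)⁻¹)
        - dispersion (slope B R₂) (dens Θ κ) ν| ≤ C₁ * ε := by
  have hR₂0 : 0 < R₂ := by linarith
  have h0 : 0 < r₂ := hR₂0.trans hRr
  set a := slope B R₂ with ha
  have ha0 : a ≠ 0 := by
    rw [ha]; unfold slope; positivity
  have ha' := abs_pos.2 ha0
  obtain ⟨C₀, hC₀, hout⟩ := exists_abs_speed_sub_le_outer (R₁ := R₁) hΘ A B hr₁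
    (by linarith : r₁ < r₂) (⟨by linarith, hRr.le⟩ : R₂ ∈ Icc r₁ r₂)
  obtain ⟨c, hc, ε', hε', hin⟩ := exists_le_abs_speed_inner hΘ A hB hr₁ hrR hR hRr (|a| * |V|)
  -- The first summand bounds `W/d` near `R₁`, the second bounds `ε W/d` near `R₂`.
  set C := r₂ / c + 2 / (|a| * δ) with hC
  have hC0 : 0 < C := by positivity
  refine ⟨C, hC0, 4 * C₀ / (r₁ * (|a| * δ) ^ 2), by positivity, ?_⟩
  filter_upwards [eventually_admissible hr₁ hrR hR hRr, eventually_mul_lt 1 hε',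
    eventually_mul_lt (C₀ / r₁) (by positivity : 0 < |a| * δ / 2),
    eventually_mul_lt (C * (1 + 1 / r₁) * 4) (by norm_num : (0 : ℝ) < 1 / 2)]
    with ε hε s1 s2 s3 κ hκ hκ' ν hν
  have hp := hε.pos
  have hdc : ContinuousOn
      (speed Θ r₁ r₂ R₁ R₂ A B ε κ (lamOf r₁ r₂ R₁ R₂ A B ε (-(|a| * ν)))) (nbhd R₁ R₂ ε) :=
    (contDiffOn_speed hΘ hκ hκ' hε A B _).continuousOn.mono
      fun s hs => hr₁.trans (hε.nbhd_subset hs).1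
  have hd := hout κ ε (-(|a| * ν)) hκ hκ' hε
  have hinν := hin κ ε (-(|a| * ν)) hκ hκ' hε (by linarith) (by
    rw [abs_neg, abs_mul, abs_abs]
    refine mul_le_mul_of_nonneg_left (abs_le_abs hν.2 ?_) ha'.le
    linarith [hν.1, hν.2])
  refine ⟨?_, abs_integral_outer_sub_dispersion_le hΘ hκ hκ' hε A ha0 hδ hν.1 s2.le hdc hd⟩
  have houter : ∀ s ∈ Icc (R₂ - ε) (R₂ + ε), ∃ z : ℝ, |z| ≤ 1 ∧ s = R₂ + ε * z := fun s hs => by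
    refine ⟨(s - R₂) / ε, ?_, by field_simp; ring⟩
    rw [abs_le, le_div_iff₀ hp, div_le_iff₀ hp]
    constructor <;> linarith [hs.1, hs.2]
  have hpos : ∀ z : ℝ, |z| ≤ 1 → 0 < R₂ + ε * z := fun z hz => by
    have := abs_le.1 hz
    nlinarith [hε.left, hε.mid]
  have hlow : ∀ z : ℝ, |z| ≤ 1 → _ := fun z hz =>
    le_abs_speed_outer hε hδ hν.1 s2.le hz (hd z hz)
  refine ⟨hε, hC0, by linarith, (contDiff_weight hΘ hκ hκ' hε A).continuous.continuousOn, hdc,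
    ?_, ?_, ?_⟩
  · rintro s (hs | hs)
    · exact abs_pos.1 (hc.trans_le (hinν s hs))
    · obtain ⟨z, hz, rfl⟩ := houter s hs
      have := hpos z hz
      exact abs_pos.1 (lt_of_lt_of_le (by positivity) (hlow z hz))
  · intro s hs
    have h1 := abs_weight_le hΘ hκ hκ' hε A (Or.inl hs)
    have h2 := hinν s hs
    rw [abs_mul, abs_inv, ← div_eq_mul_inv]
    calc _ ≤ r₂ / c := div_le_div₀ h0.le h1 hc h2
      _ ≤ C := by rw [hC]; linarith [show 0 < 2 / (|a| * δ) by positivity]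
  · intro s hs
    obtain ⟨z, hz, rfl⟩ := houter s hs
    have hs0 := hpos z hz
    have hρ := hΘ.dens_nonneg hκ hκ' z
    have hρ1 := hΘ.dens_le_one hκ hκ' z
    rw [abs_mul, abs_inv, ← div_eq_mul_inv, weight_outer hΘ hκ hκ' hε A hz, abs_neg, abs_mul,
      abs_of_pos hs0, abs_of_nonneg hρ]
    calc _ ≤ (R₂ + ε * z) / ((R₂ + ε * z) * ε * (|a| * δ / 2)) :=
          div_le_div₀ hs0.le (mul_le_of_le_one_right hs0.le hρ1) (by positivity) (hlow z hz)
      _ = 2 / (|a| * δ) / ε := by field_simp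
      _ ≤ C / ε := by
        rw [hC]
        gcongr
        linarith [show 0 < r₂ / c by positivity]

/-- The spectral analysis of the mode `m`. -/
theorem exists_spectralStatement (hΘ : IsMollifier Θ) (A : ℝ) {B : ℝ} (hB : B ≠ 0) (hr₁ : 0 < r₁)
    (hrR : r₁ < R₁) (hR : R₁ < R₂) (hRr : R₂ < r₂) {m : ℕ} (hm : 1 ≤ m) :
    ∃ κ₀ > 0, ∃ C > 0, ∃ ε₀ > 0, ∀ κ : ℝ, 0 < κ → κ < κ₀ → ∃ lam₁ : ℝ, |lam₁| ≤ C ∧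
      ∀ ε : ℝ, 0 < ε → ε < ε₀ → κ ≤ 1 / 4 ∧ Admissible r₁ r₂ R₁ R₂ ε ∧ ∃ lam : ℝ,
        |lam - (uTC A B R₂ / R₂ + lam₁ * ε)| ≤ C * ε ^ 2 ∧
        SpectralStatement Θ r₁ r₂ R₁ R₂ A B ε κ lam m := by
  have hR₂0 : 0 < R₂ := by linarith
  set a := slope B R₂ with ha
  have ha0 : a ≠ 0 := by
    rw [ha]; unfold slope; positivity
  have ha' := abs_pos.2 ha0
  set k := green r₁ r₂ m R₂ R₂ with hk
  have hk0 : 0 < k := green_diag_pos hm hr₁ (by linarith) hRr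
  obtain ⟨g, hg, hgap⟩ := exists_le_abs_green_diag_sub hm hr₁ (by linarith : r₁ < R₂) hRr
  -- The ends of the interval for `ν` are such that `k Φ(1 + δ) ≥ 2` and `k Φ(V) ≤ 1/2`, which
  -- leaves room around the value 1. This `δ` also serves as `κ₀`.
  obtain ⟨δ, hδ, hδ', hdisp⟩ := exists_le_dispersion hΘ ha0 (2 / k)
  set V := 2 + 2 * k / |a| with hV
  have hV2 : 2 ≤ V := by
    have : 0 < 2 * k / |a| := by positivity
    linarith
  have h1V : 1 + δ ≤ V := by linarith
  obtain ⟨C, hC, C₁, hC₁, hev⟩ := exists_speedBound hΘ A hB hr₁ hrR hR hRr hδ V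
  set C₃ := SpeedBound.const r₁ C with hC₃
  have hC₃0 : 0 < C₃ := by rw [hC₃]; unfold SpeedBound.const; positivity
  set C₆ := |a| * (V + 1) ^ 2 * ((C₃ + k * C₁) / k) with hC₆
  have hC₆0 : 0 < C₆ := by positivity
  set ψ := stepCorr r₁ r₂ R₁ R₂ R₂ / R₂ ^ 2 with hψ
  -- Chosen before `κ`. The first smallness condition keeps `k J` on the correct sides of 1 at both
  -- ends, including the margin `C₃ ε`; the second, against the gap `g`, rules out the other modes.
  obtain ⟨ε₀, hε₀, hsub⟩ := mem_nhdsGT_iff_exists_Ioo_subset.1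
    (hev.and ((eventually_mul_lt (k * C₁ + C₃) (by norm_num : (0 : ℝ) < 1 / 2)).and
      ((eventually_mul_lt (2 * C₃ * (2 * k)) hg).and
        (eventually_admissible hr₁ hrR hR hRr))))
  refine ⟨δ, hδ, |a| * V + |ψ| + |a| * C₆, by positivity, ε₀, hε₀, fun κ hκ hκδ => ?_⟩
  have hκ' : κ ≤ 1 / 4 := hκδ.le.trans hδ'
  set Φ := dispersion a (dens Θ κ) with hΦ
  have hΦα : 2 ≤ k * Φ (1 + δ) := by
    have := mul_le_mul_of_nonneg_left (hdisp κ hκ hκδ.le) hk0.le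
    rwa [mul_div_cancel₀ _ hk0.ne'] at this
  have hΦV : k * Φ V ≤ 1 / 2 := by
    have h1 := mul_le_mul_of_nonneg_left
      (dispersion_le hΘ hκ hκ' ha0 (by linarith : 1 < V)) hk0.le
    refine h1.trans ?_
    have : |a| * (V - 1) = |a| + 2 * k := by
      rw [hV]; field_simp; ring
    rw [this, mul_one_div, div_le_iff₀ (by positivity)]
    linarith
  obtain ⟨ν₁, hν₁, hΦν₁⟩ : ∃ ν₁ ∈ Icc (1 + δ) V, k * Φ ν₁ = 1 := by
    obtain ⟨ν₁, h1, h2⟩ := intermediate_value_Icc' h1V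
      (continuousOn_const.mul (continuousOn_dispersion hΘ hκ hκ' ha0 hδ V))
      (show (1 : ℝ) ∈ Icc (k * Φ V) (k * Φ (1 + δ)) from ⟨by linarith, by linarith⟩)
    exact ⟨ν₁, h1, h2⟩
  -- This is the coefficient of `ε` in `lamOf` at `μ = -|a|ν₁`.
  refine ⟨-(|a| * ν₁) - ψ, ?_, fun ε hε hεs => ?_⟩
  · have h1 := abs_sub (-(|a| * ν₁)) ψ
    rw [abs_neg, abs_mul, abs_abs, abs_of_pos (by linarith [hν₁.1] : 0 < ν₁)] at h1
    have h2 := mul_le_mul_of_nonneg_left hν₁.2 ha'.le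
    have : 0 < |a| * C₆ := by positivity
    linarith
  obtain ⟨hbd, s1, s2, hadm⟩ := hsub ⟨hε, hεs⟩
  refine ⟨hκ', hadm, ?_⟩
  have hbd := hbd κ hκ hκ'
  set W := weight Θ A R₁ R₂ ε κ with hW
  set d : ℝ → ℝ → ℝ := fun ν =>
    speed Θ r₁ r₂ R₁ R₂ A B ε κ (lamOf r₁ r₂ R₁ R₂ A B ε (-(|a| * ν))) with hd
  set J : ℝ → ℝ := fun ν => ∫ s in Icc (R₂ - ε) (R₂ + ε), W s * (d ν s)⁻¹ with hJ
  have hJΦ : ∀ ν ∈ Icc (1 + δ) V, |k * J ν - k * Φ ν| ≤ k * C₁ * ε := fun ν hν => by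
    rw [← mul_sub, abs_mul, abs_of_pos hk0, mul_assoc]
    exact mul_le_mul_of_nonneg_left (hbd ν hν).2 hk0.le
  have hlin := fun ν => speed_lamOf_affine Θ r₁ r₂ R₁ R₂ A B ε κ |a| ν
  have j1 := (abs_le.1 (hJΦ _ (left_mem_Icc.2 h1V))).1
  have j2 := (abs_le.1 (hJΦ _ (right_mem_Icc.2 h1V))).2
  obtain ⟨ν, hν, v, hv, hv0⟩ : ∃ ν ∈ Icc (1 + δ) V, ∃ v : ℝ → ℝ,
      IsModeSol r₁ r₂ (nbhd R₁ R₂ ε) W (d ν) m v ∧ ∃ r ∈ nbhd R₁ R₂ ε, v r ≠ 0 := by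
    have hd0 : ContinuousOn (speed Θ r₁ r₂ R₁ R₂ A B ε κ (lamOf r₁ r₂ R₁ R₂ A B ε 0))
        (nbhd R₁ R₂ ε) :=
      (contDiffOn_speed hΘ hκ hκ' hadm A B _).continuousOn.mono
        fun s hs => hr₁.trans (hadm.nbhd_subset hs).1
    have key := exists_isModeSol (W := W) (e := fun s => s) (p := -(ε * |a|)) hm h1V
      (fun t ht => by rw [← hlin t]; exact (hbd t ht).1) hd0 continuousOn_id
    simp only [hd, hlin]
    simp only [hJ, hd, hlin] at j1 j2
    exact key (by linarith) (by linarith)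
  have hSB := (hbd ν hν).1
  have hest := hSB.abs_green_mul_sub_one_le hm hv hv0
  refine ⟨lamOf r₁ r₂ R₁ R₂ A B ε (-(|a| * ν)), ?_, hSB.ne_zero,
    ⟨v, hv, hv0, fun w hw => hSB.exists_eq_mul hm hv hv0 hw⟩, fun n hn hnm w hw => ?_⟩
  -- Both values are near 1: `k Φ(ν₁)` exactly, `k Φ(ν)` up to `O(ε)`, because a solution exists at
  -- `ν`. The lower bound on the decrease of `Φ` then localizes `ν`; one more factor `ε` comes from
  -- `lamOf`.
  · have h1 : |k * Φ ν - k * Φ ν₁| ≤ (C₃ + k * C₁) * ε := by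
      have e1 := hJΦ ν hν
      rw [abs_sub_comm] at e1
      rw [hΦν₁]
      refine (abs_sub_le _ (k * J ν) _).trans ((add_le_add e1 hest).trans (le_of_eq ?_))
      ring
    have h2 : |Φ ν - Φ ν₁| ≤ (C₃ + k * C₁) / k * ε := by
      rw [← mul_sub, abs_mul, abs_of_pos hk0] at h1
      rw [div_mul_eq_mul_div, le_div_iff₀ hk0]
      linarith
    have h3 : |ν - ν₁| ≤ C₆ * ε := by
      have key : ∀ x ∈ Icc (1 + δ) V, ∀ y ∈ Icc (1 + δ) V, x ≤ y →
          |x - y| ≤ |a| * (V + 1) ^ 2 * |Φ x - Φ y| := fun x hx y hy hxy => by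
        have h4 := le_dispersion_sub hΘ hκ hκ' ha0 (by linarith [hx.1]) hxy hy.2
        rw [div_le_iff₀ (by positivity)] at h4
        rw [abs_sub_comm, abs_of_nonneg (sub_nonneg.2 hxy)]
        refine h4.trans ?_
        rw [mul_comm]
        exact mul_le_mul_of_nonneg_left (le_abs_self _) (by positivity)
      have h5 : |ν - ν₁| ≤ |a| * (V + 1) ^ 2 * |Φ ν - Φ ν₁| := by
        rcases le_total ν ν₁ with h | h
        · exact key ν hν ν₁ hν₁ h
        · rw [abs_sub_comm, abs_sub_comm (Φ ν)]
          exact key ν₁ hν₁ ν hν h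
      refine h5.trans ?_
      rw [hC₆, mul_assoc (|a| * (V + 1) ^ 2)]
      exact mul_le_mul_of_nonneg_left h2 (by positivity)
    have h6 : lamOf r₁ r₂ R₁ R₂ A B ε (-(|a| * ν))
        - (uTC A B R₂ / R₂ + (-(|a| * ν₁) - ψ) * ε) = -(ε * |a| * (ν - ν₁)) := by
      unfold lamOf
      rw [hψ]
      ring
    rw [h6, abs_neg, abs_mul, abs_mul, abs_of_pos hε, abs_abs]
    have h7 : ε * |a| * |ν - ν₁| ≤ ε * |a| * (C₆ * ε) :=
      mul_le_mul_of_nonneg_left h3 (by positivity)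
    have h8 : 0 ≤ (|a| * V + |ψ|) * ε ^ 2 := by positivity
    nlinarith
  -- A nonzero solution in mode `n` would put `G_n J` and `G_m J` both within `C₃ ε` of 1. But `J`
  -- is bounded below by `1/(2k)` and the diagonal values differ by at least `g`.
  · by_contra hcon
    push Not at hcon
    have hn' := hSB.abs_green_mul_sub_one_le hn hw hcon
    have hgn := hgap n hn hnm
    have hkJ : 1 / 2 ≤ k * |J ν| := by
      have h1 := (abs_le.1 hest).1
      have h2 : k * J ν ≤ k * |J ν| := mul_le_mul_of_nonneg_left (le_abs_self _) hk0.le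
      have h3 : 0 < k * C₁ * ε := by positivity
      have h4 : 1 - C₃ * ε ≤ k * J ν := by linarith
      linarith
    have hdiff : |green r₁ r₂ n R₂ R₂ - k| * |J ν| ≤ 2 * C₃ * ε := by
      rw [← abs_mul, sub_mul]
      rw [abs_sub_comm] at hest
      refine (abs_sub_le _ 1 _).trans ((add_le_add hn' hest).trans (le_of_eq ?_))
      ring
    have h9 : g * |J ν| ≤ 2 * C₃ * ε :=
      (mul_le_mul_of_nonneg_right hgn (abs_nonneg _)).trans hdiff
    have h10 : g * (1 / 2) ≤ 2 * C₃ * ε * k := by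
      calc g * (1 / 2) ≤ g * (k * |J ν|) := mul_le_mul_of_nonneg_left hkJ hg.le
        _ = k * (g * |J ν|) := by ring
        _ ≤ k * (2 * C₃ * ε) := mul_le_mul_of_nonneg_left h9 hk0.le
        _ = _ := by ring
    linarith

end Spectral

/-! ### Cosine series -/

section Fourier

open Real

lemma hasDerivAt_sin_nat_div {n : ℕ} (hn : 1 ≤ n) (θ : ℝ) :
    HasDerivAt (fun θ : ℝ => sin (n * θ) / n) (cos (n * θ)) θ := by
  have hn' : (n : ℝ) ≠ 0 := by positivity
  have := ((hasDerivAt_sin (n * θ)).comp θ ((hasDerivAt_id θ).const_mul (n : ℝ))).div_const (n : ℝ)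
  refine this.congr_deriv ?_
  field_simp

lemma hasDerivAt_neg_cos_nat_div {n : ℕ} (hn : 1 ≤ n) (θ : ℝ) :
    HasDerivAt (fun θ : ℝ => -cos (n * θ) / n) (sin (n * θ)) θ := by
  have hn' : (n : ℝ) ≠ 0 := by positivity
  have := ((hasDerivAt_cos (n * θ)).comp θ ((hasDerivAt_id θ).const_mul (n : ℝ))).neg.div_const
    (n : ℝ)
  refine this.congr_deriv ?_
  field_simp

lemma sin_nat_mul_neg_pi (n : ℕ) : sin (n * -π) = 0 := by
  rw [mul_neg, sin_neg, sin_nat_mul_pi, neg_zero]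

lemma integral_cos_nat_mul {n : ℕ} (hn : 1 ≤ n) : ∫ θ in (-π)..π, cos (n * θ) = 0 := by
  rw [intervalIntegral.integral_eq_sub_of_hasDerivAt
    (fun θ _ => hasDerivAt_sin_nat_div hn θ) (Continuous.intervalIntegrable (by fun_prop) _ _),
    sin_nat_mul_pi, sin_nat_mul_neg_pi]
  simp

lemma integral_cos_mul_cos_of_lt {n k : ℕ} (hk : k < n) :
    ∫ θ in (-π)..π, cos (n * θ) * cos (k * θ) = 0 := by
  have e : ∀ θ ∈ uIcc (-π) π, cos (n * θ) * cos (k * θ)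
      = 1 / 2 * (cos ((n - k : ℕ) * θ) + cos ((n + k : ℕ) * θ)) := fun θ _ => by
    rw [Nat.cast_sub hk.le, Nat.cast_add, sub_mul, add_mul, cos_sub, cos_add]
    ring
  rw [intervalIntegral.integral_congr e, intervalIntegral.integral_const_mul,
    intervalIntegral.integral_add, integral_cos_nat_mul, integral_cos_nat_mul]
  · ring
  · omega
  · omega
  · exact Continuous.intervalIntegrable (by fun_prop) _ _
  · exact Continuous.intervalIntegrable (by fun_prop) _ _

lemma integral_cos_mul_cos_of_ne {n k : ℕ} (hk : n ≠ k) :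
    ∫ θ in (-π)..π, cos (n * θ) * cos (k * θ) = 0 := by
  rcases lt_or_gt_of_ne hk with h | h
  · simp only [mul_comm (cos (n * _))]
    exact integral_cos_mul_cos_of_lt h
  · exact integral_cos_mul_cos_of_lt h

lemma integral_cos_mul_cos_self {n : ℕ} (hn : 1 ≤ n) :
    ∫ θ in (-π)..π, cos (n * θ) * cos (n * θ) = π := by
  have e : ∀ θ ∈ uIcc (-π) π, cos (n * θ) * cos (n * θ)
      = 1 / 2 + 1 / 2 * cos ((2 * n : ℕ) * θ) := fun θ _ => by
    have h : ((2 * n : ℕ) : ℝ) * θ = 2 * (n * θ) := by push_cast; ring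
    rw [h, cos_two_mul]
    ring
  rw [intervalIntegral.integral_congr e, intervalIntegral.integral_add,
    intervalIntegral.integral_const_mul, integral_cos_nat_mul (by omega),
    intervalIntegral.integral_const, smul_eq_mul]
  · ring
  · exact Continuous.intervalIntegrable (by fun_prop) _ _
  · exact Continuous.intervalIntegrable (by fun_prop) _ _

/-- The cosine coefficients of a periodic `C²` function decay quadratically. -/
lemma abs_integral_mul_cos_le {f : ℝ → ℝ} (hf : ContDiff ℝ 2 f)
    (hper : ∀ θ, f (θ + 2 * π) = f θ) {K : ℝ} (hK : ∀ θ, |deriv (deriv f) θ| ≤ K) {n : ℕ}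
    (hn : 1 ≤ n) : |∫ θ in (-π)..π, f θ * cos (n * θ)| ≤ 2 * π * K / n ^ 2 := by
  have hn' : (0 : ℝ) < n := by exact_mod_cast hn
  have hf1 : ContDiff ℝ 1 (deriv f) := by
    have : ContDiff ℝ (1 + 1) f := hf
    exact (contDiff_succ_iff_deriv.1 this).2.2
  have d1 : ∀ θ, HasDerivAt f (deriv f θ) θ := fun θ =>
    (hf.differentiable two_ne_zero θ).hasDerivAt
  have d2 : ∀ θ, HasDerivAt (deriv f) (deriv (deriv f) θ) θ := fun θ =>
    (hf1.differentiable one_ne_zero θ).hasDerivAt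
  have c1 : Continuous (deriv f) := hf1.continuous
  have c2 : Continuous (deriv (deriv f)) := hf1.continuous_deriv le_rfl
  have hper' : deriv f π = deriv f (-π) := by
    have h1 : (fun θ => f (θ + 2 * π)) = f := funext hper
    have h2 := deriv_comp_add_const f (2 * π) (-π)
    rw [h1] at h2
    rw [h2]
    congr 1; ring
  -- Two integrations by parts: the first boundary terms vanish as `sin(nπ) = 0`, the second cancel
  -- by periodicity of `f'`.
  rw [intervalIntegral.integral_mul_deriv_eq_deriv_mul (u := f) (u' := deriv f)
    (v := fun θ => sin (n * θ) / n) (v' := fun θ => cos (n * θ)) (fun θ _ => d1 θ)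
    (fun θ _ => hasDerivAt_sin_nat_div hn θ) (c1.intervalIntegrable _ _)
    (Continuous.intervalIntegrable (by fun_prop) _ _), sin_nat_mul_pi, sin_nat_mul_neg_pi]
  have e : ∀ θ ∈ uIcc (-π) π, deriv f θ * (sin (n * θ) / n)
      = 1 / n * (deriv f θ * sin (n * θ)) := fun θ _ => by ring
  rw [intervalIntegral.integral_congr e, intervalIntegral.integral_const_mul,
    intervalIntegral.integral_mul_deriv_eq_deriv_mul (u := deriv f) (u' := deriv (deriv f))
    (v := fun θ => -cos (n * θ) / n) (v' := fun θ => sin (n * θ)) (fun θ _ => d2 θ)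
    (fun θ _ => hasDerivAt_neg_cos_nat_div hn θ) (c2.intervalIntegrable _ _)
    (Continuous.intervalIntegrable (by fun_prop) _ _), hper', mul_neg (n : ℝ) π, cos_neg]
  have hbound : |∫ θ in (-π)..π, deriv (deriv f) θ * (-cos (n * θ) / n)| ≤ 2 * π * K / n := by
    rw [← Real.norm_eq_abs]
    refine (intervalIntegral.norm_integral_le_of_norm_le_const (C := K / n)
      fun θ _ => ?_).trans (le_of_eq ?_)
    · rw [norm_mul, Real.norm_eq_abs, Real.norm_eq_abs, abs_div, abs_neg, abs_of_pos hn',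
        ← mul_div_assoc]
      refine div_le_div_of_nonneg_right ?_ hn'.le
      have hK0 : 0 ≤ K := (abs_nonneg _).trans (hK θ)
      calc _ ≤ K * 1 := mul_le_mul (hK θ) (abs_cos_le_one _) (abs_nonneg _) hK0
        _ = K := mul_one K
    · rw [sub_neg_eq_add, abs_of_pos (by positivity)]
      ring
  simp only [zero_div, mul_zero, sub_self, zero_sub]
  rw [abs_neg, abs_mul, abs_neg, abs_of_pos (by positivity : (0 : ℝ) < 1 / n)]
  calc _ ≤ 1 / (n : ℝ) * (2 * π * K / n) := mul_le_mul_of_nonneg_left hbound (by positivity)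
    _ = _ := by field_simp

/-- Uniqueness of the coefficients of an absolutely convergent cosine series. -/
lemma eq_zero_of_tsum_cos_eq_zero {a : ℕ → ℝ} (ha : Summable fun n => |a (n + 1)|)
    (h : ∀ θ : ℝ, ∑' n : ℕ, cos ((n + 1 : ℕ) * θ) * a (n + 1) = 0) (k : ℕ) : a (k + 1) = 0 := by
  have hb : ∀ n (θ : ℝ), ‖cos ((n + 1 : ℕ) * θ) * a (n + 1) * cos ((k + 1 : ℕ) * θ)‖
      ≤ |a (n + 1)| := fun n θ => by
    rw [norm_mul, norm_mul, Real.norm_eq_abs, Real.norm_eq_abs, Real.norm_eq_abs]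
    have h1 := abs_cos_le_one ((n + 1 : ℕ) * θ)
    have h2 := abs_cos_le_one ((k + 1 : ℕ) * θ)
    calc _ ≤ 1 * |a (n + 1)| * 1 :=
          mul_le_mul (mul_le_mul_of_nonneg_right h1 (abs_nonneg _)) h2 (abs_nonneg _)
            (by positivity)
      _ = _ := by ring
  have hs := intervalIntegral.hasSum_integral_of_dominated_convergence (a := -π) (b := π)
    (μ := volume) (f := fun _ => (0 : ℝ))
    (F := fun (n : ℕ) θ => cos ((n + 1 : ℕ) * θ) * a (n + 1) * cos ((k + 1 : ℕ) * θ))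
    (fun n _ => |a (n + 1)|) (fun n => Continuous.aestronglyMeasurable (by fun_prop))
    (fun n => Filter.Eventually.of_forall fun θ _ => hb n θ)
    (Filter.Eventually.of_forall fun θ _ => ha)
    (by simp)
    (Filter.Eventually.of_forall fun θ _ => by
      have h1 : Summable fun n : ℕ => cos ((n + 1 : ℕ) * θ) * a (n + 1) := by
        refine Summable.of_norm_bounded ha fun n => ?_
        rw [norm_mul, Real.norm_eq_abs, Real.norm_eq_abs]
        exact mul_le_of_le_one_left (abs_nonneg _) (abs_cos_le_one _)
      have h2 := h1.hasSum.mul_right (cos ((k + 1 : ℕ) * θ))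
      rwa [h θ, zero_mul] at h2)
  have hi : ∀ n : ℕ, ∫ θ in (-π)..π, cos ((n + 1 : ℕ) * θ) * a (n + 1) * cos ((k + 1 : ℕ) * θ)
      = (∫ θ in (-π)..π, cos ((n + 1 : ℕ) * θ) * cos ((k + 1 : ℕ) * θ)) * a (n + 1) := fun n => by
    rw [← intervalIntegral.integral_mul_const]
    exact intervalIntegral.integral_congr fun θ _ => by ring
  simp only [hi] at hs
  have h3 := hs.unique (hasSum_single k fun n hn => by
    rw [integral_cos_mul_cos_of_ne (by omega), zero_mul])
  rw [integral_cos_mul_cos_self (by omega), intervalIntegral.integral_zero] at h3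
  exact (mul_eq_zero.1 h3.symm).resolve_left pi_ne_zero

lemma integral_mul_sin_of_even {f : ℝ → ℝ} (heven : ∀ θ, f (-θ) = f θ) (c : ℝ) :
    ∫ θ in (-π)..π, f θ * sin (c * θ) = 0 := by
  have h := intervalIntegral.integral_comp_neg (a := -π) (b := π) fun θ => f θ * sin (c * θ)
  have e : ∀ θ ∈ uIcc (-π) π, f (-θ) * sin (c * -θ) = -(f θ * sin (c * θ)) := fun θ _ => by
    rw [heven, mul_neg, sin_neg, mul_neg]
  rw [intervalIntegral.integral_congr e, intervalIntegral.integral_neg, neg_neg] at h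
  linarith

/-- A continuous even `2π`-periodic function all of whose cosine coefficients vanish is zero. -/
lemma eq_zero_of_cos_coeff_eq_zero {f : ℝ → ℝ} (hf : Continuous f)
    (hper : ∀ θ, f (θ + 2 * π) = f θ) (heven : ∀ θ, f (-θ) = f θ)
    (h : ∀ n : ℕ, ∫ θ in (-π)..π, f θ * cos (n * θ) = 0) (θ : ℝ) : f θ = 0 := by
  have : Fact (0 < 2 * π) := ⟨two_pi_pos⟩
  have hP : Function.Periodic (fun θ => (f θ : ℂ)) (2 * π) := fun θ => by
    simp only [hper]
  let F : C(AddCircle (2 * π), ℂ) :=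
    ⟨hP.lift, continuous_quot_lift _ (Complex.continuous_ofReal.comp hf)⟩
  have hF : ∀ x : ℝ, F x = (f x : ℂ) := fun x => hP.lift_coe x
  have hint : ∀ n : ℤ, ∫ θ in (-π)..π, f θ * cos (n * θ) = 0 := fun n => by
    obtain ⟨k, rfl | rfl⟩ := n.eq_nat_or_neg
    · exact_mod_cast h k
    · have := h k
      simpa using this
  have hcoef : ∀ n : ℤ, fourierCoeff F n = 0 := fun n => by
    rw [fourierCoeff_eq_intervalIntegral F n (-π)]
    -- Real and imaginary parts are the cosine and sine integrands; the first integral vanishes by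
    -- hypothesis, the second by parity. With all Fourier coefficients zero, the series is summable
    -- and recovers `F` pointwise.
    have e : ∀ x ∈ uIcc (-π) (-π + 2 * π), fourier (-n) (x : AddCircle (2 * π)) • F x
        = ((f x * cos (n * x) : ℝ) : ℂ) - Complex.I * ((f x * sin (n * x) : ℝ) : ℂ) :=
      fun x _ => by
        have h1 : 2 * (π : ℂ) * Complex.I * ((-n : ℤ) : ℂ) * x / ((2 * π : ℝ) : ℂ)
            = ((-(n * x) : ℝ) : ℂ) * Complex.I := by
          have : (π : ℂ) ≠ 0 := by exact_mod_cast pi_ne_zero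
          push_cast
          field_simp
        rw [fourier_coe_apply, hF, h1, Complex.exp_mul_I, ← Complex.ofReal_cos,
          ← Complex.ofReal_sin, cos_neg, sin_neg, smul_eq_mul]
        push_cast
        ring
    have hpi : -π + 2 * π = π := by ring
    rw [intervalIntegral.integral_congr e, hpi, intervalIntegral.integral_sub,
      intervalIntegral.integral_const_mul, intervalIntegral.integral_ofReal,
      intervalIntegral.integral_ofReal, hint, integral_mul_sin_of_even heven]
    · simp
    · exact Continuous.intervalIntegrable (by fun_prop) _ _
    · exact Continuous.intervalIntegrable (by fun_prop) _ _
  have hsum := has_pointwise_sum_fourier_series_of_summable (f := F)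
    (by rw [show fourierCoeff F = fun _ => (0 : ℂ) from funext hcoef]; exact summable_zero) θ
  simp only [hcoef, zero_smul] at hsum
  have := hsum.unique hasSum_zero
  rw [hF] at this
  exact_mod_cast this

end Fourier

/-! ### Angular slices and decay of the cosine coefficients -/

section Slices

variable {R₁ R₂ ε : ℝ}

lemma isOpen_radii : IsOpen (radii R₁ R₂ ε) := isOpen_Ioo.union isOpen_Ioo

lemma isOpen_dom : IsOpen (dom R₁ R₂ ε) := isOpen_radii.prod isOpen_univ

lemma contDiff_slice {h : ℝ × ℝ → ℝ} (hh : ContDiffOn ℝ 2 h (dom R₁ R₂ ε)) {r : ℝ}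
    (hr : r ∈ radii R₁ R₂ ε) : ContDiff ℝ 2 fun θ => h (r, θ) := by
  rw [← contDiffOn_univ]
  exact hh.comp (by fun_prop : ContDiff ℝ 2 fun θ : ℝ => (r, θ)).contDiffOn
    fun θ _ => ⟨hr, mem_univ θ⟩

lemma abs_deriv_deriv_slice_le {h : ℝ × ℝ → ℝ} (hh : ContDiffOn ℝ 2 h (dom R₁ R₂ ε)) {K : ℝ}
    (hK : ∀ p ∈ dom R₁ R₂ ε, ‖iteratedFDeriv ℝ 2 h p‖ ≤ K) {r : ℝ}
    (hr : r ∈ radii R₁ R₂ ε) (θ : ℝ) : |deriv (deriv fun θ => h (r, θ)) θ| ≤ K := by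
  have hline : ∀ θ : ℝ, HasDerivAt (fun θ : ℝ => (r, θ)) ((0 : ℝ), (1 : ℝ)) θ := fun θ =>
    (hasDerivAt_const θ r).prodMk (hasDerivAt_id θ)
  have hmem : ∀ θ : ℝ, (r, θ) ∈ dom R₁ R₂ ε := fun θ => ⟨hr, mem_univ θ⟩
  have hat : ∀ θ : ℝ, ContDiffAt ℝ 2 h (r, θ) := fun θ =>
    hh.contDiffAt (isOpen_dom.mem_nhds (hmem θ))
  have h1 : deriv (fun θ => h (r, θ)) = fun θ => fderiv ℝ h (r, θ) (0, 1) := funext fun θ =>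
    (((hat θ).differentiableAt two_ne_zero).hasFDerivAt.comp_hasDerivAt θ (hline θ)).deriv
  have h2 : DifferentiableAt ℝ (fderiv ℝ h) (r, θ) :=
    ((hat θ).fderiv_right (m := 1) (by norm_num)).differentiableAt one_ne_zero
  have h3 := (h2.hasFDerivAt.comp_hasDerivAt θ (hline θ)).clm_apply
    (hasDerivAt_const θ ((0 : ℝ), (1 : ℝ)))
  rw [h1]
  have h4 : deriv (fun θ => fderiv ℝ h (r, θ) (0, 1)) θ
      = fderiv ℝ (fderiv ℝ h) (r, θ) (0, 1) (0, 1) := by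
    rw [show (fun θ => fderiv ℝ h (r, θ) (0, 1))
      = fun θ => (fderiv ℝ h ∘ fun θ => (r, θ)) θ (0, 1) from rfl, h3.deriv]
    simp
  have hn : ‖((0 : ℝ), (1 : ℝ))‖ = 1 := by simp [Prod.norm_def]
  have h5 : ‖fderiv ℝ (fderiv ℝ h) (r, θ)‖ ≤ K := by
    rw [← norm_iteratedFDeriv_one, norm_iteratedFDeriv_fderiv]
    exact hK _ (hmem θ)
  rw [h4, ← Real.norm_eq_abs]
  have h6 := ContinuousLinearMap.le_opNorm₂ (fderiv ℝ (fderiv ℝ h) (r, θ)) (0, 1) (0, 1)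
  rw [hn, mul_one, mul_one] at h6
  exact h6.trans h5

variable {α : ℝ≥0} {h : ℝ × ℝ → ℝ}

lemma MemX.exists_abs_cosCoeff_le (hh : MemX α R₁ R₂ ε h) :
    ∃ K, 0 ≤ K ∧ ∀ n : ℕ, 1 ≤ n → ∀ r ∈ radii R₁ R₂ ε, |cosCoeff n h r| ≤ K / n ^ 2 := by
  obtain ⟨K, hK⟩ := hh.isC2Holder.bounded
  refine ⟨2 * |K|, by positivity, fun n hn r hr => ?_⟩
  have hn' : (0 : ℝ) < n := by exact_mod_cast hn
  have h1 := abs_integral_mul_cos_le (contDiff_slice hh.isC2Holder.contDiffOn hr)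
    (hh.periodic r hr) (K := |K|) (fun θ => (abs_deriv_deriv_slice_le hh.isC2Holder.contDiffOn
      (hK 2 le_rfl) hr θ).trans (le_abs_self K)) hn
  unfold cosCoeff
  rw [abs_mul, abs_of_pos (by positivity : 0 < 1 / Real.pi)]
  calc _ ≤ 1 / Real.pi * (2 * Real.pi * |K| / n ^ 2) :=
        mul_le_mul_of_nonneg_left h1 (by positivity)
    _ = _ := by field_simp

lemma continuousOn_cosCoeff (hh : ContinuousOn h (dom R₁ R₂ ε)) (n : ℕ) :
    ContinuousOn (cosCoeff n h) (radii R₁ R₂ ε) := by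
  rw [continuousOn_iff_continuous_domRestrict]
  refine continuous_const.mul (intervalIntegral.continuous_parametric_intervalIntegral_of_continuous'
    (f := fun (r : radii R₁ R₂ ε) θ => h (r, θ) * Real.cos (n * θ)) ?_ _ _)
  have h1 : Continuous fun p : radii R₁ R₂ ε × ℝ => h ((p.1 : ℝ), p.2) :=
    hh.comp_continuous (by fun_prop) fun p => ⟨p.1.2, mem_univ _⟩
  exact h1.mul (by fun_prop)

end Slices

/-! ### Smoothing by the Green potential -/

section Potential

variable {r₁ r₂ : ℝ} {f : ℝ → ℝ}

lemma contDiffOn_primitive (hr : r₁ < r₂) (hf : IntervalIntegrable f volume r₁ r₂) {k : ℕ}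
    (hfk : ContDiffOn ℝ k f (Ioo r₁ r₂)) :
    ContDiffOn ℝ (k + 1 : ℕ) (fun r => ∫ s in r₁..r, f s) (Ioo r₁ r₂) := by
  have hd : ∀ r ∈ Ioo r₁ r₂, HasDerivAt (fun r => ∫ s in r₁..r, f s) (f r) r := fun r hr' => by
    refine intervalIntegral.integral_hasDerivAt_right (hf.mono_set ?_)
      (hfk.continuousOn.stronglyMeasurableAtFilter isOpen_Ioo r hr')
      (hfk.continuousOn.continuousAt (isOpen_Ioo.mem_nhds hr'))
    rw [uIcc_of_le hr'.1.le, uIcc_of_le hr.le]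
    exact Icc_subset_Icc_right hr'.2.le
  rw [Nat.cast_add, Nat.cast_one, contDiffOn_succ_iff_deriv_of_isOpen isOpen_Ioo]
  exact ⟨fun r hr' => (hd r hr').differentiableAt.differentiableWithinAt, by simp,
    hfk.congr fun r hr' => (hd r hr').deriv⟩

/-- The two factors multiplying the source in the Green potential. -/
lemma intervalIntegrable_mul_logSinh (h₁ : 0 < r₁) (h₂ : r₁ < r₂) (n : ℕ)
    (hf : IntervalIntegrable f volume r₁ r₂) :
    IntervalIntegrable (fun s => f s * logSinh n (s / r₁)) volume r₁ r₂ ∧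
      IntervalIntegrable (fun s => f s * logSinh n (r₂ / s)) volume r₁ r₂ := by
  have hpos : ∀ s ∈ uIcc r₁ r₂, 0 < s := fun s hs => by
    rw [uIcc_of_le h₂.le] at hs; exact h₁.trans_le hs.1
  refine ⟨hf.mul_continuousOn ?_, hf.mul_continuousOn ?_⟩
  · exact (continuousOn_logSinh n).comp (by fun_prop) fun s hs => div_pos (hpos s hs) h₁
  · exact (continuousOn_logSinh n).comp
      (continuousOn_const.div continuousOn_id fun s hs => (hpos s hs).ne')
      fun s hs => div_pos (h₁.trans h₂) (hpos s hs)

/-- The Green potential through primitives from the left end. -/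
lemma green_potential_eq (h₁ : 0 < r₁) (h₂ : r₁ < r₂) (n : ℕ)
    (hf : IntervalIntegrable f volume r₁ r₂) {r : ℝ} (hr : r ∈ Icc r₁ r₂) :
    ∫ s in r₁..r₂, f s * green r₁ r₂ n r s
      = (logSinh n (r₂ / r) * (∫ s in r₁..r, f s * logSinh n (s / r₁))
        + logSinh n (r / r₁) * ((∫ s in r₁..r₂, f s * logSinh n (r₂ / s))
          - ∫ s in r₁..r, f s * logSinh n (r₂ / s))) / (n * logSinh n (r₂ / r₁)) := by
  have hi := (intervalIntegrable_mul_logSinh h₁ h₂ n hf).2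
  have hsub : uIcc r₁ r ⊆ uIcc r₁ r₂ := by
    rw [uIcc_of_le hr.1, uIcc_of_le h₂.le]; exact Icc_subset_Icc_right hr.2
  rw [intervalIntegral_green h₁ h₂ hr hf,
    intervalIntegral.integral_interval_sub_left hi (hi.mono_set hsub)]

lemma continuousOn_primitive_Icc (h₂ : r₁ ≤ r₂) (hf : IntervalIntegrable f volume r₁ r₂) :
    ContinuousOn (fun r => ∫ s in r₁..r, f s) (Icc r₁ r₂) := by
  have := intervalIntegral.continuousOn_primitive_interval
    (μ := volume) (a := r₁) (b := r₂) (f := f) ?_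
  · rwa [uIcc_of_le h₂] at this
  · rwa [uIcc_of_le h₂, integrableOn_Icc_iff_integrableOn_Ioc,
      ← intervalIntegrable_iff_integrableOn_Ioc_of_le h₂]

lemma contDiffOn_logSinh_div (h₁ : 0 < r₁) (h₂ : r₁ < r₂) (n : ℕ) :
    ContDiffOn ℝ ∞ (fun s => logSinh n (s / r₁)) (Icc r₁ r₂) ∧
      ContDiffOn ℝ ∞ (fun s => logSinh n (r₂ / s)) (Icc r₁ r₂) := by
  have hpos : ∀ s ∈ Icc r₁ r₂, 0 < s := fun s hs => h₁.trans_le hs.1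
  refine ⟨(contDiffOn_logSinh n).comp (contDiffOn_id.div_const _)
    fun s hs => div_pos (hpos s hs) h₁, (contDiffOn_logSinh n).comp
      (contDiffOn_const.div contDiffOn_id fun s hs => (hpos s hs).ne')
      fun s hs => div_pos (h₁.trans h₂) (hpos s hs)⟩

lemma continuousOn_green_potential (h₁ : 0 < r₁) (h₂ : r₁ < r₂) (n : ℕ)
    (hf : IntervalIntegrable f volume r₁ r₂) :
    ContinuousOn (fun r => ∫ s in r₁..r₂, f s * green r₁ r₂ n r s) (Icc r₁ r₂) := by
  obtain ⟨i1, i2⟩ := intervalIntegrable_mul_logSinh h₁ h₂ n hf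
  obtain ⟨c1, c2⟩ := contDiffOn_logSinh_div h₁ h₂ n
  refine ContinuousOn.congr ?_ fun r hr => green_potential_eq h₁ h₂ n hf hr
  exact ((c2.continuousOn.mul (continuousOn_primitive_Icc h₂.le i1)).add
    (c1.continuousOn.mul (continuousOn_const.sub
      (continuousOn_primitive_Icc h₂.le i2)))).div_const _

/-- The kink of the kernel on the diagonal is hidden in primitives with endpoint `r`: the potential
is a combination of such primitives with smooth coefficients, and a primitive gains one derivative.
-/
lemma contDiffOn_green_potential_succ (h₁ : 0 < r₁) (h₂ : r₁ < r₂) (n : ℕ)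
    (hf : IntervalIntegrable f volume r₁ r₂) {k : ℕ} (hfk : ContDiffOn ℝ k f (Ioo r₁ r₂)) :
    ContDiffOn ℝ (k + 1 : ℕ) (fun r => ∫ s in r₁..r₂, f s * green r₁ r₂ n r s)
      (Ioo r₁ r₂) := by
  obtain ⟨i1, i2⟩ := intervalIntegrable_mul_logSinh h₁ h₂ n hf
  obtain ⟨c1, c2⟩ := contDiffOn_logSinh_div h₁ h₂ n
  have c1 := c1.mono Ioo_subset_Icc_self
  have c2 := c2.mono Ioo_subset_Icc_self
  have hle : ∀ k : ℕ, ((k : ℕ) : WithTop ℕ∞) ≤ ∞ := fun k => by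
    exact_mod_cast le_top
  refine ContDiffOn.congr ?_ fun r hr => green_potential_eq h₁ h₂ n hf (Ioo_subset_Icc_self hr)
  exact (((c2.of_le (hle _)).mul (contDiffOn_primitive h₂ i1 (hfk.mul (c1.of_le (hle _))))).add
    ((c1.of_le (hle _)).mul (contDiffOn_const.sub
      (contDiffOn_primitive h₂ i2 (hfk.mul (c2.of_le (hle _))))))).div_const _

/-- Bootstrapping: a Green potential whose source is a smooth multiple of itself is smooth. -/
lemma contDiffOn_of_eq_green_potential (h₁ : 0 < r₁) (h₂ : r₁ < r₂) (n : ℕ) {q v : ℝ → ℝ}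
    (hq : ContDiffOn ℝ ∞ q (Ioo r₁ r₂))
    (hi : IntervalIntegrable (fun s => q s * v s) volume r₁ r₂)
    (hv : ∀ r ∈ Icc r₁ r₂, v r = ∫ s in r₁..r₂, q s * v s * green r₁ r₂ n r s) :
    ContDiffOn ℝ ∞ v (Ioo r₁ r₂) := by
  rw [contDiffOn_infty]
  intro k
  induction k with
  | zero =>
    rw [Nat.cast_zero, contDiffOn_zero]
    exact ((continuousOn_green_potential h₁ h₂ n hi).congr hv).mono Ioo_subset_Icc_self
  | succ k ih =>
    exact (contDiffOn_green_potential_succ h₁ h₂ n hi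
      ((hq.of_le (by exact_mod_cast le_top)).mul ih)).congr
      fun r hr => hv r (Ioo_subset_Icc_self hr)

end Potential

/-! ### Smooth extension of mode solutions -/

section Support

variable {r₁ r₂ R₁ R₂ ε : ℝ} {W d : ℝ → ℝ}

lemma radii_subset_nbhd : radii R₁ R₂ ε ⊆ nbhd R₁ R₂ ε :=
  union_subset_union Ioo_subset_Icc_self Ioo_subset_Icc_self

/-- Integrals of functions supported in the closed neighbourhood. -/
lemma Admissible.integral_nbhd (hε : Admissible r₁ r₂ R₁ R₂ ε) {f : ℝ → ℝ}
    (hf : ∀ s, s ∉ nbhd R₁ R₂ ε → f s = 0) :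
    ∫ s in nbhd R₁ R₂ ε, f s = ∫ s in r₁..r₂, f s := by
  rw [intervalIntegral.integral_of_le hε.r₁_lt_r₂.le]
  refine (setIntegral_eq_of_subset_of_forall_sdiff_eq_zero measurableSet_Ioc ?_
    fun s hs => hf s hs.2).symm
  exact hε.nbhd_subset.trans Ioo_subset_Ioc_self

lemma Admissible.intervalIntegrable_of_nbhd (hε : Admissible r₁ r₂ R₁ R₂ ε) {f : ℝ → ℝ}
    (hf : ∀ s, s ∉ nbhd R₁ R₂ ε → f s = 0) (hi : IntegrableOn f (nbhd R₁ R₂ ε)) :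
    IntervalIntegrable f volume r₁ r₂ := by
  rw [intervalIntegrable_iff_integrableOn_Ioc_of_le hε.r₁_lt_r₂.le]
  exact hi.of_forall_sdiff_eq_zero measurableSet_Ioc fun s hs => hf s hs.2

/-- The quotient of a weight supported in the neighbourhood by a speed without zeros there is
smooth. -/
lemma contDiffOn_weight_div (hε : Admissible r₁ r₂ R₁ R₂ ε) (hW : ContDiff ℝ ∞ W)
    (hW0 : ∀ s, s ∉ radii R₁ R₂ ε → W s = 0) (hd : ContDiffOn ℝ ∞ d (Ioi 0))
    (hd0 : ∀ s ∈ nbhd R₁ R₂ ε, d s ≠ 0) :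
    ContDiffOn ℝ ∞ (fun s => W s * (d s)⁻¹) (Ioo r₁ r₂) := by
  intro x hx
  refine ContDiffAt.contDiffWithinAt ?_
  by_cases hxS : x ∈ nbhd R₁ R₂ ε
  · exact hW.contDiffAt.mul
      ((hd.contDiffAt (Ioi_mem_nhds (hε.r₁_pos.trans hx.1))).inv (hd0 x hxS))
  · have hev : (fun s => W s * (d s)⁻¹) =ᶠ[nhds x] fun _ => 0 := by
      filter_upwards [isCompact_nbhd.isClosed.isOpen_compl.mem_nhds hxS] with s hs
      rw [hW0 s fun h => hs (radii_subset_nbhd h), zero_mul]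
    exact contDiffAt_const.congr_of_eventuallyEq hev

lemma IsModeSol.integrableOn {n : ℕ} {v : ℝ → ℝ} (hW : Continuous W)
    (hd : ContinuousOn d (nbhd R₁ R₂ ε)) (hd0 : ∀ s ∈ nbhd R₁ R₂ ε, d s ≠ 0)
    (hv : IsModeSol r₁ r₂ (nbhd R₁ R₂ ε) W d n v) :
    IntegrableOn (fun s => W s * (d s)⁻¹ * v s) (nbhd R₁ R₂ ε) :=
  ((hW.continuousOn.mul (hd.inv₀ hd0)).mul hv.1).integrableOn_compact isCompact_nbhd

/-- A solution of the mode equation extends to a smooth solution on the annulus. -/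
lemma IsModeSol.exists_smooth (hε : Admissible r₁ r₂ R₁ R₂ ε) (hW : ContDiff ℝ ∞ W)
    (hW0 : ∀ s, s ∉ radii R₁ R₂ ε → W s = 0) (hd : ContDiffOn ℝ ∞ d (Ioi 0))
    (hd0 : ∀ s ∈ nbhd R₁ R₂ ε, d s ≠ 0) {n : ℕ} {v : ℝ → ℝ}
    (hv : IsModeSol r₁ r₂ (nbhd R₁ R₂ ε) W d n v) :
    ∃ w : ℝ → ℝ, (∀ r ∈ nbhd R₁ R₂ ε, w r = v r) ∧ ContDiffOn ℝ ∞ w (Ioo r₁ r₂) := by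
  have hsub := hε.nbhd_subset_Icc
  have hWS : ∀ s, s ∉ nbhd R₁ R₂ ε → W s = 0 := fun s hs =>
    hW0 s fun h => hs (radii_subset_nbhd h)
  have hdc : ContinuousOn d (nbhd R₁ R₂ ε) := hd.continuousOn.mono
    fun s hs => hε.r₁_pos.trans (hε.nbhd_subset hs).1
  -- The right-hand side of the equation makes sense on the whole annulus and serves as the
  -- extension. The weight vanishes where `w` and `v` may differ, so `w` solves the same equation
  -- there.
  set w : ℝ → ℝ := fun r => ∫ s in r₁..r₂, W s * (d s)⁻¹ * v s * green r₁ r₂ n r s with hw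
  have hwv : ∀ r ∈ nbhd R₁ R₂ ε, w r = v r := fun r hr => by
    rw [hv.2 r hr, hε.integral_nbhd fun s hs => by rw [hWS s hs]; ring]
    refine intervalIntegral.integral_congr fun s _ => ?_
    ring
  have hqw : ∀ s, W s * (d s)⁻¹ * w s = W s * (d s)⁻¹ * v s := fun s => by
    by_cases hs : s ∈ nbhd R₁ R₂ ε
    · rw [hwv s hs]
    · rw [hWS s hs]; ring
  refine ⟨w, hwv, contDiffOn_of_eq_green_potential hε.r₁_pos hε.r₁_lt_r₂ n
    (contDiffOn_weight_div hε hW hW0 hd hd0) ?_ fun r _ => ?_⟩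
  · simp only [hqw]
    exact hε.intervalIntegrable_of_nbhd (fun s hs => by rw [hWS s hs]; ring)
      (hv.integrableOn hW.continuous hdc hd0)
  · simp only [hqw]
    rfl

end Support

/-! ### Bounded derivatives and Hölder norms -/

section Regularity

variable {r₁ r₂ R₁ R₂ ε : ℝ} {h : ℝ × ℝ → ℝ}

lemma iteratedFDeriv_periodic (hper : ∀ p : ℝ × ℝ, h (p + (0, 2 * Real.pi)) = h p) (k : ℕ) :
    Function.Periodic (iteratedFDeriv ℝ k h) ((0 : ℝ), 2 * Real.pi) := fun p => by
  rw [← iteratedFDeriv_comp_add_right k ((0 : ℝ), 2 * Real.pi) p, funext hper]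

/-- A function which is periodic in the angle and smooth near the closure of `D_ε` has bounded
derivatives. -/
lemma isCInfty_of_contDiffOn {U : Set ℝ} (hU : IsOpen U) (hS : nbhd R₁ R₂ ε ⊆ U)
    (hh : ContDiffOn ℝ ∞ h (U ×ˢ univ))
    (hper : ∀ p : ℝ × ℝ, h (p + (0, 2 * Real.pi)) = h p) : IsCInfty (dom R₁ R₂ ε) h := by
  have hopen : IsOpen (U ×ˢ (univ : Set ℝ)) := hU.prod isOpen_univ
  refine ⟨hh.mono (prod_mono (radii_subset_nbhd.trans hS) subset_rfl), fun k => ?_⟩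
  have hc : ContinuousOn (iteratedFDeriv ℝ k h) (U ×ˢ univ) := fun p hp =>
    ((hh.contDiffAt (hopen.mem_nhds hp)).continuousAt_iteratedFDeriv
      (by exact_mod_cast le_top)).continuousWithinAt
  obtain ⟨K, hK⟩ := (isCompact_nbhd.prod (isCompact_Icc (a := (0 : ℝ)) (b := 2 * Real.pi)))
    |>.exists_bound_of_continuousOn (hc.mono (prod_mono hS (subset_univ _)))
  refine ⟨K, fun p hp => ?_⟩
  -- Shifting the angle by whole periods brings the point into a compact set, where the continuous
  -- derivative is bounded.
  obtain ⟨n, hn, -⟩ := existsUnique_add_zsmul_mem_Ico Real.two_pi_pos p.2 0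
  have e := (iteratedFDeriv_periodic hper k).zsmul n p
  rw [← e]
  refine hK _ ⟨?_, ?_⟩
  · have : (p + n • ((0 : ℝ), 2 * Real.pi)).1 = p.1 := by simp
    rw [this]
    exact radii_subset_nbhd hp.1
  · have : (p + n • ((0 : ℝ), 2 * Real.pi)).2 = p.2 + n • (2 * Real.pi) := by simp
    rw [this]
    rw [zero_add] at hn
    exact ⟨hn.1, hn.2.le⟩

/-- The domain is not convex: on each strip the mean value inequality applies, while points of
different strips are at distance at least `R₂ - R₁ - 2ε` and boundedness suffices. A bounded
Lipschitz function is Hölder, by comparing the distance with 1. -/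
lemma isC2Holder_of_isCInfty (hε : Admissible r₁ r₂ R₁ R₂ ε) {α : ℝ≥0} (hα₁ : α < 1)
    (hh : IsCInfty (dom R₁ R₂ ε) h) : IsC2Holder α (dom R₁ R₂ ε) h := by
  choose K hK using hh.bounded
  refine ⟨by exact_mod_cast contDiffOn_infty.1 hh.contDiffOn 2, ⟨max (K 0) (max (K 1) (K 2)),
    fun k hk p hp => (hK k p hp).trans ?_⟩, ?_⟩
  · interval_cases k
    · exact le_max_left _ _
    · exact (le_max_left _ _).trans (le_max_right _ _)
    · exact (le_max_right _ _).trans (le_max_right _ _)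
  set F := iteratedFDeriv ℝ 2 h with hF
  set D := R₂ - R₁ - 2 * ε with hD
  have hD0 : 0 < D := by linarith [hε.mid]
  have hK2 : ∀ p ∈ dom R₁ R₂ ε, ‖F p‖ ≤ |K 2| := fun p hp => (hK 2 p hp).trans (le_abs_self _)
  have hdiff : ∀ p ∈ dom R₁ R₂ ε, DifferentiableAt ℝ F p := fun p hp =>
    ((contDiffOn_infty.1 hh.contDiffOn 3).contDiffAt
      (isOpen_dom.mem_nhds hp)).differentiableAt_iteratedFDeriv (Nat.cast_lt.2 (by norm_num))
  have hcomp : ∀ I : Set ℝ, Convex ℝ I → I ⊆ radii R₁ R₂ ε → ∀ p ∈ I ×ˢ (univ : Set ℝ),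
      ∀ q ∈ I ×ˢ (univ : Set ℝ), ‖F p - F q‖ ≤ |K 3| * ‖p - q‖ := fun I hI hIr p hp q hq => by
    refine (hI.prod convex_univ).norm_image_sub_le_of_norm_fderiv_le (𝕜 := ℝ)
      (fun x hx => hdiff x ⟨hIr hx.1, hx.2⟩) (fun x hx => ?_) hq hp
    rw [hF, norm_fderiv_iteratedFDeriv]
    exact (hK 3 x ⟨hIr hx.1, hx.2⟩).trans (le_abs_self _)
  have hfar : ∀ p ∈ dom R₁ R₂ ε, ∀ q ∈ dom R₁ R₂ ε, ‖F p - F q‖ ≤ 2 * |K 2| :=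
    fun p hp q hq => (norm_sub_le _ _).trans (by linarith [hK2 p hp, hK2 q hq])
  have hcross : ∀ p ∈ Ioo (R₁ - ε) (R₁ + ε) ×ˢ (univ : Set ℝ),
      ∀ q ∈ Ioo (R₂ - ε) (R₂ + ε) ×ˢ (univ : Set ℝ), D ≤ ‖p - q‖ := fun p hp q hq => by
    refine le_trans ?_ (norm_fst_le (p - q))
    rw [Prod.fst_sub, Real.norm_eq_abs, abs_sub_comm]
    refine le_trans ?_ (le_abs_self _)
    linarith [hp.1.2, hq.1.1]
  have hfar' : ∀ p ∈ dom R₁ R₂ ε, ∀ q ∈ dom R₁ R₂ ε, D ≤ ‖p - q‖ →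
      ‖F p - F q‖ ≤ (|K 3| + 2 * |K 2| / D) * ‖p - q‖ := fun p hp q hq hpq => by
    have h1 : 2 * |K 2| ≤ 2 * |K 2| / D * ‖p - q‖ := by
      rw [div_mul_eq_mul_div, le_div_iff₀ hD0]
      exact mul_le_mul_of_nonneg_left hpq (by positivity)
    have h2 : 0 ≤ |K 3| * ‖p - q‖ := by positivity
    linarith [hfar p hp q hq]
  have hnear : ∀ I : Set ℝ, Convex ℝ I → I ⊆ radii R₁ R₂ ε → ∀ p ∈ I ×ˢ (univ : Set ℝ),
      ∀ q ∈ I ×ˢ (univ : Set ℝ), ‖F p - F q‖ ≤ (|K 3| + 2 * |K 2| / D) * ‖p - q‖ :=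
    fun I hI hIr p hp q hq => by
      have h1 := hcomp I hI hIr p hp q hq
      have h2 : 0 ≤ 2 * |K 2| / D * ‖p - q‖ := by positivity
      linarith
  have hlip : ∀ p ∈ dom R₁ R₂ ε, ∀ q ∈ dom R₁ R₂ ε,
      ‖F p - F q‖ ≤ (|K 3| + 2 * |K 2| / D) * ‖p - q‖ := fun p hp q hq => by
    rcases hp.1 with hp1 | hp1 <;> rcases hq.1 with hq1 | hq1
    · exact hnear _ (convex_Ioo _ _) subset_union_left p ⟨hp1, trivial⟩ q ⟨hq1, trivial⟩
    · exact hfar' p hp q hq (hcross p ⟨hp1, trivial⟩ q ⟨hq1, trivial⟩)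
    · refine hfar' p hp q hq ?_
      rw [norm_sub_rev]
      exact hcross q ⟨hq1, trivial⟩ p ⟨hp1, trivial⟩
    · exact hnear _ (convex_Ioo _ _) subset_union_right p ⟨hp1, trivial⟩ q ⟨hq1, trivial⟩
  set C : ℝ := |K 3| + 2 * |K 2| / D + 2 * |K 2| with hC
  have hC0 : 0 ≤ C := by positivity
  refine ⟨C.toNNReal, fun p hp q hq => ?_⟩
  have key : dist (F p) (F q) ≤ C * dist p q ^ (α : ℝ) := by
    rw [dist_eq_norm, dist_eq_norm]
    rcases le_total ‖p - q‖ 1 with h1 | h1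
    · have h2 : ‖p - q‖ ≤ ‖p - q‖ ^ (α : ℝ) := by
        rcases (norm_nonneg (p - q)).eq_or_lt with h0 | h0
        · rw [← h0]
          exact Real.rpow_nonneg le_rfl _
        · conv_lhs => rw [← Real.rpow_one ‖p - q‖]
          exact Real.rpow_le_rpow_of_exponent_ge h0 h1 (by exact_mod_cast hα₁.le)
      refine (hlip p hp q hq).trans (mul_le_mul ?_ h2 (norm_nonneg _) hC0)
      rw [hC]
      linarith [abs_nonneg (K 2)]
    · have h2 : 1 ≤ ‖p - q‖ ^ (α : ℝ) := Real.one_le_rpow h1 α.2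
      have h3 : 2 * |K 2| ≤ C := by
        rw [hC]
        have : 0 ≤ |K 3| + 2 * |K 2| / D := by positivity
        linarith
      calc _ ≤ 2 * |K 2| * 1 := by rw [mul_one]; exact hfar p hp q hq
        _ ≤ _ := mul_le_mul h3 h2 zero_le_one hC0
  change _ ≤ ENNReal.ofReal C * _
  rw [edist_dist, edist_dist, ENNReal.ofReal_rpow_of_nonneg dist_nonneg α.coe_nonneg,
    ← ENNReal.ofReal_mul hC0]
  exact ENNReal.ofReal_le_ofReal key

end Regularity

/-! ### Functions with a single angular mode -/

/-- The mode `g(r) cos(mθ)`. -/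
noncomputable def modeFun (g : ℝ → ℝ) (m : ℕ) (p : ℝ × ℝ) : ℝ := g p.1 * Real.cos (m * p.2)

section ModeFun

variable {r₁ r₂ R₁ R₂ ε : ℝ} {g : ℝ → ℝ} {m : ℕ}

lemma modeFun_periodic (g : ℝ → ℝ) (m : ℕ) (r θ : ℝ) :
    modeFun g m (r, θ + 2 * Real.pi) = modeFun g m (r, θ) := by
  unfold modeFun
  simp only [mul_add]
  rw [Real.cos_add_nat_mul_two_pi]

lemma modeFun_periodic_div (g : ℝ → ℝ) (hm : 1 ≤ m) (r θ : ℝ) :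
    modeFun g m (r, θ + 2 * Real.pi / m) = modeFun g m (r, θ) := by
  have : (m : ℝ) ≠ 0 := by positivity
  unfold modeFun
  simp only [mul_add, mul_div_cancel₀ _ this, Real.cos_add_two_pi]

lemma contDiffOn_modeFun {U : Set ℝ} (hg : ContDiffOn ℝ ∞ g U) :
    ContDiffOn ℝ ∞ (modeFun g m) (U ×ˢ univ) := by
  refine ContDiffOn.mul (hg.comp contDiffOn_fst fun p hp => hp.1) ?_
  exact (Real.contDiff_cos.comp (contDiff_const.mul contDiff_snd)).contDiffOn

lemma isCInfty_modeFun {U : Set ℝ} (hU : IsOpen U) (hS : nbhd R₁ R₂ ε ⊆ U)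
    (hg : ContDiffOn ℝ ∞ g U) (m : ℕ) : IsCInfty (dom R₁ R₂ ε) (modeFun g m) :=
  isCInfty_of_contDiffOn hU hS (contDiffOn_modeFun hg) fun p => by
    have := modeFun_periodic g m p.1 p.2
    rw [← this]
    congr 1
    ext <;> simp

lemma memX_modeFun (hε : Admissible r₁ r₂ R₁ R₂ ε) {α : ℝ≥0} (hα₁ : α < 1) {U : Set ℝ}
    (hU : IsOpen U) (hS : nbhd R₁ R₂ ε ⊆ U) (hg : ContDiffOn ℝ ∞ g U) (hm : 1 ≤ m) :
    MemX α R₁ R₂ ε (modeFun g m) where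
  isC2Holder := isC2Holder_of_isCInfty hε hα₁ (isCInfty_modeFun hU hS hg m)
  periodic r _ θ := modeFun_periodic g m r θ
  even r _ θ := by
    unfold modeFun
    simp
  mean_zero r _ := by
    unfold modeFun
    simp only
    rw [intervalIntegral.integral_const_mul, integral_cos_nat_mul hm, mul_zero]

lemma cosCoeff_modeFun_self (hm : 1 ≤ m) (r : ℝ) : cosCoeff m (modeFun g m) r = g r := by
  unfold cosCoeff modeFun
  simp only [mul_assoc]
  rw [intervalIntegral.integral_const_mul, integral_cos_mul_cos_self hm]
  have := Real.pi_ne_zero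
  field_simp

lemma cosCoeff_modeFun_of_ne {n : ℕ} (h : n ≠ m) (r : ℝ) : cosCoeff n (modeFun g m) r = 0 := by
  unfold cosCoeff modeFun
  simp only [mul_assoc]
  rw [intervalIntegral.integral_const_mul, integral_cos_mul_cos_of_ne h.symm, mul_zero, mul_zero]

end ModeFun

/-! ### Equivalence of `ℒ_n g = 0` with the mode equation -/

section ModeEquation

variable {Θ : ℝ → ℝ} {r₁ r₂ R₁ R₂ A B ε κ lam K : ℝ} {n : ℕ} {g : ℝ → ℝ}

lemma integrableOn_weight_mul (hΘ : IsMollifier Θ) (hκ : 0 < κ) (hκ' : κ ≤ 1 / 4)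
    (hε : Admissible r₁ r₂ R₁ R₂ ε) (A : ℝ) (hg : ContinuousOn g (radii R₁ R₂ ε))
    (hK : ∀ r ∈ radii R₁ R₂ ε, |g r| ≤ K) :
    IntegrableOn (fun s => weight Θ A R₁ R₂ ε κ s * g s) (nbhd R₁ R₂ ε) := by
  have h0 : IntegrableOn (fun s => weight Θ A R₁ R₂ ε κ s * g s) (radii R₁ R₂ ε) := by
    have : IsFiniteMeasure (volume.restrict (radii R₁ R₂ ε)) := ⟨by
      rw [Measure.restrict_apply_univ]
      exact (measure_mono radii_subset_nbhd).trans_lt isCompact_nbhd.measure_lt_top⟩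
    refine Integrable.of_bound (((contDiff_weight hΘ hκ hκ' hε A).continuous.continuousOn.mul
      hg).aestronglyMeasurable isOpen_radii.measurableSet) (r₂ * K) ?_
    refine (ae_restrict_iff' isOpen_radii.measurableSet).2
      (Filter.Eventually.of_forall fun s hs => ?_)
    have h1 := abs_weight_le hΘ hκ hκ' hε A (radii_subset_nbhd hs)
    rw [norm_mul, Real.norm_eq_abs, Real.norm_eq_abs]
    exact mul_le_mul h1 (hK s hs) (abs_nonneg _) ((abs_nonneg _).trans h1)
  exact h0.of_forall_sdiff_eq_zero measurableSet_nbhd fun s hs => by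
    rw [weight_eq_zero hΘ hκ hκ' hε A hs.2, zero_mul]

/-- Only the values of `g` on the open intervals are controlled, but the weight vanishes elsewhere,
endpoints included. The integral over the annulus may therefore be taken over the compact
neighbourhood. -/
lemma modeOp_eq_speed (hΘ : IsMollifier Θ) (hκ : 0 < κ) (hκ' : κ ≤ 1 / 4)
    (hε : Admissible r₁ r₂ R₁ R₂ ε) (hn : 1 ≤ n) (hg : ContinuousOn g (radii R₁ R₂ ε))
    (hK : ∀ r ∈ radii R₁ R₂ ε, |g r| ≤ K) {r : ℝ} (hr : r ∈ radii R₁ R₂ ε) :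
    modeOp r₁ r₂ (circulation A B r₁ r₂) (vorticity Θ A R₁ R₂ ε κ) lam n g r
      = speed Θ r₁ r₂ R₁ R₂ A B ε κ lam r * g r
        - ∫ s in nbhd R₁ R₂ ε, weight Θ A R₁ R₂ ε κ s * g s * green r₁ r₂ n r s := by
  have hW0 : ∀ s, s ∉ nbhd R₁ R₂ ε → weight Θ A R₁ R₂ ε κ s = 0 := fun s hs =>
    weight_eq_zero hΘ hκ hκ' hε A fun h => hs (radii_subset_nbhd h)
  rw [modeOp_eq hn hε.r₁_pos hε.r₁_lt_r₂ (hε.nbhd_subset_Icc (radii_subset_nbhd hr))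
    (hε.intervalIntegrable_of_nbhd (fun s hs => ?_)
      (integrableOn_weight_mul hΘ hκ hκ' hε A hg hK)),
    hε.integral_nbhd fun s hs => by rw [hW0 s hs]; ring]
  · rfl
  · have := hW0 s hs
    unfold weight at this
    rw [this, zero_mul]

/-- The constant does not involve `n`, because the Green function is at most `1/2` in every mode;
the `1/n²` decay of the coefficients thus carries over to the series. -/
lemma abs_modeOp_le (hΘ : IsMollifier Θ) (hκ : 0 < κ) (hκ' : κ ≤ 1 / 4)
    (hε : Admissible r₁ r₂ R₁ R₂ ε) (hn : 1 ≤ n) (hg : ContinuousOn g (radii R₁ R₂ ε))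
    (hK : ∀ r ∈ radii R₁ R₂ ε, |g r| ≤ K) {r : ℝ} (hr : r ∈ radii R₁ R₂ ε) :
    |modeOp r₁ r₂ (circulation A B r₁ r₂) (vorticity Θ A R₁ R₂ ε κ) lam n g r|
      ≤ (|speed Θ r₁ r₂ R₁ R₂ A B ε κ lam r| + r₂ / 2 * (4 * ε)) * K := by
  have hp := hε.pos
  have hrS := hε.nbhd_subset_Icc (radii_subset_nbhd hr)
  have hK0 : 0 ≤ K := (abs_nonneg _).trans (hK r hr)
  have h0 : 0 < r₂ := hε.r₁_pos.trans hε.r₁_lt_r₂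
  rw [modeOp_eq_speed hΘ hκ hκ' hε hn hg hK hr]
  have h1 : |∫ s in nbhd R₁ R₂ ε, weight Θ A R₁ R₂ ε κ s * g s * green r₁ r₂ n r s|
      ≤ r₂ / 2 * (4 * ε) * K := by
    rw [← Real.norm_eq_abs]
    refine (norm_setIntegral_le_of_norm_le_const (C := r₂ / 2 * K)
      isCompact_nbhd.measure_lt_top fun s hs => ?_).trans (le_of_eq ?_)
    · have hsS := hε.nbhd_subset_Icc hs
      have a := green_nonneg (n := n) hε.r₁_pos hε.r₁_lt_r₂ hrS hsS
      have b := green_le_half hn hε.r₁_pos hε.r₁_lt_r₂ hrS hsS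
      have c : |weight Θ A R₁ R₂ ε κ s * g s| ≤ r₂ * K := by
        by_cases hsr : s ∈ radii R₁ R₂ ε
        · rw [abs_mul]
          exact mul_le_mul (abs_weight_le hΘ hκ hκ' hε A hs) (hK s hsr) (abs_nonneg _) h0.le
        · rw [weight_eq_zero hΘ hκ hκ' hε A hsr, zero_mul, abs_zero]
          positivity
      rw [norm_mul, Real.norm_eq_abs, Real.norm_of_nonneg a]
      calc _ ≤ r₂ * K * (1 / 2) := mul_le_mul c b a (by positivity)
        _ = _ := by ring
    · rw [Measure.real, hε.volume_nbhd, ENNReal.toReal_ofReal (by positivity)]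
      ring
  refine (abs_sub _ _).trans ?_
  rw [abs_mul, add_mul]
  exact add_le_add (mul_le_mul_of_nonneg_left (hK r hr) (abs_nonneg _)) h1

/-- A function annihilated by `ℒ_n` comes from a solution of the mode equation. -/
lemma exists_isModeSol_of_modeOp_eq_zero (hΘ : IsMollifier Θ) (hκ : 0 < κ) (hκ' : κ ≤ 1 / 4)
    (hε : Admissible r₁ r₂ R₁ R₂ ε) (hn : 1 ≤ n) (hg : ContinuousOn g (radii R₁ R₂ ε))
    (hK : ∀ r ∈ radii R₁ R₂ ε, |g r| ≤ K)
    (hd : ∀ r ∈ nbhd R₁ R₂ ε, speed Θ r₁ r₂ R₁ R₂ A B ε κ lam r ≠ 0)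
    (h : ∀ r ∈ radii R₁ R₂ ε,
      modeOp r₁ r₂ (circulation A B r₁ r₂) (vorticity Θ A R₁ R₂ ε κ) lam n g r = 0) :
    ∃ w, IsModeSol r₁ r₂ (nbhd R₁ R₂ ε) (weight Θ A R₁ R₂ ε κ)
        (speed Θ r₁ r₂ R₁ R₂ A B ε κ lam) n w ∧
      ∀ r ∈ radii R₁ R₂ ε, g r = w r / speed Θ r₁ r₂ R₁ R₂ A B ε κ lam r := by
  have hW0 : ∀ s, s ∉ radii R₁ R₂ ε → weight Θ A R₁ R₂ ε κ s = 0 := fun s hs =>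
    weight_eq_zero hΘ hκ hκ' hε A hs
  have hWS : ∀ s, s ∉ nbhd R₁ R₂ ε → weight Θ A R₁ R₂ ε κ s = 0 := fun s hs =>
    hW0 s fun h => hs (radii_subset_nbhd h)
  set w : ℝ → ℝ := fun r => ∫ s in nbhd R₁ R₂ ε,
    weight Θ A R₁ R₂ ε κ s * g s * green r₁ r₂ n r s with hw
  have hgw : ∀ r ∈ radii R₁ R₂ ε, g r = w r / speed Θ r₁ r₂ R₁ R₂ A B ε κ lam r :=
    fun r hr => by
      have h1 := h r hr
      rw [modeOp_eq_speed hΘ hκ hκ' hε hn hg hK hr, sub_eq_zero] at h1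
      rw [eq_div_iff (hd r (radii_subset_nbhd hr)), mul_comm]
      exact h1
  refine ⟨w, ⟨?_, fun r _ => ?_⟩, hgw⟩
  · refine ((continuousOn_green_potential hε.r₁_pos hε.r₁_lt_r₂ n
      (hε.intervalIntegrable_of_nbhd (fun s hs => by rw [hWS s hs, zero_mul])
        (integrableOn_weight_mul hΘ hκ hκ' hε A hg hK))).mono hε.nbhd_subset_Icc).congr
      fun r _ => ?_
    exact hε.integral_nbhd fun s hs => by rw [hWS s hs]; ring
  · refine setIntegral_congr_fun measurableSet_nbhd fun s _ => ?_
    by_cases hs : s ∈ radii R₁ R₂ ε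
    · rw [hgw s hs]
      ring
    · simp only [hW0 s hs, zero_mul]

lemma modeOp_of_isModeSol (hΘ : IsMollifier Θ) (hκ : 0 < κ) (hκ' : κ ≤ 1 / 4)
    (hε : Admissible r₁ r₂ R₁ R₂ ε) (hn : 1 ≤ n) (hg : ContinuousOn g (radii R₁ R₂ ε))
    (hK : ∀ r ∈ radii R₁ R₂ ε, |g r| ≤ K)
    (hd : ∀ r ∈ nbhd R₁ R₂ ε, speed Θ r₁ r₂ R₁ R₂ A B ε κ lam r ≠ 0) {v : ℝ → ℝ}
    (hv : IsModeSol r₁ r₂ (nbhd R₁ R₂ ε) (weight Θ A R₁ R₂ ε κ)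
        (speed Θ r₁ r₂ R₁ R₂ A B ε κ lam) n v) {c : ℝ}
    (hgv : ∀ r ∈ radii R₁ R₂ ε, g r = c * (v r / speed Θ r₁ r₂ R₁ R₂ A B ε κ lam r))
    {r : ℝ} (hr : r ∈ radii R₁ R₂ ε) :
    modeOp r₁ r₂ (circulation A B r₁ r₂) (vorticity Θ A R₁ R₂ ε κ) lam n g r = 0 := by
  have h1 : ∫ s in nbhd R₁ R₂ ε, weight Θ A R₁ R₂ ε κ s * g s * green r₁ r₂ n r s
      = c * v r := by
    rw [hv.2 r (radii_subset_nbhd hr), ← integral_const_mul]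
    refine setIntegral_congr_fun measurableSet_nbhd fun s _ => ?_
    by_cases hs : s ∈ radii R₁ R₂ ε
    · simp only [hgv s hs]
      ring
    · simp only [weight_eq_zero hΘ hκ hκ' hε A hs, zero_mul, mul_zero]
  have h2 := hd r (radii_subset_nbhd hr)
  rw [modeOp_eq_speed hΘ hκ hκ' hε hn hg hK hr, h1, hgv r hr]
  field_simp
  ring

lemma modeOp_of_eq_zero (hΘ : IsMollifier Θ) (hκ : 0 < κ) (hκ' : κ ≤ 1 / 4)
    (hε : Admissible r₁ r₂ R₁ R₂ ε) (hn : 1 ≤ n) (hg : ∀ r ∈ radii R₁ R₂ ε, g r = 0)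
    {r : ℝ} (hr : r ∈ radii R₁ R₂ ε) :
    modeOp r₁ r₂ (circulation A B r₁ r₂) (vorticity Θ A R₁ R₂ ε κ) lam n g r = 0 := by
  have h := abs_modeOp_le (A := A) (B := B) (lam := lam) (K := 0) hΘ hκ hκ' hε hn
    (continuousOn_const.congr hg) (fun r hr => by rw [hg r hr, abs_zero]) hr
  rw [mul_zero] at h
  exact abs_nonpos_iff.1 h

end ModeEquation

/-! ### The kernel of the linearized operator -/

section LinearizedOperator

variable {Θ : ℝ → ℝ} {r₁ r₂ R₁ R₂ A B ε κ lam : ℝ} {α : ℝ≥0} {g : ℝ × ℝ → ℝ}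

lemma MemX.continuousOn (hg : MemX α R₁ R₂ ε g) : ContinuousOn g (dom R₁ R₂ ε) :=
  hg.isC2Holder.contDiffOn.continuousOn

lemma MemX.exists_abs_cosCoeff_le_const (hg : MemX α R₁ R₂ ε g) {n : ℕ} (hn : 1 ≤ n) :
    ∃ K, ∀ r ∈ radii R₁ R₂ ε, |cosCoeff n g r| ≤ K := by
  obtain ⟨K, -, hK⟩ := hg.exists_abs_cosCoeff_le
  exact ⟨_, hK n hn⟩

/-- The modes of an element of `X(D_ε)` are absolutely summable after applying `ℒ_n`. -/
lemma summable_abs_modeOp (hΘ : IsMollifier Θ) (hκ : 0 < κ) (hκ' : κ ≤ 1 / 4)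
    (hε : Admissible r₁ r₂ R₁ R₂ ε) (hg : MemX α R₁ R₂ ε g) (A B lam : ℝ) {r : ℝ}
    (hr : r ∈ radii R₁ R₂ ε) :
    Summable fun n : ℕ => |modeOp r₁ r₂ (circulation A B r₁ r₂) (vorticity Θ A R₁ R₂ ε κ) lam
      (n + 1) (cosCoeff (n + 1) g) r| := by
  obtain ⟨K, -, hK⟩ := hg.exists_abs_cosCoeff_le
  have hs : Summable fun n : ℕ => 1 / ((n + 1 : ℕ) : ℝ) ^ 2 :=
    (summable_nat_add_iff 1).2 (Real.summable_one_div_nat_pow.2 one_lt_two)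
  refine Summable.of_nonneg_of_le (fun n => abs_nonneg _) (fun n => ?_)
    (hs.mul_left ((|speed Θ r₁ r₂ R₁ R₂ A B ε κ lam r| + r₂ / 2 * (4 * ε)) * K))
  refine (abs_modeOp_le hΘ hκ hκ' hε (by omega) (continuousOn_cosCoeff hg.continuousOn (n + 1))
    (hK (n + 1) (by omega)) hr).trans (le_of_eq ?_)
  ring

lemma summable_linTerm (hΘ : IsMollifier Θ) (hκ : 0 < κ) (hκ' : κ ≤ 1 / 4)
    (hε : Admissible r₁ r₂ R₁ R₂ ε) (hg : MemX α R₁ R₂ ε g) (A B lam : ℝ) {p : ℝ × ℝ}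
    (hp : p ∈ dom R₁ R₂ ε) :
    Summable fun n : ℕ => linTerm r₁ r₂ (circulation A B r₁ r₂) (vorticity Θ A R₁ R₂ ε κ) lam g p
      (n + 1) := by
  refine Summable.of_norm_bounded (summable_abs_modeOp hΘ hκ hκ' hε hg A B lam hp.1) fun n => ?_
  unfold linTerm
  rw [norm_mul, Real.norm_eq_abs, Real.norm_eq_abs]
  exact mul_le_of_le_one_left (abs_nonneg _) (Real.abs_cos_le_one _)

lemma modeOp_eq_zero_of_linOp_eq_zero (hΘ : IsMollifier Θ) (hκ : 0 < κ) (hκ' : κ ≤ 1 / 4)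
    (hε : Admissible r₁ r₂ R₁ R₂ ε) (hg : MemX α R₁ R₂ ε g)
    (h : ∀ p ∈ dom R₁ R₂ ε,
      linOp r₁ r₂ (circulation A B r₁ r₂) (vorticity Θ A R₁ R₂ ε κ) lam g p = 0) {n : ℕ}
    (hn : 1 ≤ n) {r : ℝ} (hr : r ∈ radii R₁ R₂ ε) :
    modeOp r₁ r₂ (circulation A B r₁ r₂) (vorticity Θ A R₁ R₂ ε κ) lam n (cosCoeff n g) r = 0 := by
  obtain ⟨k, rfl⟩ := Nat.exists_eq_add_of_le' hn
  exact eq_zero_of_tsum_cos_eq_zero (a := fun n => modeOp r₁ r₂ (circulation A B r₁ r₂)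
    (vorticity Θ A R₁ R₂ ε κ) lam n (cosCoeff n g) r)
    (summable_abs_modeOp hΘ hκ hκ' hε hg A B lam hr) (fun θ => h (r, θ) ⟨hr, mem_univ θ⟩) k

/-- An element of `X(D_ε)` is determined by its cosine coefficients. -/
lemma MemX.eq_mul_of_cosCoeff_eq {h : ℝ × ℝ → ℝ} (hg : MemX α R₁ R₂ ε g)
    (hh : MemX α R₁ R₂ ε h) {c : ℝ}
    (hc : ∀ n : ℕ, 1 ≤ n → ∀ r ∈ radii R₁ R₂ ε, cosCoeff n g r = c * cosCoeff n h r)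
    {p : ℝ × ℝ} (hp : p ∈ dom R₁ R₂ ε) : g p = c * h p := by
  obtain ⟨r, θ⟩ := p
  have hr : r ∈ radii R₁ R₂ ε := hp.1
  have cg := (contDiff_slice hg.isC2Holder.contDiffOn hr).continuous
  have ch := (contDiff_slice hh.isC2Holder.contDiffOn hr).continuous
  have := eq_zero_of_cos_coeff_eq_zero (f := fun θ => g (r, θ) - c * h (r, θ))
    (cg.sub (continuous_const.mul ch))
    (fun θ => by simp only [hg.periodic r hr, hh.periodic r hr])
    (fun θ => by simp only [hg.even r hr, hh.even r hr]) (fun n => ?_) θ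
  · exact sub_eq_zero.1 this
  have e : ∀ θ ∈ uIcc (-Real.pi) Real.pi, (g (r, θ) - c * h (r, θ)) * Real.cos (n * θ)
      = g (r, θ) * Real.cos (n * θ) - c * (h (r, θ) * Real.cos (n * θ)) := fun θ _ => by ring
  have ig : IntervalIntegrable (fun θ => g (r, θ) * Real.cos (n * θ)) volume
      (-Real.pi) Real.pi := (cg.mul (by fun_prop)).intervalIntegrable _ _
  have ih : IntervalIntegrable (fun θ => c * (h (r, θ) * Real.cos (n * θ))) volume
      (-Real.pi) Real.pi :=
    (continuous_const.mul (ch.mul (by fun_prop))).intervalIntegrable _ _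
  rw [intervalIntegral.integral_congr e, intervalIntegral.integral_sub ig ih,
    intervalIntegral.integral_const_mul]
  rcases Nat.eq_zero_or_pos n with rfl | hn
  · simp [hg.mean_zero r hr, hh.mean_zero r hr]
  · have h1 := hc n hn r hr
    unfold cosCoeff at h1
    have h2 : (1 / Real.pi) ≠ 0 := one_div_ne_zero Real.pi_ne_zero
    rw [mul_left_comm] at h1
    exact sub_eq_zero.2 (mul_left_cancel₀ h2 h1)

lemma cosCoeff_eq_mul {h : ℝ × ℝ → ℝ} {c r : ℝ} (hgh : ∀ θ, g (r, θ) = c * h (r, θ)) (n : ℕ) :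
    cosCoeff n g r = c * cosCoeff n h r := by
  unfold cosCoeff
  simp only [hgh, mul_assoc]
  rw [intervalIntegral.integral_const_mul]
  ring

/-- From the spectral analysis of the modes to the kernel of the linearized operator. -/
theorem SpectralStatement.exists_kernel (hΘ : IsMollifier Θ) (hκ : 0 < κ) (hκ' : κ ≤ 1 / 4)
    (hε : Admissible r₁ r₂ R₁ R₂ ε) (hα₁ : α < 1) {m : ℕ} (hm : 1 ≤ m)
    (hs : SpectralStatement Θ r₁ r₂ R₁ R₂ A B ε κ lam m) :
    ∃ h : ℝ × ℝ → ℝ, MemX α R₁ R₂ ε h ∧ IsCInfty (dom R₁ R₂ ε) h ∧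
      (∀ r ∈ radii R₁ R₂ ε, ∀ θ : ℝ, h (r, θ + 2 * Real.pi / m) = h (r, θ)) ∧
      (∃ p ∈ dom R₁ R₂ ε, h p ≠ 0) ∧
      (∃ r ∈ radii R₁ R₂ ε, ∃ θ₁ θ₂ : ℝ, h (r, θ₁) ≠ h (r, θ₂)) ∧
      (∀ g : ℝ × ℝ → ℝ, MemX α R₁ R₂ ε g → ∀ p ∈ dom R₁ R₂ ε,
        Summable fun n : ℕ => linTerm r₁ r₂ (circulation A B r₁ r₂)
          (vorticity Θ A R₁ R₂ ε κ) lam g p (n + 1)) ∧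
      (∀ g : ℝ × ℝ → ℝ, MemX α R₁ R₂ ε g →
        ((∀ p ∈ dom R₁ R₂ ε, linOp r₁ r₂ (circulation A B r₁ r₂)
            (vorticity Θ A R₁ R₂ ε κ) lam g p = 0) ↔
          ∃ c : ℝ, ∀ p ∈ dom R₁ R₂ ε, g p = c * h p)) := by
  obtain ⟨hd0, ⟨v, hv, ⟨ρ, hρ, hvρ⟩, huniq⟩, hother⟩ := hs
  have hW := contDiff_weight hΘ hκ hκ' hε A
  have hW0 : ∀ s, s ∉ radii R₁ R₂ ε → weight Θ A R₁ R₂ ε κ s = 0 := fun s hs =>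
    weight_eq_zero hΘ hκ hκ' hε A hs
  have hd := contDiffOn_speed hΘ hκ hκ' hε A B lam
  set d := speed Θ r₁ r₂ R₁ R₂ A B ε κ lam with hdef
  obtain ⟨w, hwv, hws⟩ := hv.exists_smooth hε hW hW0 hd hd0
  -- An open set containing the closed intervals on which `w/d` is smooth: smoothness past the
  -- endpoints gives bounded derivatives up to them.
  set U := Ioo r₁ r₂ ∩ d ⁻¹' {0}ᶜ with hU
  have hdI : ContDiffOn ℝ ∞ d (Ioo r₁ r₂) := hd.mono fun x hx => hε.r₁_pos.trans hx.1
  have hUo : IsOpen U := hdI.continuousOn.isOpen_inter_preimage isOpen_Ioo isOpen_compl_singleton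
  have hSU : nbhd R₁ R₂ ε ⊆ U := fun r hr => ⟨hε.nbhd_subset hr, hd0 r hr⟩
  have hgs : ContDiffOn ℝ ∞ (fun r => w r / d r) U :=
    (hws.mono inter_subset_left).div (hdI.mono inter_subset_left) fun r hr => hr.2
  set h := modeFun (fun r => w r / d r) m with hh
  have hX : MemX α R₁ R₂ ε h := memX_modeFun hε hα₁ hUo hSU hgs hm
  -- The point where `v` is nonzero might be an endpoint. But if `w/d` vanished on the open
  -- intervals, the integral equation would make `v` vanish on the closed ones too.
  have hne : ∃ r ∈ radii R₁ R₂ ε, w r / d r ≠ 0 := by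
    by_contra hcon
    push Not at hcon
    refine hvρ ?_
    rw [hv.2 ρ hρ]
    refine setIntegral_eq_zero_of_forall_eq_zero fun s hsS => ?_
    by_cases hsr : s ∈ radii R₁ R₂ ε
    · have h1 := hcon s hsr
      rw [hwv s hsS, div_eq_mul_inv, mul_comm] at h1
      rw [h1, mul_zero]
    · rw [hW0 s hsr, zero_mul, zero_mul]
  obtain ⟨r, hr, hwr⟩ := hne
  have hm0 : (m : ℝ) ≠ 0 := by positivity
  have hval0 : h (r, 0) = w r / d r := by
    rw [hh]; unfold modeFun; simp
  have hvalpi : h (r, Real.pi / m) = -(w r / d r) := by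
    rw [hh]; unfold modeFun; simp [mul_div_cancel₀ _ hm0]
  refine ⟨h, hX, isCInfty_modeFun hUo hSU hgs m,
    fun r _ θ => modeFun_periodic_div _ hm r θ, ⟨(r, 0), ⟨hr, mem_univ _⟩, by rwa [hval0]⟩,
    ⟨r, hr, 0, Real.pi / m, ?_⟩, fun g hg p hp => summable_linTerm hΘ hκ hκ' hε hg A B lam hp,
    fun g hg => ⟨fun hL => ?_, ?_⟩⟩
  · rw [hval0, hvalpi]
    intro heq
    exact hwr (by linarith)
  -- Each coefficient is a mode solution divided by the speed: for `n = m` a multiple of the known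
  -- one, for `n ≠ m` zero. The mean-zero condition supplies the missing mode 0.
  · have hsol : ∀ n : ℕ, 1 ≤ n → ∃ w', IsModeSol r₁ r₂ (nbhd R₁ R₂ ε)
        (weight Θ A R₁ R₂ ε κ) d n w' ∧ ∀ r ∈ radii R₁ R₂ ε, cosCoeff n g r = w' r / d r :=
      fun n hn => by
        obtain ⟨K, hK⟩ := hg.exists_abs_cosCoeff_le_const hn
        exact exists_isModeSol_of_modeOp_eq_zero hΘ hκ hκ' hε hn
          (continuousOn_cosCoeff hg.continuousOn n) hK hd0
          fun r hr => modeOp_eq_zero_of_linOp_eq_zero hΘ hκ hκ' hε hg hL hn hr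
    obtain ⟨w₀, hw₀, hgw₀⟩ := hsol m hm
    obtain ⟨c, hc⟩ := huniq w₀ hw₀
    refine ⟨c, fun p hp => hg.eq_mul_of_cosCoeff_eq hX (fun n hn r hr => ?_) hp⟩
    have hrS := radii_subset_nbhd hr
    by_cases hnm : n = m
    · subst hnm
      rw [hgw₀ r hr, hc r hrS, hh, cosCoeff_modeFun_self hn, hwv r hrS, mul_div_assoc]
    · obtain ⟨w', hw', hgw'⟩ := hsol n hn
      rw [hgw' r hr, hother n hn hnm w' hw' r hrS, hh, cosCoeff_modeFun_of_ne hnm, zero_div,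
        mul_zero]
  · rintro ⟨c, hc⟩ p hp
    have hcoef : ∀ n : ℕ, ∀ r ∈ radii R₁ R₂ ε, cosCoeff n g r = c * cosCoeff n h r :=
      fun n r hr => cosCoeff_eq_mul (fun θ => hc (r, θ) ⟨hr, mem_univ θ⟩) n
    have hzero : ∀ n : ℕ, linTerm r₁ r₂ (circulation A B r₁ r₂) (vorticity Θ A R₁ R₂ ε κ) lam g p
        (n + 1) = 0 := fun n => by
      unfold linTerm
      refine mul_eq_zero_of_right _ ?_
      by_cases hnm : n + 1 = m
      · obtain ⟨K, hK⟩ := hg.exists_abs_cosCoeff_le_const (n := n + 1) (by omega)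
        rw [← hnm] at hv
        refine modeOp_of_isModeSol (c := c) hΘ hκ hκ' hε (by omega)
          (continuousOn_cosCoeff hg.continuousOn _) hK hd0 hv (fun r hr => ?_) hp.1
        rw [hcoef _ r hr, hh, hnm, cosCoeff_modeFun_self hm, hwv r (radii_subset_nbhd hr)]
      · refine modeOp_of_eq_zero hΘ hκ hκ' hε (by omega) (fun r hr => ?_) hp.1
        rw [hcoef _ r hr, hh, cosCoeff_modeFun_of_ne hnm, mul_zero]
    unfold linOp
    simp only [hzero, tsum_zero]

end LinearizedOperator

/-! ### Uniformity over finitely many modes and conclusion -/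

/-- Positive constants for finitely many monotone statements can be chosen uniformly. -/
lemma exists_uniform_constants {Q : ℕ → ℝ → ℝ → ℝ → Prop}
    (hmono : ∀ m a b c a' b' c', a' ≤ a → b' ≤ b → c ≤ c' → Q m a b c → Q m a' b' c')
    (hQ : ∀ m : ℕ, 1 ≤ m → ∃ a > 0, ∃ c > 0, ∃ b > 0, Q m a b c) (N : ℕ) :
    ∃ a > 0, ∃ b > 0, ∃ c > 0, ∀ m : ℕ, 1 ≤ m → m ≤ N → Q m a b c := by
  induction N with
  | zero => exact ⟨1, one_pos, 1, one_pos, 1, one_pos, fun m h1 h2 => by omega⟩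
  | succ N ih =>
    obtain ⟨a, ha, b, hb, c, hc, h⟩ := ih
    obtain ⟨a', ha', c', hc', b', hb', h'⟩ := hQ (N + 1) (by omega)
    refine ⟨min a a', lt_min ha ha', min b b', lt_min hb hb', max c c', lt_max_of_lt_left hc,
      fun m h1 h2 => ?_⟩
    rcases h2.eq_or_lt with rfl | h2
    · exact hmono _ _ _ _ _ _ _ (min_le_right _ _) (min_le_right _ _) (le_max_right _ _) h'
    · exact hmono _ _ _ _ _ _ _ (min_le_left _ _) (min_le_left _ _) (le_max_left _ _)
        (h m h1 (by omega))

end TaylorCouette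

theorem theorem6p1
    (r₁ r₂ R₁ R₂ A B : ℝ) (hr₁ : 0 < r₁) (hrR : r₁ < R₁) (hR : R₁ < R₂) (hRr : R₂ < r₂)
    (hB : B ≠ 0) (hu : TaylorCouette.uTC A B R₁ ≠ TaylorCouette.uTC A B R₂)
    (Θ : ℝ → ℝ) (hΘ : TaylorCouette.IsMollifier Θ)
    (α : ℝ≥0) (hα₀ : 0 < α) (hα₁ : α < 1)
    (M : ℝ) (hM : 1 < M) :
    ∃ κ₀ > (0 : ℝ), ∃ ε₀ > (0 : ℝ), ∃ C > (0 : ℝ),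
      ∀ κ : ℝ, 0 < κ → κ < κ₀ → ∀ m : ℕ, 1 ≤ m → (m : ℝ) < M →
        -- the coefficient `lam₁` depends on `κ` and `m`, but not on `ε`
        ∃ lam₁ : ℝ, |lam₁| ≤ C ∧
          ∀ ε : ℝ, 0 < ε → ε < ε₀ →
            ∃ (lam : ℝ) (h : ℝ × ℝ → ℝ),
              |lam - (TaylorCouette.uTC A B R₂ / R₂ + lam₁ * ε)| ≤ C * ε ^ 2 ∧
              TaylorCouette.MemX α R₁ R₂ ε h ∧
              TaylorCouette.IsCInfty (TaylorCouette.dom R₁ R₂ ε) h ∧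
              (∀ r ∈ TaylorCouette.radii R₁ R₂ ε, ∀ θ : ℝ,
                h (r, θ + 2 * Real.pi / m) = h (r, θ)) ∧
              (∃ p ∈ TaylorCouette.dom R₁ R₂ ε, h p ≠ 0) ∧
              (∃ r ∈ TaylorCouette.radii R₁ R₂ ε, ∃ θ₁ θ₂ : ℝ, h (r, θ₁) ≠ h (r, θ₂)) ∧
              -- the series defining the operator converges on `X(D_ε)`
              (∀ g : ℝ × ℝ → ℝ, TaylorCouette.MemX α R₁ R₂ ε g →
                ∀ p ∈ TaylorCouette.dom R₁ R₂ ε,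
                  Summable fun n : ℕ =>
                    TaylorCouette.linTerm r₁ r₂ (TaylorCouette.circulation A B r₁ r₂)
                      (TaylorCouette.vorticity Θ A R₁ R₂ ε κ) lam g p (n + 1)) ∧
              -- the kernel of the operator on `X(D_ε)` is the span of `h`
              (∀ g : ℝ × ℝ → ℝ, TaylorCouette.MemX α R₁ R₂ ε g →
                ((∀ p ∈ TaylorCouette.dom R₁ R₂ ε,
                    TaylorCouette.linOp r₁ r₂ (TaylorCouette.circulation A B r₁ r₂)
                      (TaylorCouette.vorticity Θ A R₁ R₂ ε κ) lam g p = 0) ↔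
                  ∃ c : ℝ, ∀ p ∈ TaylorCouette.dom R₁ R₂ ε, g p = c * h p)) := by

  obtain ⟨κ₀, hκ₀, ε₀, hε₀, C, hC, hall⟩ := TaylorCouette.exists_uniform_constants
    (Q := fun m κ₀ ε₀ C => ∀ κ : ℝ, 0 < κ → κ < κ₀ → ∃ lam₁ : ℝ, |lam₁| ≤ C ∧
      ∀ ε : ℝ, 0 < ε → ε < ε₀ → κ ≤ 1 / 4 ∧ TaylorCouette.Admissible r₁ r₂ R₁ R₂ ε ∧ ∃ lam : ℝ,
        |lam - (TaylorCouette.uTC A B R₂ / R₂ + lam₁ * ε)| ≤ C * ε ^ 2 ∧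
        TaylorCouette.SpectralStatement Θ r₁ r₂ R₁ R₂ A B ε κ lam m)
    (fun m a b c a' b' c' haa hbb hcc h κ hκ hκ' => by
      obtain ⟨lam₁, h1, h2⟩ := h κ hκ (hκ'.trans_le haa)
      refine ⟨lam₁, h1.trans hcc, fun ε hε hε' => ?_⟩
      obtain ⟨h3, h4, lam, h5, h6⟩ := h2 ε hε (hε'.trans_le hbb)
      exact ⟨h3, h4, lam, h5.trans (mul_le_mul_of_nonneg_right hcc (sq_nonneg ε)), h6⟩)
    (fun m hm => TaylorCouette.exists_spectralStatement hΘ A hB hr₁ hrR hR hRr hm) ⌈M⌉₊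
  refine ⟨κ₀, hκ₀, ε₀, hε₀, C, hC, fun κ hκ hκ' m hm hmM => ?_⟩
  -- Only finitely many modes lie below `M`, so the constants for `1 ≤ m ≤ ⌈M⌉₊` serve them all.
  have hmN : m ≤ ⌈M⌉₊ := by exact_mod_cast hmM.le.trans (Nat.le_ceil M)
  obtain ⟨lam₁, h1, h2⟩ := hall m hm hmN κ hκ hκ'
  refine ⟨lam₁, h1, fun ε hε hε' => ?_⟩
  obtain ⟨h3, h4, lam, h5, h6⟩ := h2 ε hε hε'
  obtain ⟨h, hh⟩ := h6.exists_kernel (α := α) hΘ hκ h3 h4 hα₁ hm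
  exact ⟨lam, h, h5, hh⟩
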